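/- **Model.** All algorithms are deterministic programs of a fixed length for the unit-cost word RAM (arithmetic, bitwise operations, shifts, indirect loads and stores, conditional jumps), whose words have $O(n)$ bits on $k$-SAT instances with $n$ variables, and $O(\log (nd))$ bits on the instances below. **SETH.** For every $\delta>0$ there is a $k$ such that no algorithm decides the satisfiability of $k$-CNF formulas with $n$ variables (and pairwise different clauses) in time $O(2^{(1-\delta)n})$. **Threshold Vectors Product Problem (TVPP).** Given two sets $A,B\subseteq\{0,1\}^d$ with $|A|=|B|=n$ and a threshold $t\in\{1,\dots,n\}$, decide whether there are $a\in A$, $b\in B$ with $a^{T}b\ge t$. **Lemma.** Assume SETH. Let $d:\mathbb N\to\mathbb N$ be any function with $d(n)=\omega(\log n)$, and let $\varepsilon>0$. Then TVPP requires $\Omega(n^{2-\varepsilon})$ time in dimension $d(n)$, in the following sense. 1. No algorithm solves, in time $O(n^{2-\varepsilon})$, all instances of TVPP in which the $n$-element sets consist of vectors of dimension at most $d(n)$. 2. If $d(n)$ can be computed from $n$ in time $O(n^{2-\delta})$ for some $\delta>0$ (on words of $O(\log n)$ bits), then no algorithm solves, in time $O(n^{2-\varepsilon})$, all instances of TVPP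 in which the $n$-element sets consist of vectors of dimension exactly $d(n)$. -/

import Mathlib

/-! ### The word RAM -/

namespace WordRAM

/-- The arithmetical and bitwise operations on words. -/
inductive BinOp where
  | add | sub | mul | div | mod | and | or | xor | shl | shr

/-- The value of an operation (`sub` is truncated at `0`, division by `0` gives `0`). -/
def BinOp.eval : BinOp → ℕ → ℕ → ℕ
  | .add, x, y => x + y
  | .sub, x, y => x - y
  | .mul, x, y => x * y
  | .div, x, y => x / y
  | .mod, x, y => x % y
  | .and, x, y => x &&& y
  | .or, x, y => x ||| y
  | .xor, x, y => x ^^^ y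
  | .shl, x, y => x <<< y
  | .shr, x, y => x >>> y

/-- Instructions. Registers are named by numbers; a program mentions only finitely many of them.
* `const r v`: put the constant `v` into register `r`;
* `op o r s u`: put `o` of the contents of registers `s`, `u` into register `r`;
* `load r s`: put the memory cell whose address is in register `s` into register `r`;
* `store r s`: put register `s` into the memory cell whose address is in register `r`;
* `jz r l`: continue with line `l` if register `r` is zero. -/
inductive Instr where
  | const (r v : ℕ)
  | op (o : BinOp) (r s u : ℕ)
  | load (r s : ℕ)
  | store (r s : ℕ)
  | jz (r l : ℕ)

/-- A program is a finite list of instructions. -/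
abbrev Program := List Instr

/-- A configuration: program counter, registers and memory. -/
structure State where
  pc : ℕ
  reg : ℕ → ℕ
  mem : ℕ → ℕ

/-- The effect of one instruction. -/
def Instr.exec (s : State) : Instr → State
  | .const r v => ⟨s.pc + 1, Function.update s.reg r v, s.mem⟩
  | .op o r x y => ⟨s.pc + 1, Function.update s.reg r (o.eval (s.reg x) (s.reg y)), s.mem⟩
  | .load r x => ⟨s.pc + 1, Function.update s.reg r (s.mem (s.reg x)), s.mem⟩
  | .store r x => ⟨s.pc + 1, s.reg, Function.update s.mem (s.reg r) (s.reg x)⟩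
  | .jz r l => ⟨if s.reg r = 0 then l else s.pc + 1, s.reg, s.mem⟩

/-- One step; the machine has halted, and stays as it is, once the program counter is past the
last line of the program. -/
def step (p : Program) (s : State) : State :=
  match p[s.pc]? with
  | none => s
  | some i => i.exec s

/-- The initial configuration: the input in the first memory cells, everything else `0`. -/
def init (x : List ℕ) : State := ⟨0, fun _ => 0, fun a => x.getD a 0⟩

/-- The configuration after `t` steps on input `x`. -/
def run (p : Program) (x : List ℕ) (t : ℕ) : State := (step p)^[t] (init x)

/-- On input `x`, the program `p` halts within `T` steps with `out` in register `0`, and all words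
that occur in registers and memory in the course of the computation have at most `w` bits. -/
def Outputs (p : Program) (x : List ℕ) (T : ℝ) (w out : ℕ) : Prop :=
  ∃ t : ℕ, (t : ℝ) ≤ T ∧ p.length ≤ (run p x t).pc ∧ (run p x t).reg 0 = out ∧
    ∀ s ≤ t, ∀ a, (run p x s).reg a < 2 ^ w ∧ (run p x s).mem a < 2 ^ w

/-- On input `x`, the program `p` decides correctly whether `P` holds (output `1` for yes and `0`
for no), within `T` steps on words of `w` bits. -/
def Decides (p : Program) (x : List ℕ) (T : ℝ) (w : ℕ) (P : Prop) : Prop :=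
  (P → Outputs p x T w 1) ∧ (¬ P → Outputs p x T w 0)

end WordRAM

/-! ### `k`-SAT and the Strong Exponential Time Hypothesis -/

/-- A clause of a `k`-CNF formula in the variables `0, …, n - 1`: a disjunction of `k` literals, in
which repetitions are allowed. The literal `(v, true)` is the variable `v`, and `(v, false)` is its
negation. -/
abbrev KClause (k n : ℕ) := Fin k → Fin n × Bool

/-- A `k`-CNF formula in `n` variables: a conjunction of pairwise different clauses. -/
structure KCNF (k n : ℕ) where
  clauses : List (KClause k n)
  nodup : clauses.Nodup

/-- Satisfiability. -/
def KCNF.Satisfiable {k n : ℕ} (φ : KCNF k n) : Prop :=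
  ∃ σ : Fin n → Bool, ∀ c ∈ φ.clauses, ∃ i, σ (c i).1 = (c i).2

/-- The input for a machine: `n`, the number of clauses, and the clauses one after the other, each
literal in one word. -/
def KCNF.encode {k n : ℕ} (φ : KCNF k n) : List ℕ :=
  [n, φ.clauses.length] ++
    φ.clauses.flatMap (fun c => List.ofFn (fun i => 2 * ((c i).1 : ℕ) + (c i).2.toNat))

/-- `k`-SAT in `n` variables can be solved in time `O(T(n))` on words of `O(n)` bits. -/
def KSATInTime (k : ℕ) (T : ℕ → ℝ) : Prop :=
  ∃ (p : WordRAM.Program) (c : ℕ) (C : ℝ), ∀ (n : ℕ) (φ : KCNF k n),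
    WordRAM.Decides p φ.encode (C * T n) (c * (n + 1)) φ.Satisfiable

/-- The Strong Exponential Time Hypothesis: for every `ε > 0` there is a `k` such that `k`-SAT in
`n` variables cannot be solved in time `O(2^((1-ε)n))`. -/
def SETH : Prop :=
  ∀ ε : ℝ, 0 < ε → ∃ k : ℕ, ¬ KSATInTime k (fun n => (2 : ℝ) ^ ((1 - ε) * (n : ℝ)))

/-! ### The Threshold Vectors Product Problem -/

/-- The inner product of two binary vectors. -/
def binDot {d : ℕ} (a b : Fin d → Bool) : ℕ := ∑ k, (a k).toNat * (b k).toNat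

/-- An instance: two sets of `n` binary vectors each, listed without repetition, and a threshold
`t` in `{1, …, n}`. -/
structure TVPP (n d : ℕ) where
  A : Fin n → Fin d → Bool
  B : Fin n → Fin d → Bool
  t : ℕ
  A_injective : Function.Injective A
  B_injective : Function.Injective B
  one_le_t : 1 ≤ t
  t_le : t ≤ n

/-- The question: is there a pair with inner product at least `t`? -/
def TVPP.IsYes {n d : ℕ} (I : TVPP n d) : Prop := ∃ i j, I.t ≤ binDot (I.A i) (I.B j)

/-- A binary matrix, row by row, one entry in each word. -/
def encodeRows {n d : ℕ} (M : Fin n → Fin d → Bool) : List ℕ :=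
  (List.ofFn (fun i => List.ofFn (fun k => (M i k).toNat))).flatten

/-- The input for a machine. -/
def TVPP.encode {n d : ℕ} (I : TVPP n d) : List ℕ :=
  [n, d, I.t] ++ encodeRows I.A ++ encodeRows I.B

/-- The Threshold Vectors Product Problem, restricted to the instances whose number of vectors `n`
and dimension `d` satisfy `D n d`, can be solved in time `O(T(n))` on words of `O(log (n d))`
bits. -/
def TVPPInTime (D : ℕ → ℕ → Prop) (T : ℕ → ℝ) : Prop :=
  ∃ (p : WordRAM.Program) (c : ℕ) (C : ℝ), ∀ (n d : ℕ), D n d → ∀ I : TVPP n d,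
    WordRAM.Decides p I.encode (C * T n) (c * (Nat.log 2 (n * d) + 1)) I.IsYes

/-- The function `d` can be computed in time `O(n^(2-δ))` for some `δ > 0`, on words of `O(log n)`
bits. -/
def SubquadraticTimeComputable (d : ℕ → ℕ) : Prop :=
  ∃ (p : WordRAM.Program) (c : ℕ) (C δ : ℝ), 0 < δ ∧ ∀ n : ℕ, 1 ≤ n →
    WordRAM.Outputs p [n] (C * (n : ℝ) ^ (2 - δ)) (c * (Nat.log 2 n + 1)) (d n)

/-! The proof is sparsification followed by split-and-list, carried out in full on the word RAM.

Split-and-list. For a formula in at most `2h` variables, list the `N = 2^h` assignments of each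
half. Every clause gets two columns: a vector of the first half carries `(hit, 1 - hit)`, a vector
of the second half `(1, hit)`. The two columns contribute `hit_A + (1 - hit_A) * hit_B`, the truth
value of "one of the halves satisfies the clause". So the inner product counts satisfied clauses,
and the formula is satisfiable iff some pair reaches the number of clauses (`le_binDot_iff`,
`inst_isYes`). Some tautologies (`dummies`) are added so that the vectors of each set are pairwise
different. The dimension is linear in the number of clauses. It has to be `O(h) = O(log N)`, with a
constant that depends on `k` and `ε` only; every such constant is admissible because `d(N)` exceeds
all multiples of `log N`. A `k`-CNF can have about `n^k` clauses, hence the sparsification.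

Sparsification. Clauses are sets of literals and are added one at a time to a list of kept clauses.
If the new clause `C` completes a flower, that is, if a nonempty proper subset `H` of `C` lies in
very many kept clauses of the size of `C`, the search branches: either the heart `H` is satisfied,
or all petals `D \ H` are. An assignment satisfies the formula iff it satisfies some leaf
(`hits_leaves`). A clause of size `c` weighs `2^(q(k-c))`; the potential counts kept clauses twice
and live pending clauses once. The degree bounds keep it below `maxPot = O(h)` (`Inv.pot_le`).
Keeping a clause or branching to a heart raises it by at least `1` (`Popped.pot_accept`,
`Popped.pot_heart`), branching to petals by at least `2^(qk-σ-1)` (`Popped.pot_petals`). Hence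
leaves have `O(h)` clauses, the depth is `O(h)`, and the number of leaves obeys `ℓ(p) ≤ ℓ(p+1) +
ℓ(p+b+1)` with `b+1 = 2^(qk-σ-1)`. Petal branches are rare, and for large `q` this gives at most
`2^(ηh)` leaves (`length_leaves_le`, `exists_params`).

The machine. The tree is never stored. Each leaf owns a dyadic interval, whose starting point
determines the path to the leaf; the path is recomputed in polynomial time
(`Tree.exists_enumeration`, `sparsify_spec`). Then the instance of the leaf is written into fresh
memory, and the assumed TVPP program is simulated there with shifted addresses (`Cmd.Ho.sim`). The
whole is written in a small structured language whose compilation keeps account of time and word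
size (`Cmd.code_correct`). With `η = ε/4` the total time is `2^(ηh) * poly(h) * N^(2-ε)`, which is
`O(2^((1-ε/4)n))` (`ksatInTime_of_solver`) and contradicts SETH. For the first assertion the
dimension used is `K * h`; for the second it is `d(2^h)`, computed once by the given program. -/

set_option linter.unusedSimpArgs false

namespace WordRAM

/-! ### Reachability with time and word size -/

/-- All words of a configuration have at most `w` bits. -/
def State.Bounded (w : ℕ) (a : State) : Prop := ∀ i, a.reg i < 2 ^ w ∧ a.mem i < 2 ^ w

/-- The program leads from `a` to `b` within `T` steps on words of `w` bits. -/
def Reach (p : Program) (w T : ℕ) (a b : State) : Prop :=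
  ∃ t ≤ T, (step p)^[t] a = b ∧ ∀ j ≤ t, ((step p)^[j] a).Bounded w

lemma Reach.refl {p w a} (h : State.Bounded w a) (T : ℕ) : Reach p w T a a :=
  ⟨0, Nat.zero_le _, rfl, fun j hj => by obtain rfl : j = 0 := by omega
                                         exact h⟩

lemma Reach.trans {p w T₁ T₂ a b c} (h₁ : Reach p w T₁ a b) (h₂ : Reach p w T₂ b c) :
    Reach p w (T₁ + T₂) a c := by
  obtain ⟨t₁, ht₁, rfl, hb₁⟩ := h₁
  obtain ⟨t₂, ht₂, rfl, hb₂⟩ := h₂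
  refine ⟨t₁ + t₂, by omega, by rw [add_comm, Function.iterate_add_apply], fun j hj => ?_⟩
  by_cases h : j ≤ t₁
  · exact hb₁ j h
  · have := hb₂ (j - t₁) (by omega)
    rwa [← Function.iterate_add_apply, Nat.sub_add_cancel (by omega)] at this

lemma Reach.mono {p w T₁ T₂ a b} (h : Reach p w T₁ a b) (hT : T₁ ≤ T₂) : Reach p w T₂ a b := by
  obtain ⟨t, ht, h⟩ := h
  exact ⟨t, ht.trans hT, h⟩

lemma Reach.bounded_right {p w T a b} (h : Reach p w T a b) : State.Bounded w b := by
  obtain ⟨t, ht, rfl, hb⟩ := h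
  exact hb t le_rfl

lemma Reach.exec {p : Program} {w} {a : State} {i : Instr} (hi : p[a.pc]? = some i)
    (ha : State.Bounded w a) (hb : State.Bounded w (i.exec a)) : Reach p w 1 a (i.exec a) := by
  have h1 : step p a = i.exec a := by simp [step, hi]
  refine ⟨1, le_rfl, by simpa using h1, fun j hj => ?_⟩
  interval_cases j
  · exact ha
  · simpa [h1] using hb

/-- The code `l` stands in the program from line `o` on. -/
def At (p : Program) (o : ℕ) (l : List Instr) : Prop := ∀ i, i < l.length → p[o + i]? = l[i]?

lemma at_append {p : Program} {o : ℕ} {c d : List Instr} :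
    At p o (c ++ d) ↔ At p o c ∧ At p (o + c.length) d := by
  constructor
  · intro h
    constructor
    · intro i hi
      rw [h i (by simp; omega), List.getElem?_append_left hi]
    · intro i hi
      rw [add_assoc, h (c.length + i) (by simpa using hi), List.getElem?_append_right (by omega)]
      simp
  · rintro ⟨h₁, h₂⟩ i hi
    by_cases hc : i < c.length
    · rw [h₁ i hc, List.getElem?_append_left hc]
    · have := h₂ (i - c.length) (by simp at hi; omega)
      rw [List.getElem?_append_right (by omega), ← this]
      congr 1
      omega

lemma at_cons {p : Program} {o : ℕ} {i : Instr} {d : List Instr} :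
    At p o (i :: d) ↔ p[o]? = some i ∧ At p (o + 1) d := by
  rw [← List.singleton_append, at_append]
  simp only [List.length_singleton, and_congr_left_iff]
  intro _
  constructor
  · intro h
    simpa using h 0 (by simp)
  · intro h j hj
    obtain rfl : j = 0 := by simpa using hj
    simpa using h

lemma At.flatMap {p : Program} {α : Type*} {g : α → List Instr} {m : ℕ} (hg : ∀ a, (g a).length = m)
    {l : List α} : ∀ {o : ℕ}, At p o (l.flatMap g) → ∀ {i : ℕ} {a : α}, l[i]? = some a →
      At p (o + m * i) (g a) := by
  induction l with
  | nil => simp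
  | cons b l ih =>
    intro o h i a hi
    rw [List.flatMap_cons, at_append, hg] at h
    cases i with
    | zero =>
      obtain rfl : b = a := by simpa using hi
      simpa using h.1
    | succ i =>
      have := ih h.2 (i := i) (a := a) (by simpa using hi)
      rwa [show o + m * (i + 1) = o + m + m * i by ring]

/-! ### Expressions and commands -/

/-- Expressions over named registers. -/
inductive Expr (V : Type) where
  | num (v : ℕ)
  | var (r : V)
  | bin (o : BinOp) (a b : Expr V)
  | get (a : Expr V)

/-- Commands of a structured language. `loop e c` repeats `c` as long as `e` is not zero, and
`sim p b r` runs the program `p` with all addresses shifted by the contents of `b`, and puts its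
output into `r`. -/
inductive Cmd (V : Type) where
  | skip
  | set (r : V) (e : Expr V)
  | put (a e : Expr V)
  | seq (c d : Cmd V)
  | ite (e : Expr V) (c d : Cmd V)
  | loop (e : Expr V) (c : Cmd V)
  | sim (p : Program) (b r : V)

/-- Named registers and memory. -/
structure Store (V : Type) where
  reg : V → ℕ
  mem : ℕ → ℕ

/-- The operations that can increase the number of bits. -/
def BinOp.Grows : BinOp → Prop
  | .add | .mul | .shl => True
  | _ => False

lemma BinOp.eval_lt {o : BinOp} {w x y : ℕ} (hx : x < 2 ^ w) (hy : y < 2 ^ w)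
    (h : o.Grows → o.eval x y < 2 ^ w) : o.eval x y < 2 ^ w := by
  cases o
  case add | mul | shl => exact h trivial
  case sub => exact (Nat.sub_le _ _).trans_lt hx
  case div => exact (Nat.div_le_self _ _).trans_lt hx
  case mod => exact (Nat.mod_le _ _).trans_lt hx
  case and => exact Nat.and_le_left.trans_lt hx
  case or => exact Nat.or_lt_two_pow hx hy
  case xor => exact Nat.xor_lt_two_pow hx hy
  case shr => exact (Nat.shiftRight_le _ _).trans_lt hx

variable {V : Type}

/-- The value of an expression. -/
def Expr.val (s : Store V) : Expr V → ℕ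
  | .num v => v
  | .var r => s.reg r
  | .bin o a b => o.eval (a.val s) (b.val s)
  | .get a => s.mem (a.val s)

/-- All values that occur in the evaluation of an expression have at most `w` bits, provided that
registers and memory cells have. -/
def Expr.Fits (w : ℕ) (s : Store V) : Expr V → Prop
  | .num v => v < 2 ^ w
  | .var _ => True
  | .bin o a b => a.Fits w s ∧ b.Fits w s ∧ (o.Grows → o.eval (a.val s) (b.val s) < 2 ^ w)
  | .get a => a.Fits w s

/-- The number of instructions for the evaluation of an expression. -/
def Expr.cost : Expr V → ℕ
  | .num _ => 1
  | .var _ => 1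
  | .bin _ a b => a.cost + b.cost + 1
  | .get a => a.cost + 1

/-- Code that evaluates an expression into register `t`, using the registers from `t` on. -/
def Expr.code (idx : V → ℕ) : Expr V → ℕ → List Instr
  | .num v, t => [.const t v]
  -- Since `x ||| x = x`, this copies a register, and it cannot overflow the word.
  | .var r, t => [.op .or t (idx r) (idx r)]
  | .bin o a b, t => a.code idx t ++ (b.code idx (t + 1) ++ [.op o t t (t + 1)])
  | .get a, t => a.code idx t ++ [.load t t]

lemma Expr.length_code (idx : V → ℕ) (e : Expr V) : ∀ t, (e.code idx t).length = e.cost := by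
  induction e with
  | num | var => intro t; rfl
  | bin o a b iha ihb => intro t; simp [code, cost, iha, ihb]; omega
  | get a iha => intro t; simp [code, cost, iha]

/-- All words of a store have at most `w` bits. -/
def Store.Bounded (w : ℕ) (s : Store V) : Prop := (∀ r, s.reg r < 2 ^ w) ∧ ∀ a, s.mem a < 2 ^ w

lemma Expr.val_lt {w : ℕ} {s : Store V} (hs : s.Bounded w) :
    ∀ {e : Expr V}, e.Fits w s → e.val s < 2 ^ w
  | .num _, h => h
  | .var _, _ => hs.1 _
  | .bin _ _ _, h => BinOp.eval_lt (val_lt hs h.1) (val_lt hs h.2.1) h.2.2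
  | .get _, _ => hs.2 _

/-- The configuration `L` holds the store `s`, with the register `r` in register `idx r`. -/
structure Holds (w : ℕ) (idx : V → ℕ) (L : State) (s : Store V) : Prop where
  reg : ∀ r, L.reg (idx r) = s.reg r
  mem : L.mem = s.mem
  bounded : L.Bounded w

lemma Holds.store_bounded {w} {idx : V → ℕ} {L s} (h : Holds w idx L s) : s.Bounded w :=
  ⟨fun r => h.reg r ▸ (h.bounded _).1, fun a => h.mem ▸ (h.bounded a).2⟩

lemma State.Bounded.update {w a} (h : State.Bounded w a) {v : ℕ} (hv : v < 2 ^ w) (r pc : ℕ) :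
    State.Bounded w ⟨pc, Function.update a.reg r v, a.mem⟩ := by
  intro i
  refine ⟨?_, (h i).2⟩
  by_cases hi : i = r
  · subst hi; simpa using hv
  · simpa [hi] using (h i).1

lemma State.Bounded.update_mem {w a} (h : State.Bounded w a) {v : ℕ} (hv : v < 2 ^ w) (r pc : ℕ) :
    State.Bounded w ⟨pc, a.reg, Function.update a.mem r v⟩ := by
  intro i
  refine ⟨(h i).1, ?_⟩
  by_cases hi : i = r
  · subst hi; simpa using hv
  · simpa [hi] using (h i).2

lemma State.Bounded.pc {w a} (h : State.Bounded w a) (pc : ℕ) :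
    State.Bounded w ⟨pc, a.reg, a.mem⟩ := h

/-- The evaluation behaves like a stack: registers below `t` survive, so the first operand, left in
`t`, is still there when the second has been evaluated into `t + 1`. The named registers all lie
below `t`. -/
theorem Expr.code_correct {p : Program} {w : ℕ} {idx : V → ℕ} {s : Store V} (e : Expr V) :
    ∀ {t o : ℕ} {L : State}, At p o (e.code idx t) → L.pc = o → (∀ r, idx r < t) →
      Holds w idx L s → e.Fits w s →
      ∃ L', Reach p w e.cost L L' ∧ L'.pc = o + e.cost ∧ L'.reg t = e.val s ∧
        (∀ i < t, L'.reg i = L.reg i) ∧ L'.mem = L.mem := by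
  induction e with
  | num v =>
    intro t o L hat hpc ht hL hf
    subst hpc
    rw [code, at_cons] at hat
    exact ⟨_, Reach.exec hat.1 hL.bounded (hL.bounded.update hf _ _), rfl,
      by simp [Instr.exec, val], fun i hi => by simp [Instr.exec, hi.ne], rfl⟩
  | var r =>
    intro t o L hat hpc ht hL hf
    subst hpc
    rw [code, at_cons] at hat
    refine ⟨_, Reach.exec hat.1 hL.bounded (hL.bounded.update ?_ _ _), rfl,
      by simp [Instr.exec, val, BinOp.eval, hL.reg],
      fun i hi => by simp [Instr.exec, hi.ne], rfl⟩
    simpa [BinOp.eval] using (hL.bounded _).1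
  | bin b e₁ e₂ ih₁ ih₂ =>
    intro t o L hat hpc ht hL hf
    rw [code, at_append, at_append, length_code, length_code, at_cons] at hat
    obtain ⟨L₁, hr₁, hpc₁, hv₁, hreg₁, hm₁⟩ := ih₁ hat.1 hpc ht hL hf.1
    have hL₁ : Holds w idx L₁ s :=
      ⟨fun r => by rw [hreg₁ _ (ht r), hL.reg], by rw [hm₁, hL.mem], hr₁.bounded_right⟩
    obtain ⟨L₂, hr₂, hpc₂, hv₂, hreg₂, hm₂⟩ :=
      ih₂ hat.2.1 hpc₁ (fun r => (ht r).trans (Nat.lt_succ_self t)) hL₁ hf.2.1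
    have hv : b.eval (L₂.reg t) (L₂.reg (t + 1)) = (bin b e₁ e₂).val s := by
      rw [hv₂, hreg₂ t (Nat.lt_succ_self t), hv₁, val]
    have hi := hat.2.2.1
    rw [← hpc₂] at hi
    have h3 := Reach.exec hi hr₂.bounded_right (hr₂.bounded_right.update (by
      rw [hv]; exact val_lt hL.store_bounded hf) _ _)
    refine ⟨_, ((hr₁.trans hr₂).trans h3).mono (by simp [cost]), by simp [Instr.exec, cost, hpc₂]; omega,
      by simp [Instr.exec, hv], fun i hi => ?_, by simp [Instr.exec, hm₂, hm₁]⟩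
    simp [Instr.exec, hi.ne, hreg₂ i (hi.trans (Nat.lt_succ_self t)), hreg₁ i hi]
  | get e ih =>
    intro t o L hat hpc ht hL hf
    rw [code, at_append, length_code, at_cons] at hat
    obtain ⟨L₁, hr₁, hpc₁, hv₁, hreg₁, hm₁⟩ := ih hat.1 hpc ht hL hf
    have hi := hat.2.1
    rw [← hpc₁] at hi
    have h3 := Reach.exec hi hr₁.bounded_right
      (hr₁.bounded_right.update (hr₁.bounded_right _).2 _ _)
    refine ⟨_, (hr₁.trans h3).mono (by simp [cost]), by simp [Instr.exec, cost, hpc₁]; omega,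
      by simp [Instr.exec, hv₁, hm₁, hL.mem, val], fun i hi => ?_, by simp [Instr.exec, hm₁]⟩
    simp [Instr.exec, hi.ne, hreg₁ i hi]

/-! ### Simulation of a program on a shifted memory -/

/-- A bound for the registers mentioned by an instruction. -/
def Instr.regs : Instr → ℕ
  | .const r _ => r + 1
  | .op _ r s u => r + s + u + 1
  | .load r s => r + s + 1
  | .store r s => r + s + 1
  | .jz r _ => r + 1

/-- A positive bound for the registers mentioned by a program. -/
def Program.regs (p : Program) : ℕ := (p.map Instr.regs).sum + 1

lemma Program.regs_le {p : Program} {i : Instr} (h : i ∈ p) : i.regs ≤ p.regs :=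
  (List.single_le_sum (by simp) _ (List.mem_map_of_mem h)).trans (Nat.le_succ _)

/-- The two instructions that simulate one: the register `r` is kept in register `K + 1 + r`, the
register `b` holds the shift, and the code starts in line `o`. -/
def Instr.shifted (L K o b : ℕ) : Instr → List Instr
  -- The second instruction is padding: each simulated instruction takes exactly two lines, so that
  -- line `l` is found at `o + 2 * l`.
  | .const r v => [.const (K + 1 + r) v, .const K 0]
  | .op f r s u => [.op f (K + 1 + r) (K + 1 + s) (K + 1 + u), .const K 0]
  | .load r s => [.op .add K b (K + 1 + s), .load (K + 1 + r) K]
  | .store r s => [.op .add K b (K + 1 + r), .store K (K + 1 + s)]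
  -- A target beyond the end of the program means halting; it is clamped to the first line after the
  -- simulated code.
  | .jz r l => [.jz (K + 1 + r) (o + 2 * min l L), .const K 0]

/-- The configuration `A` simulates the configuration `z`. -/
structure Simulates (w : ℕ) (L R K o b : ℕ) (A₀ A z : State) : Prop where
  pc : A.pc = o + 2 * min z.pc L
  reg : ∀ i < R, A.reg (K + 1 + i) = z.reg i
  mem : A.mem = fun a => if a < A₀.reg b then A₀.mem a else z.mem (a - A₀.reg b)
  low : ∀ i < K, A.reg i = A₀.reg i
  bounded : A.Bounded w

/-- Any register may be used as an address, therefore `hz` asks that every register plus the shift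
fits into a word, while `hz'` covers the words that the step produces. If the simulated machine has
halted, no instruction is executed at all; the bound `2` is only an upper bound. -/
lemma Instr.shifted_correct {p q : Program} {w K o b : ℕ} (hb : b < K) {A₀ A z : State}
    (hat : At q o (p.flatMap (Instr.shifted p.length K o b)))
    (h : Simulates w p.length p.regs K o b A₀ A z)
    (hz : ∀ a, z.reg a + A₀.reg b < 2 ^ w)
    (hz' : ∀ a, (step p z).reg a < 2 ^ w) :
    ∃ A', Reach q w 2 A A' ∧ Simulates w p.length p.regs K o b A₀ A' (step p z) := by
  rcases hi : p[z.pc]? with _ | i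
  · have : step p z = z := by simp [step, hi]
    rw [this]
    exact ⟨A, Reach.refl h.bounded _, h⟩
  have hstep : step p z = i.exec z := by simp [step, hi]
  rw [hstep] at hz' ⊢
  have hlt : z.pc < p.length := (List.getElem?_eq_some_iff.1 hi).1
  have hmem : i ∈ p := List.mem_of_getElem? hi
  have hR := Program.regs_le hmem
  have hcode := hat.flatMap (m := 2) (fun a => by cases a <;> rfl) hi
  have hpc : A.pc = o + 2 * z.pc := by rw [h.pc, min_eq_left hlt.le]
  rw [← hpc] at hcode
  have h2 : 0 < 2 ^ w := by positivity
  have hbA : A.reg b = A₀.reg b := h.low b hb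
  cases i with
  | const r v =>
    rw [shifted, at_cons, at_cons] at hcode
    simp only [regs] at hR
    have e₁ := Reach.exec hcode.1 h.bounded
      (h.bounded.update (by simpa [Instr.exec] using hz' r) _ _)
    have e₂ := Reach.exec (by simpa [Instr.exec] using hcode.2.1) e₁.bounded_right
      (e₁.bounded_right.update h2 _ _)
    refine ⟨_, e₁.trans e₂, ⟨?_, ?_, ?_, ?_, e₂.bounded_right⟩⟩
    · simp [Instr.exec, hpc]; omega
    · intro j hj
      simp [Instr.exec, Function.update_apply, h.reg j hj, show ¬ (K + 1 + j = K) by omega]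
    · simp [Instr.exec, h.mem]
    · intro j hj
      simp [Instr.exec, Function.update_apply, h.low j hj, show ¬ (j = K) by omega,
        show ¬ (j = K + 1 + r) by omega]
  | op f r s u =>
    rw [shifted, at_cons, at_cons] at hcode
    simp only [regs] at hR
    have hs := h.reg s (by omega)
    have hu := h.reg u (by omega)
    have e₁ := Reach.exec hcode.1 h.bounded
      (h.bounded.update (by rw [hs, hu]; simpa [Instr.exec] using hz' r) _ _)
    have e₂ := Reach.exec (by simpa [Instr.exec] using hcode.2.1) e₁.bounded_right
      (e₁.bounded_right.update h2 _ _)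
    refine ⟨_, e₁.trans e₂, ⟨?_, ?_, ?_, ?_, e₂.bounded_right⟩⟩
    · simp [Instr.exec, hpc]; omega
    · intro j hj
      simp [Instr.exec, Function.update_apply, h.reg j hj, show ¬ (K + 1 + j = K) by omega, hs, hu]
    · simp [Instr.exec, h.mem]
    · intro j hj
      simp [Instr.exec, Function.update_apply, h.low j hj, show ¬ (j = K) by omega,
        show ¬ (j = K + 1 + r) by omega]
  | load r s =>
    rw [shifted, at_cons, at_cons] at hcode
    simp only [regs] at hR
    have hs := h.reg s (by omega)
    have e₁ := Reach.exec hcode.1 h.bounded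
      (h.bounded.update (by rw [hs, hbA]; simpa [BinOp.eval, add_comm] using hz s) _ _)
    have e₂ := Reach.exec (by simpa [Instr.exec] using hcode.2.1) e₁.bounded_right
      (e₁.bounded_right.update (e₁.bounded_right _).2 _ _)
    refine ⟨_, e₁.trans e₂, ⟨?_, ?_, ?_, ?_, e₂.bounded_right⟩⟩
    · simp [Instr.exec, hpc]; omega
    · intro j hj
      simp [Instr.exec, Function.update_apply, h.reg j hj, show ¬ (K + 1 + j = K) by omega, hs,
        hbA, h.mem, BinOp.eval]
    · simp [Instr.exec, h.mem]
    · intro j hj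
      simp [Instr.exec, Function.update_apply, h.low j hj, show ¬ (j = K) by omega,
        show ¬ (j = K + 1 + r) by omega]
  | store r s =>
    rw [shifted, at_cons, at_cons] at hcode
    simp only [regs] at hR
    have hs := h.reg s (by omega)
    have hr := h.reg r (by omega)
    have e₁ := Reach.exec hcode.1 h.bounded
      (h.bounded.update (by rw [hr, hbA]; simpa [BinOp.eval, add_comm] using hz r) _ _)
    have e₂ := Reach.exec (by simpa [Instr.exec] using hcode.2.1) e₁.bounded_right
      (e₁.bounded_right.update_mem (e₁.bounded_right _).1 _ _)
    refine ⟨_, e₁.trans e₂, ⟨?_, ?_, ?_, ?_, e₂.bounded_right⟩⟩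
    · simp [Instr.exec, hpc]; omega
    · intro j hj
      simp [Instr.exec, Function.update_apply, h.reg j hj, show ¬ (K + 1 + j = K) by omega]
    · funext a
      simp only [Instr.exec, h.mem, Function.update_apply, hs, hr, hbA, BinOp.eval, if_true,
        show ¬ (K + 1 + s = K) by omega, if_false]
      by_cases ha : a < A₀.reg b
      · simp [ha, show ¬ (a = A₀.reg b + z.reg r) by omega]
      · simp only [ha, if_false]
        congr 1
        exact propext (by omega)
    · intro j hj
      simp [Instr.exec, Function.update_apply, h.low j hj, show ¬ (j = K) by omega]
  | jz r l =>
    rw [shifted, at_cons, at_cons] at hcode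
    simp only [regs] at hR
    have hr := h.reg r (by omega)
    have e₁ := Reach.exec hcode.1 h.bounded (h.bounded.pc _)
    by_cases h0 : z.reg r = 0
    · refine ⟨_, e₁.mono (by omega), ⟨?_, ?_, ?_, ?_, e₁.bounded_right⟩⟩
      · simp [Instr.exec, hr, h0]
      · intro j hj
        simp [Instr.exec, h.reg j hj]
      · simp [Instr.exec, h.mem]
      · intro j hj
        simp [Instr.exec, h.low j hj]
    · have e₂ := Reach.exec (by simpa [Instr.exec, hr, h0] using hcode.2.1) e₁.bounded_right
        (e₁.bounded_right.update h2 _ _)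
      refine ⟨_, e₁.trans e₂, ⟨?_, ?_, ?_, ?_, e₂.bounded_right⟩⟩
      · simp [Instr.exec, hpc, hr, h0]; omega
      · intro j hj
        simp [Instr.exec, Function.update_apply, h.reg j hj, show ¬ (K + 1 + j = K) by omega]
      · simp [Instr.exec, h.mem]
      · intro j hj
        simp [Instr.exec, Function.update_apply, h.low j hj, show ¬ (j = K) by omega]

lemma Instr.shifted_iterate {p q : Program} {w K o b : ℕ} (hb : b < K) {A₀ A z : State}
    (hat : At q o (p.flatMap (Instr.shifted p.length K o b)))
    (h : Simulates w p.length p.regs K o b A₀ A z) {t : ℕ}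
    (hz : ∀ j ≤ t, ∀ a, ((step p)^[j] z).reg a + A₀.reg b < 2 ^ w) :
    ∃ A', Reach q w (2 * t) A A' ∧
      Simulates w p.length p.regs K o b A₀ A' ((step p)^[t] z) := by
  induction t with
  | zero => exact ⟨A, Reach.refl h.bounded _, h⟩
  | succ t ih =>
    obtain ⟨A₁, hr₁, hs₁⟩ := ih (fun j hj => hz j (by omega))
    obtain ⟨A₂, hr₂, hs₂⟩ := shifted_correct hb hat hs₁ (hz t (by omega)) (fun a => by
      rw [← Function.iterate_succ_apply' (step p)]
      exact lt_of_le_of_lt (Nat.le_add_right _ _) (hz (t + 1) le_rfl a))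
    exact ⟨A₂, (hr₁.trans hr₂).mono (by omega), by rwa [Function.iterate_succ_apply']⟩

/-- Code that sets the registers `K, …, K + m - 1` to zero. -/
def zeroCode (K m : ℕ) : List Instr := (List.range m).map (fun i => .const (K + i) 0)

lemma zeroCode_correct {q : Program} {w K : ℕ} {m : ℕ} : ∀ {o : ℕ} {A : State},
    At q o (zeroCode K m) → A.pc = o → A.Bounded w →
    ∃ A', Reach q w m A A' ∧ A'.pc = o + m ∧ (∀ i < m, A'.reg (K + i) = 0) ∧
      (∀ i < K, A'.reg i = A.reg i) ∧ A'.mem = A.mem := by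
  induction m with
  | zero => exact fun _ hpc hb => ⟨_, Reach.refl hb _, hpc, by simp, by simp, rfl⟩
  | succ m ih =>
    intro o A hat hpc hb
    rw [zeroCode, List.range_succ, List.map_append, at_append] at hat
    obtain ⟨A₁, hr, hpc₁, hz, hlow, hm⟩ := ih hat.1 hpc hb
    have hc := hat.2
    simp only [List.length_map, List.length_range, List.map_cons, List.map_nil, at_cons] at hc
    have e := Reach.exec (hpc₁ ▸ hc.1) hr.bounded_right
      (hr.bounded_right.update (by positivity) _ _)
    refine ⟨_, hr.trans e, by simp [Instr.exec, hpc₁]; omega, fun i hi => ?_, fun i hi => ?_, hm⟩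
    · simp only [Instr.exec, Function.update_apply]
      split_ifs with h
      · rfl
      · exact hz i (by omega)
    · simp [Instr.exec, Function.update_apply, hlow i hi, show ¬ i = K + m by omega]

/-- Code for a simulation. -/
def simCode (p : Program) (K o b r : ℕ) : List Instr :=
  zeroCode K (p.regs + 1) ++ (p.flatMap (Instr.shifted p.length K (o + (p.regs + 1)) b) ++
    [.op .or r (K + 1) (K + 1)])

/-- The length of the code of a command. -/
def Cmd.len : Cmd V → ℕ
  | .skip => 0
  | .set _ e => e.cost + 1
  | .put a e => a.cost + e.cost + 1
  | .seq c d => c.len + d.len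
  | .ite e c d => e.cost + c.len + d.len + 3
  | .loop e c => e.cost + c.len + 3
  | .sim p _ _ => 2 * p.length + p.regs + 2

/-- The code of a command, to be placed at line `o`; the registers from `K` on are for
intermediate results. -/
def Cmd.code (idx : V → ℕ) (K : ℕ) : Cmd V → ℕ → List Instr
  | .skip, _ => []
  | .set r e, _ => e.code idx K ++ [.op .or (idx r) K K]
  | .put a e, _ => a.code idx K ++ (e.code idx (K + 1) ++ [.store K (K + 1)])
  | .seq c d, o => c.code idx K o ++ d.code idx K (o + c.len)
  | .ite e c d, o => e.code idx K ++ (.jz K (o + e.cost + c.len + 3) ::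
      (c.code idx K (o + e.cost + 1) ++ (.const K 0 :: .jz K (o + e.cost + c.len + d.len + 3) ::
        d.code idx K (o + e.cost + c.len + 3))))
  | .loop e c, o => e.code idx K ++ (.jz K (o + e.cost + c.len + 3) ::
      (c.code idx K (o + e.cost + 1) ++ [.const K 0, .jz K o]))
  | .sim p b r, o => simCode p K o (idx b) (idx r)

lemma length_flatMap_shifted (p : Program) (L K o b : ℕ) :
    (p.flatMap (Instr.shifted L K o b)).length = 2 * p.length := by
  induction p with
  | nil => rfl
  | cons i p ih =>
    rw [List.flatMap_cons, List.length_append, ih]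
    cases i <;> simp [Instr.shifted] <;> omega

lemma Cmd.length_code (idx : V → ℕ) (K : ℕ) (c : Cmd V) : ∀ o, (c.code idx K o).length = c.len := by
  induction c with
  | skip => intro o; rfl
  | set r e => intro o; simp [code, len, Expr.length_code]
  | put a e => intro o; simp [code, len, Expr.length_code]; omega
  | seq c d ihc ihd => intro o; simp [code, len, ihc, ihd]
  | ite e c d ihc ihd => intro o; simp [code, len, Expr.length_code, ihc, ihd]; omega
  | loop e c ihc => intro o; simp [code, len, Expr.length_code, ihc]; omega
  | sim p b r =>
    intro o
    simp only [code, len, simCode, zeroCode, List.length_append, length_flatMap_shifted,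
      List.length_map, List.length_range, List.length_singleton]
    omega

/-! ### Semantics of commands -/

variable [DecidableEq V]

/-- The start of a simulation with the given shift. -/
def Store.shifted (s : Store V) (b : ℕ) : State := ⟨0, fun _ => 0, fun a => s.mem (b + a)⟩

/-- Execution of a command on words of `w` bits, with its running time. -/
inductive Cmd.Exec (w : ℕ) : Cmd V → Store V → ℕ → Store V → Prop
  | skip {s} : Exec w .skip s 0 s
  | set {r e s} (h : e.Fits w s) :
      Exec w (.set r e) s (e.cost + 1) ⟨Function.update s.reg r (e.val s), s.mem⟩
  | put {a e s} (ha : a.Fits w s) (he : e.Fits w s) :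
      Exec w (.put a e) s (a.cost + e.cost + 1)
        ⟨s.reg, Function.update s.mem (a.val s) (e.val s)⟩
  | seq {c d s s' s'' t t'} (hc : Exec w c s t s') (hd : Exec w d s' t' s'') :
      Exec w (.seq c d) s (t + t') s''
  | ite_true {e c d s s' t} (he : e.Fits w s) (h : e.val s ≠ 0) (hc : Exec w c s t s') :
      Exec w (.ite e c d) s (e.cost + t + 3) s'
  | ite_false {e c d s s' t} (he : e.Fits w s) (h : e.val s = 0) (hd : Exec w d s t s') :
      Exec w (.ite e c d) s (e.cost + t + 3) s'
  | loop_false {e c s} (he : e.Fits w s) (h : e.val s = 0) :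
      Exec w (.loop e c) s (e.cost + 1) s
  | loop_true {e c s s' s'' t t'} (he : e.Fits w s) (h : e.val s ≠ 0) (hc : Exec w c s t s')
      (hl : Exec w (.loop e c) s' t' s'') : Exec w (.loop e c) s (e.cost + t + 3 + t') s''
  | sim {p b r s t}
      (hw : ∀ j ≤ t, ∀ a, ((step p)^[j] (s.shifted (s.reg b))).reg a + s.reg b < 2 ^ w)
      (hp : p.length ≤ ((step p)^[t] (s.shifted (s.reg b))).pc) :
      Exec w (.sim p b r) s (2 * t + p.regs + 2)
        ⟨Function.update s.reg r (((step p)^[t] (s.shifted (s.reg b))).reg 0),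
          fun a => if a < s.reg b then s.mem a else
            ((step p)^[t] (s.shifted (s.reg b))).mem (a - s.reg b)⟩

/-- The induction is over the execution, not over the command: a loop runs the same code again, and
in `loop_true` the unchanged hypothesis `hat₀` about its place serves the remaining rounds. An
unconditional jump is a `jz` on a register that has just been set to zero. -/
theorem Cmd.code_correct {q : Program} {w K : ℕ} {idx : V → ℕ} (hidx : Function.Injective idx)
    (hK : ∀ r, idx r < K) {c : Cmd V} {s s' : Store V} {t : ℕ} (h : Exec w c s t s') :
    ∀ {o : ℕ} {L : State}, At q o (c.code idx K o) → L.pc = o → Holds w idx L s →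
      ∃ L', Reach q w t L L' ∧ L'.pc = o + c.len ∧ Holds w idx L' s' := by
  have frame : ∀ {L L' : State} {s : Store V}, Holds w idx L s → (∀ i < K, L'.reg i = L.reg i) →
      L'.mem = L.mem → L'.Bounded w → Holds w idx L' s := fun hL h1 h2 h3 =>
    ⟨fun r => by rw [h1 _ (hK r), hL.reg], by rw [h2, hL.mem], h3⟩
  have h0 : 0 < 2 ^ w := by positivity
  induction h with
  | skip => exact fun _ hpc hL => ⟨_, Reach.refl hL.bounded _, hpc, hL⟩
  | @set r e s he =>
    intro o L hat hpc hL
    rw [code, at_append, Expr.length_code, at_cons] at hat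
    obtain ⟨L₁, hr₁, hpc₁, hv₁, hreg₁, hm₁⟩ := e.code_correct hat.1 hpc hK hL he
    have e₂ := Reach.exec (hpc₁ ▸ hat.2.1) hr₁.bounded_right
      (hr₁.bounded_right.update (by simpa [BinOp.eval] using (hr₁.bounded_right K).1) _ _)
    refine ⟨_, hr₁.trans e₂, by simp [Instr.exec, hpc₁, len]; omega, fun r' => ?_, ?_,
      e₂.bounded_right⟩
    · simp only [Instr.exec, Function.update_apply, hidx.eq_iff]
      split_ifs
      · simp [BinOp.eval, hv₁]
      · rw [hreg₁ _ (hK r'), hL.reg]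
    · simp [Instr.exec, hm₁, hL.mem]
  | @put a e s ha he =>
    intro o L hat hpc hL
    rw [code, at_append, at_append, Expr.length_code, Expr.length_code, at_cons] at hat
    obtain ⟨L₁, hr₁, hpc₁, hv₁, hreg₁, hm₁⟩ := a.code_correct hat.1 hpc hK hL ha
    have hL₁ := frame hL hreg₁ hm₁ hr₁.bounded_right
    obtain ⟨L₂, hr₂, hpc₂, hv₂, hreg₂, hm₂⟩ :=
      e.code_correct hat.2.1 hpc₁ (fun r => (hK r).trans (Nat.lt_succ_self K)) hL₁ he
    have e₃ := Reach.exec (hpc₂ ▸ hat.2.2.1) hr₂.bounded_right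
      (hr₂.bounded_right.update_mem (hr₂.bounded_right _).1 _ _)
    refine ⟨_, ((hr₁.trans hr₂).trans e₃), by simp [Instr.exec, hpc₂, len]; omega, fun r' => ?_,
      ?_, e₃.bounded_right⟩
    · simp [Instr.exec, hreg₂ _ ((hK r').trans (Nat.lt_succ_self K)), hL₁.reg]
    · simp [Instr.exec, hv₂, hreg₂ K (Nat.lt_succ_self K), hv₁, hm₂, hL₁.mem]
  | seq hc hd ihc ihd =>
    intro o L hat hpc hL
    rw [code, at_append, length_code] at hat
    obtain ⟨L₁, hr₁, hpc₁, hL₁⟩ := ihc hat.1 hpc hL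
    obtain ⟨L₂, hr₂, hpc₂, hL₂⟩ := ihd hat.2 hpc₁ hL₁
    exact ⟨L₂, hr₁.trans hr₂, by rw [hpc₂, len, add_assoc], hL₂⟩
  | @ite_true e c d s s' t he hne hc ih =>
    intro o L hat hpc hL
    rw [code, at_append, at_cons, at_append, at_cons, at_cons, Expr.length_code, length_code] at hat
    obtain ⟨L₁, hr₁, hpc₁, hv₁, hreg₁, hm₁⟩ := e.code_correct hat.1 hpc hK hL he
    have hL₁ := frame hL hreg₁ hm₁ hr₁.bounded_right
    have e₂ := Reach.exec (i := .jz K (o + e.cost + c.len + 3)) (by rw [hpc₁]; exact hat.2.1)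
      hr₁.bounded_right (hr₁.bounded_right.pc _)
    obtain ⟨L₃, hr₃, hpc₃, hL₃⟩ := ih (L := Instr.exec L₁ (.jz K (o + e.cost + c.len + 3)))
      hat.2.2.1 (by simp [Instr.exec, hv₁, hne, hpc₁])
      ⟨hL₁.reg, hL₁.mem, hL₁.bounded⟩
    have e₄ := Reach.exec (i := .const K 0)
      (by rw [hpc₃]; exact hat.2.2.2.1) hr₃.bounded_right
      (hr₃.bounded_right.update h0 _ _)
    have e₅ := Reach.exec (a := Instr.exec L₃ (.const K 0))
      (i := .jz K (o + e.cost + c.len + d.len + 3))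
      (by simpa [Instr.exec, hpc₃] using hat.2.2.2.2.1) e₄.bounded_right
      (e₄.bounded_right.pc _)
    refine ⟨_, ((((hr₁.trans e₂).trans hr₃).trans e₄).trans e₅).mono (by omega),
      by simp [Instr.exec, len]; omega, fun r => ?_, ?_, e₅.bounded_right⟩
    · simp [Instr.exec, (hK r).ne, hL₃.reg]
    · simp [Instr.exec, hL₃.mem]
  | @ite_false e c d s s' t he hne hd ih =>
    intro o L hat hpc hL
    rw [code, at_append, at_cons, at_append, at_cons, at_cons, Expr.length_code, length_code] at hat
    obtain ⟨L₁, hr₁, hpc₁, hv₁, hreg₁, hm₁⟩ := e.code_correct hat.1 hpc hK hL he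
    have hL₁ := frame hL hreg₁ hm₁ hr₁.bounded_right
    have e₂ := Reach.exec (i := .jz K (o + e.cost + c.len + 3)) (by rw [hpc₁]; exact hat.2.1)
      hr₁.bounded_right (hr₁.bounded_right.pc _)
    obtain ⟨L₃, hr₃, hpc₃, hL₃⟩ := ih (o := o + e.cost + c.len + 3)
      (L := Instr.exec L₁ (.jz K (o + e.cost + c.len + 3)))
      (by have := hat.2.2.2.2.2
          rwa [show o + e.cost + 1 + c.len + 1 + 1 = o + e.cost + c.len + 3 by omega] at this)
      (by simp [Instr.exec, hv₁, hne]) ⟨hL₁.reg, hL₁.mem, hL₁.bounded⟩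
    exact ⟨_, ((hr₁.trans e₂).trans hr₃).mono (by omega), by rw [hpc₃, len]; omega, hL₃⟩
  | @loop_false e c s he hne =>
    intro o L hat hpc hL
    rw [code, at_append, at_cons, at_append, at_cons, at_cons, Expr.length_code, length_code] at hat
    obtain ⟨L₁, hr₁, hpc₁, hv₁, hreg₁, hm₁⟩ := e.code_correct hat.1 hpc hK hL he
    have hL₁ := frame hL hreg₁ hm₁ hr₁.bounded_right
    have e₂ := Reach.exec (i := .jz K (o + e.cost + c.len + 3)) (by rw [hpc₁]; exact hat.2.1)
      hr₁.bounded_right (hr₁.bounded_right.pc _)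
    exact ⟨_, hr₁.trans e₂, by simp [Instr.exec, hv₁, hne, len]; omega, hL₁.reg, hL₁.mem,
      hL₁.bounded⟩
  | @loop_true e c s s' s'' t t' he hne hc hl ihc ihl =>
    intro o L hat hpc hL
    have hat₀ := hat
    rw [code, at_append, at_cons, at_append, at_cons, at_cons, Expr.length_code, length_code] at hat
    obtain ⟨L₁, hr₁, hpc₁, hv₁, hreg₁, hm₁⟩ := e.code_correct hat.1 hpc hK hL he
    have hL₁ := frame hL hreg₁ hm₁ hr₁.bounded_right
    have e₂ := Reach.exec (i := .jz K (o + e.cost + c.len + 3)) (by rw [hpc₁]; exact hat.2.1)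
      hr₁.bounded_right (hr₁.bounded_right.pc _)
    obtain ⟨L₃, hr₃, hpc₃, hL₃⟩ := ihc (L := Instr.exec L₁ (.jz K (o + e.cost + c.len + 3)))
      hat.2.2.1 (by simp [Instr.exec, hv₁, hne, hpc₁])
      ⟨hL₁.reg, hL₁.mem, hL₁.bounded⟩
    have e₄ := Reach.exec (i := .const K 0)
      (by rw [hpc₃]; exact hat.2.2.2.1) hr₃.bounded_right
      (hr₃.bounded_right.update h0 _ _)
    have e₅ := Reach.exec (a := Instr.exec L₃ (.const K 0)) (i := .jz K o)
      (by simpa [Instr.exec, hpc₃] using hat.2.2.2.2.1) e₄.bounded_right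
      (e₄.bounded_right.pc _)
    obtain ⟨L₆, hr₆, hpc₆, hL₆⟩ := ihl
      (L := Instr.exec (Instr.exec L₃ (.const K 0)) (.jz K o)) hat₀ (by simp [Instr.exec])
      ⟨fun r => by simp [Instr.exec, (hK r).ne, hL₃.reg], by simp [Instr.exec, hL₃.mem],
        e₅.bounded_right⟩
    exact ⟨_, (((((hr₁.trans e₂).trans hr₃).trans e₄).trans e₅).trans hr₆).mono (by omega),
      hpc₆, hL₆⟩
  | @sim p b r s t hw hp =>
    intro o L hat hpc hL
    rw [code, simCode, at_append, at_append, at_cons, length_flatMap_shifted] at hat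
    obtain ⟨L₁, hr₁, hpc₁, hz₁, hreg₁, hm₁⟩ := zeroCode_correct hat.1 hpc hL.bounded
    have hl : (zeroCode K (p.regs + 1)).length = p.regs + 1 := by simp [zeroCode]
    rw [hl] at hat
    obtain ⟨L₂, hr₂, hs₂⟩ := Instr.shifted_iterate (A₀ := L) (A := L₁) (w := w)
      (z := s.shifted (s.reg b)) (t := t) (hK b) hat.2.1
      ⟨by simpa [Store.shifted] using hpc₁,
        fun i hi => by rw [add_assoc, hz₁ _ (by omega)]; rfl,
        by
          funext a
          rw [hm₁, hL.reg]
          simp only [Store.shifted, hL.mem]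
          split_ifs with ha
          · rfl
          · rw [Nat.add_sub_cancel' (by omega)],
        hreg₁, hr₁.bounded_right⟩
      (fun j hj a => by rw [hL.reg]; exact hw j hj a)
    have hpc₂ : L₂.pc = o + (p.regs + 1) + 2 * p.length := by
      rw [hs₂.pc, min_eq_right hp]
    have hr0 : L₂.reg (K + 1) = ((step p)^[t] (s.shifted (s.reg b))).reg 0 :=
      hs₂.reg 0 (Nat.succ_pos _)
    have e₃ := Reach.exec (hpc₂ ▸ hat.2.2.1) hr₂.bounded_right
      (hr₂.bounded_right.update (by simpa [BinOp.eval] using (hr₂.bounded_right (K + 1)).1) _ _)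
    refine ⟨_, ((hr₁.trans hr₂).trans e₃).mono (by omega),
      by simp [Instr.exec, hpc₂, len]; omega, fun r' => ?_, ?_, e₃.bounded_right⟩
    · simp only [Instr.exec, Function.update_apply, hidx.eq_iff]
      split_ifs
      · simp [BinOp.eval, hr0]
      · rw [hs₂.low _ (hK r'), hL.reg]
    · simp [Instr.exec, hs₂.mem, hL.reg, hL.mem]

/-- A command gives a program. -/
theorem Cmd.exists_outputs {idx : V → ℕ} (hidx : Function.Injective idx) {K : ℕ}
    (hK : ∀ r, idx r < K) (c : Cmd V) {r₀ : V} (hr₀ : idx r₀ = 0) :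
    ∃ p : Program, ∀ (x : List ℕ) (w t : ℕ) (T : ℝ) (s' : Store V), (∀ v ∈ x, v < 2 ^ w) →
      Exec w c ⟨fun _ => 0, fun a => x.getD a 0⟩ t s' → (t : ℝ) ≤ T →
      Outputs p x T w (s'.reg r₀) := by
  refine ⟨c.code idx K 0, fun x w t T s' hx h hT => ?_⟩
  have hb : (init x).Bounded w := by
    intro i
    refine ⟨by simp [init], ?_⟩
    by_cases hi : i < x.length
    · simpa [init, hi] using hx _ (List.getElem_mem hi)
    · simp [init, not_lt.1 hi]
  obtain ⟨L, ⟨t', ht', rfl, hb'⟩, hpc, hL⟩ := code_correct hidx hK h (q := c.code idx K 0)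
    (o := 0) (L := init x) (fun i _ => by rw [zero_add]) rfl ⟨fun _ => rfl, rfl, hb⟩
  refine ⟨t', (Nat.cast_le.2 ht').trans hT, ?_, ?_, fun j hj a => hb' j hj a⟩
  · rw [length_code, run, hpc, zero_add]
  · rw [run, ← hL.reg, hr₀]

end WordRAM

/-! ### Finite sets of numbers as words -/

/-- The word whose bits are the elements of `A`. -/
def enc (A : Finset ℕ) : ℕ := ∑ i ∈ A, 2 ^ i

lemma testBit_enc (A : Finset ℕ) (i : ℕ) : (enc A).testBit i = decide (i ∈ A) := by
  rw [Bool.eq_iff_iff, ← Nat.mem_bitIndices, ← List.mem_toFinset, enc,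
    Finset.toFinset_bitIndices_sum_two_pow, decide_eq_true_iff]

lemma exists_enc (x : ℕ) : ∃ A, enc A = x :=
  ⟨_, Finset.sum_toFinset_bitIndices_two_pow x⟩

lemma enc_injective : Function.Injective enc := by
  intro A B h
  ext i
  have := congrArg (fun x => Nat.testBit x i) h
  simpa [testBit_enc] using this

lemma enc_and (A B : Finset ℕ) : enc A &&& enc B = enc (A ∩ B) := by
  apply Nat.eq_of_testBit_eq
  simp [testBit_enc]

lemma enc_or (A B : Finset ℕ) : enc A ||| enc B = enc (A ∪ B) := by
  apply Nat.eq_of_testBit_eq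
  simp [testBit_enc]

lemma enc_singleton (i : ℕ) : enc {i} = 2 ^ i := by simp [enc]

@[simp] lemma enc_empty : enc ∅ = 0 := rfl

lemma enc_eq_zero {A : Finset ℕ} : enc A = 0 ↔ A = ∅ := by
  rw [← enc_empty, enc_injective.eq_iff]

lemma enc_sub {A B : Finset ℕ} (h : B ⊆ A) : enc A - enc B = enc (A \ B) := by
  have := Finset.sum_sdiff h (f := fun i => 2 ^ i)
  simp only [enc]
  omega

lemma enc_range (n : ℕ) : enc (Finset.range n) = 2 ^ n - 1 := by
  rw [enc, Nat.geomSum_eq le_rfl, Nat.div_one]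

lemma enc_mono {A B : Finset ℕ} (h : A ⊆ B) : enc A ≤ enc B := Finset.sum_le_sum_of_subset h

lemma enc_lt {A : Finset ℕ} {n : ℕ} (h : A ⊆ Finset.range n) : enc A < 2 ^ n := by
  have := enc_mono h
  rw [enc_range] at this
  have : 0 < 2 ^ n := by positivity
  omega

lemma enc_and_eq_left {A B : Finset ℕ} : enc A &&& enc B = enc A ↔ A ⊆ B := by
  rw [enc_and, enc_injective.eq_iff, Finset.inter_eq_left]

lemma enc_and_eq_right {A B : Finset ℕ} : enc A &&& enc B = enc B ↔ B ⊆ A := by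
  rw [enc_and, enc_injective.eq_iff, Finset.inter_eq_right]

/-- `(x - 1) &&& c` is the largest submask of `c` below the submask `x`. -/
lemma le_pred_and {c : ℕ} : ∀ {x g : ℕ}, x &&& c = x → g &&& c = g → g < x → g ≤ (x - 1) &&& c := by
  induction c using Nat.strong_induction_on with
  | _ c ih =>
  intro x g hx hg hlt
  rcases Nat.eq_zero_or_pos c with rfl | hc
  · simp only [Nat.and_zero] at hx; omega
  -- Bitwise `and` splits into lowest bits and halves; the induction passes from `c` to `c / 2`.
  have key : ∀ y z : ℕ, y &&& z = 2 * ((y / 2) &&& (z / 2)) + (y % 2) * (z % 2) := by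
    intro y z
    have h1 := Nat.and_div_two (a := y) (b := z)
    have h2 := Nat.and_mod_two_pow (a := y) (b := z) (n := 1)
    have h3 : (y % 2) &&& (z % 2) = (y % 2) * (z % 2) := by
      rcases Nat.mod_two_eq_zero_or_one y with h | h <;>
        rcases Nat.mod_two_eq_zero_or_one z with h' | h' <;> simp [h, h']
    simp only [pow_one] at h2
    rw [h3] at h2
    omega
  have hx' := key x c
  have hg' := key g c
  rw [hx] at hx'
  rw [hg] at hg'
  have hp := key (x - 1) c
  -- For even `x`, subtracting one borrows from `x / 2` and sets the lowest bit, so the induction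
  -- hypothesis applies to the halves; for odd `x` only the lowest bit is cleared.
  rcases Nat.mod_two_eq_zero_or_one x with h | h
  · have hgx : g / 2 < x / 2 := by omega
    have hb : g % 2 ≤ c % 2 := by
      rcases Nat.mod_two_eq_zero_or_one c with h' | h'
      · rw [h'] at hg'; omega
      · omega
    have hg2 : g / 2 &&& c / 2 = g / 2 := by
      rcases Nat.mod_two_eq_zero_or_one c with h' | h' <;> rw [h'] at hg' <;> omega
    have hx2 : x / 2 &&& c / 2 = x / 2 := by
      rw [h] at hx'; omega
    have := ih (c / 2) (by omega) hx2 hg2 hgx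
    rw [show (x - 1) / 2 = x / 2 - 1 by omega, show (x - 1) % 2 = 1 by omega, one_mul] at hp
    omega
  · rw [show (x - 1) / 2 = x / 2 by omega, show (x - 1) % 2 = 0 by omega, zero_mul] at hp
    have : x / 2 &&& c / 2 = x / 2 := by
      rcases Nat.mod_two_eq_zero_or_one c with h' | h' <;> rw [h, h'] at hx' <;> omega
    omega

/-- The number of ones in binary. -/
def popcount (x : ℕ) : ℕ := x.bitIndices.length

lemma popcount_eq (x : ℕ) : popcount x = x % 2 + popcount (x / 2) := by
  rcases Nat.even_or_odd' x with ⟨y, rfl | rfl⟩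
  · simp [popcount]
  · have h : (2 * y + 1) / 2 = y := by omega
    have h' : (2 * y + 1) % 2 = 1 := by omega
    rw [h, h']
    rw [popcount, Nat.bitIndices_two_mul_add_one]
    simp [popcount, add_comm]

lemma popcount_enc (A : Finset ℕ) : popcount (enc A) = A.card := by
  rw [popcount, ← List.toFinset_card_of_nodup Nat.bitIndices_nodup, enc,
    Finset.toFinset_bitIndices_sum_two_pow]

/-! ### Sparsification -/

namespace Sparsify

/-- The threshold for flowers with petals of size `i`. -/
def thr (q σ i : ℕ) : ℕ := 2 ^ (q * i - σ)

lemma thr_pos (q σ i : ℕ) : 0 < thr q σ i := by unfold thr; positivity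

/-- The number of clauses of size `c` that contain `X`. -/
def deg (l : List (Finset ℕ)) (c : ℕ) (X : Finset ℕ) : ℕ :=
  l.countP (fun D => D.card = c ∧ X ⊆ D)

/-- `H` is the heart of a flower that the addition of `C` completes. -/
def Flower (q σ : ℕ) (F : List (Finset ℕ)) (C H : Finset ℕ) : Prop :=
  H ⊆ C ∧ H ≠ C ∧ H.Nonempty ∧ thr q σ (C.card - H.card) ≤ deg F C.card H + 1

/-- The heart with the smallest code. -/
def IsFirst (q σ : ℕ) (F : List (Finset ℕ)) (C H : Finset ℕ) : Prop :=
  Flower q σ F C H ∧ ∀ H', Flower q σ F C H' → enc H ≤ enc H'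

lemma exists_isFirst {q σ F C} (h : ∃ H, Flower q σ F C H) : ∃ H, IsFirst q σ F C H := by
  classical
  have h' : ∃ x, ∃ H, Flower q σ F C H ∧ enc H = x := by
    obtain ⟨H, hH⟩ := h
    exact ⟨_, H, hH, rfl⟩
  obtain ⟨H, hH, hx⟩ := Nat.find_spec h'
  exact ⟨H, hH, fun H' hH' => hx ▸ Nat.find_min' h' ⟨H', hH', rfl⟩⟩

open Classical in
/-- The heart of a flower, if there is any; otherwise the empty set. -/
noncomputable def pick (q σ : ℕ) (F : List (Finset ℕ)) (C : Finset ℕ) : Finset ℕ :=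
  if h : ∃ H, Flower q σ F C H then (exists_isFirst h).choose else ∅

lemma pick_flower {q σ F C} (h : pick q σ F C ≠ ∅) : Flower q σ F C (pick q σ F C) := by
  unfold pick at h ⊢
  split_ifs at h ⊢ with hH
  · exact (exists_isFirst hH).choose_spec.1
  · exact absurd rfl h

/-- Codes are injective, so the heart of least code is unique. Thus a search that minimizes codes
finds exactly the heart chosen in `tree`. -/
lemma pick_eq {q σ F C H} (h : IsFirst q σ F C H) : pick q σ F C = H := by
  have hH : ∃ H, Flower q σ F C H := ⟨H, h.1⟩
  have := (exists_isFirst hH).choose_spec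
  rw [pick, dif_pos hH]
  exact enc_injective (le_antisymm (this.2 _ h.1) (h.2 _ this.1))

lemma pick_eq_empty {q σ F C} : pick q σ F C = ∅ ↔ ∀ H, ¬ Flower q σ F C H := by
  constructor
  · intro h H hH
    obtain ⟨H', hH'⟩ := exists_isFirst ⟨H, hH⟩
    rw [pick_eq hH'] at h
    exact hH'.1.2.2.1.ne_empty h
  · intro h
    rw [pick, dif_neg (by simpa using h)]

/-- The petals of a flower among the clauses of size `c`. -/
def petals (F : List (Finset ℕ)) (c : ℕ) (H : Finset ℕ) : List (Finset ℕ) :=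
  (F.filter (fun D => D.card = c ∧ H ⊆ D)).map (· \ H)

/-- All the sets that replace the flower with heart `H` which `C` completes. -/
def newPetals (F : List (Finset ℕ)) (C H : Finset ℕ) : List (Finset ℕ) :=
  (petals F C.card H ++ [C \ H]).reverse

/-- Addition of a clause. Supersets are replaced by the clause `U`. -/
def accept (U : Finset ℕ) (F : List (Finset ℕ)) (C : Finset ℕ) : List (Finset ℕ) :=
  F.map (fun D => if C ⊆ D then U else D) ++ [C]

/-- The binary tree of choices in the sparsification. -/
inductive Tree where
  | leaf (F : List (Finset ℕ))
  | node (l r : Tree)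

/-- The clause lists at the leaves. -/
def Tree.leaves : Tree → List (List (Finset ℕ))
  | .leaf F => [F]
  | .node l r => l.leaves ++ r.leaves

/-- The depth of a tree. -/
def Tree.depth : Tree → ℕ
  | .leaf _ => 0
  | .node l r => max l.depth r.depth + 1

/-- The sparsification, with kept clauses `F`, pending clauses `P` and original clauses `O`. -/
noncomputable def tree (q σ : ℕ) (U : Finset ℕ) : ℕ → (F P O : List (Finset ℕ)) → Tree
  | 0, F, _, _ => .leaf F
  | _ + 1, F, [], [] => .leaf F
  | n + 1, F, C :: P, O =>
      if ∃ E ∈ F, E ⊆ C then tree q σ U n F P O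
      else if pick q σ F C = ∅ then tree q σ U n (accept U F C) P O
      else .node (tree q σ U n F (pick q σ F C :: P) O)
        (tree q σ U n F (newPetals F C (pick q σ F C) ++ P) O)
  | n + 1, F, [], C :: O =>
      if ∃ E ∈ F, E ⊆ C then tree q σ U n F [] O
      else if pick q σ F C = ∅ then tree q σ U n (accept U F C) [] O
      else .node (tree q σ U n F [pick q σ F C] O)
        (tree q σ U n F (newPetals F C (pick q σ F C)) O)

/-- The weight of a clause. -/
def wt (k q : ℕ) (D : Finset ℕ) : ℕ := if D.card ≤ k then 2 ^ (q * (k - D.card)) else 0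

/-- The weight of a list of clauses. -/
def wts (k q : ℕ) (l : List (Finset ℕ)) : ℕ := (l.map (wt k q)).sum

/-- The pending clauses that are not implied by a kept clause. -/
def live (F P : List (Finset ℕ)) : List (Finset ℕ) := P.filter (fun T => ¬ ∃ E ∈ F, E ⊆ T)

/-- The potential. -/
def pot (k q : ℕ) (F P : List (Finset ℕ)) : ℕ := 2 * wts k q F + wts k q (live F P)

/-- No set is contained in too many clauses of the same size. -/
def Good (k q σ : ℕ) (l : List (Finset ℕ)) : Prop :=
  ∀ X : Finset ℕ, X.Nonempty → ∀ c ≤ k, deg l c X ≤ thr q σ (c - X.card)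

/-- A clause of size between `1` and `k` on `V` literals. -/
def IsClause (k V : ℕ) (D : Finset ℕ) : Prop := D.Nonempty ∧ D ⊆ Finset.range V ∧ D.card ≤ k

/-- The conditions on the parameters. -/
structure Par (k q σ V : ℕ) : Prop where
  hσ : σ ≤ q
  hk : 8 * k ≤ 2 ^ σ
  hq : σ + 1 ≤ 2 * q
  hq1 : 1 ≤ q
  hV : k < V

/-- The invariant of the sparsification. -/
structure Inv (k q σ V : ℕ) (F P O : List (Finset ℕ)) : Prop where
  isF : ∀ D ∈ F, D ≠ Finset.range V → IsClause k V D
  isP : ∀ D ∈ P, IsClause k V D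
  isO : ∀ D ∈ O, IsClause k V D
  goodF : Good k q σ F
  -- Strictness leaves room for the one clause that completes a flower.
  strict : ∀ X : Finset ℕ, X.Nonempty → ∀ c ≤ k, X.card < c → deg F c X < thr q σ (c - X.card)
  goodP : Good k q σ P
  -- New pending clauses are smaller than all the others, so pending clauses of equal size stem from
  -- a single branching.
  sorted : P.Pairwise (fun A B => A.card ≤ B.card)
  anti : ∀ D ∈ F, ∀ E ∈ F, D ≠ Finset.range V → E ⊆ D → E = D

/-! ### Degrees and weights of clause lists -/

lemma deg_append (l l' : List (Finset ℕ)) (c X) : deg (l ++ l') c X = deg l c X + deg l' c X :=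
  List.countP_append

lemma deg_cons (D : Finset ℕ) (l : List (Finset ℕ)) (c X) :
    deg (D :: l) c X = deg l c X + if D.card = c ∧ X ⊆ D then 1 else 0 := by
  simp [deg, List.countP_cons]

@[simp] lemma deg_nil (c X) : deg [] c X = 0 := rfl

lemma deg_eq_zero {l : List (Finset ℕ)} {c X} (h : ∀ D ∈ l, D.card = c → ¬ X ⊆ D) :
    deg l c X = 0 := by
  rw [deg, List.countP_eq_zero]
  simpa using h

lemma wts_append (k q) (l l' : List (Finset ℕ)) : wts k q (l ++ l') = wts k q l + wts k q l' := by
  simp [wts]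

lemma wts_cons (k q D) (l : List (Finset ℕ)) : wts k q (D :: l) = wt k q D + wts k q l := by
  simp [wts]

@[simp] lemma wts_nil (k q) : wts k q [] = 0 := rfl

lemma wts_filter_le_sum (k q : ℕ) (l : List (Finset ℕ)) (X : Finset ℕ) :
    wts k q (l.filter (fun D => X ⊆ D)) ≤
      ∑ c ∈ Finset.Icc X.card k, deg l c X * 2 ^ (q * (k - c)) := by
  induction l with
  | nil => simp
  | cons D l ih =>
    by_cases hX : X ⊆ D
    · rw [List.filter_cons_of_pos (by simpa using hX), wts_cons]
      simp only [deg_cons, add_mul, Finset.sum_add_distrib]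
      rw [add_comm]
      refine add_le_add ih ?_
      unfold wt
      split_ifs with hD
      · refine le_trans (le_of_eq ?_) (Finset.single_le_sum (fun _ _ => Nat.zero_le _)
          (Finset.mem_Icc.2 ⟨Finset.card_le_card hX, hD⟩))
        simp [hX]
      · simp
    · rw [List.filter_cons_of_neg (by simpa using hX)]
      simpa [deg_cons, hX] using ih

/-- The supersets of `X` of its own size contribute `deg * wt X`. For every larger size `c ≤ k` the
degree is at most `2^(q(c-|X|)-σ)` and each clause weighs `2^(q(k-c))`, together `wt X / 2^σ`. There
are at most `k` such sizes, and `8k ≤ 2^σ`, so the proper supersets weigh at most `wt X / 8`. -/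
lemma wts_filter_le {k q σ V : ℕ} (hp : Par k q σ V) {l : List (Finset ℕ)} (hl : Good k q σ l)
    {X : Finset ℕ} (hX : X.Nonempty) :
    8 * wts k q (l.filter (fun D => X ⊆ D)) ≤ (8 * deg l X.card X + 1) * wt k q X := by
  refine (Nat.mul_le_mul_left 8 (wts_filter_le_sum k q l X)).trans ?_
  unfold wt
  split_ifs with hk
  · rw [← Finset.add_sum_Ioc_eq_sum_Icc hk, mul_add, add_mul, ← mul_assoc, one_mul]
    refine Nat.add_le_add_left ?_ _
    have h1 : ∀ c ∈ Finset.Ioc X.card k,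
        2 ^ σ * (deg l c X * 2 ^ (q * (k - c))) ≤ 2 ^ (q * (k - X.card)) := by
      intro c hc
      rw [Finset.mem_Ioc] at hc
      refine (Nat.mul_le_mul_left _ (Nat.mul_le_mul_right _ (hl X hX c hc.2))).trans ?_
      unfold thr
      rw [← pow_add, ← pow_add]
      apply Nat.pow_le_pow_right (by norm_num)
      have h2 : k - X.card = (c - X.card) + (k - c) := by omega
      -- Since `c > |X|` and `σ ≤ q`, the subtraction of `σ` in the exponent is not truncated.
      have h3 : q * 1 ≤ q * (c - X.card) := Nat.mul_le_mul_left q (by omega)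
      rw [h2, mul_add]
      have := hp.hσ
      omega
    have h2 := Finset.sum_le_sum h1
    rw [← Finset.mul_sum, Finset.sum_const, Nat.card_Ioc, smul_eq_mul] at h2
    have h3 : 2 ^ σ * (8 * ∑ c ∈ Finset.Ioc X.card k, deg l c X * 2 ^ (q * (k - c))) ≤
        2 ^ σ * 2 ^ (q * (k - X.card)) := by
      have h4 : 8 * (k - X.card) ≤ 2 ^ σ := le_trans (by omega) hp.hk
      calc _ = 8 * (2 ^ σ * ∑ c ∈ Finset.Ioc X.card k, deg l c X * 2 ^ (q * (k - c))) := by ring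
        _ ≤ 8 * ((k - X.card) * 2 ^ (q * (k - X.card))) := Nat.mul_le_mul_left _ h2
        _ = 8 * (k - X.card) * 2 ^ (q * (k - X.card)) := by ring
        _ ≤ _ := Nat.mul_le_mul_right _ h4
    exact Nat.le_of_mul_le_mul_left h3 (by positivity)
  · rw [Finset.Icc_eq_empty (by omega)]
    simp

/-- Each clause is charged to one of its literals. By `wts_filter_le` for `{v}`, and since the unit
clause `{v}` occurs at most once, a literal is charged at most `9/8 * 2^(q(k-1))`. The placeholder
`Finset.range V` has more than `k` elements and weighs nothing. -/
lemma wts_le {k q σ V : ℕ} (hp : Par k q σ V) {l : List (Finset ℕ)} (hl : Good k q σ l)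
    (hk : 1 ≤ k) (hc : ∀ D ∈ l, D ≠ Finset.range V → IsClause k V D) :
    wts k q l ≤ 2 * V * 2 ^ (q * (k - 1)) := by
  have h1 : wts k q l ≤ ∑ v ∈ Finset.range V, wts k q (l.filter (fun D => {v} ⊆ D)) := by
    clear hl
    induction l with
    | nil => simp
    | cons D l ih =>
      have ih' := ih (fun E hE => hc E (List.mem_cons_of_mem _ hE))
      have h2 : ∀ v, wts k q ((D :: l).filter (fun D => {v} ⊆ D)) =
          (if v ∈ D then wt k q D else 0) + wts k q (l.filter (fun D => {v} ⊆ D)) := by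
        intro v
        by_cases hv : v ∈ D
        · rw [List.filter_cons_of_pos (by simpa using hv), wts_cons, if_pos hv]
        · rw [List.filter_cons_of_neg (by simpa using hv), if_neg hv, zero_add]
      simp only [h2, Finset.sum_add_distrib, wts_cons]
      refine add_le_add ?_ ih'
      by_cases hU : D = Finset.range V
      · have : wt k q D = 0 := by
          rw [wt, if_neg]
          rw [hU, Finset.card_range]
          exact not_le.2 hp.hV
        omega
      · obtain ⟨⟨v, hv⟩, hD, -⟩ := hc D (List.mem_cons_self ..) hU
        refine le_trans (le_of_eq ?_) (Finset.single_le_sum (fun _ _ => Nat.zero_le _) (hD hv))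
        rw [if_pos hv]
  have h2 : ∀ v ∈ Finset.range V, wts k q (l.filter (fun D => {v} ⊆ D)) ≤
      2 * 2 ^ (q * (k - 1)) := by
    intro v _
    have h3 := wts_filter_le hp hl (Finset.singleton_nonempty v)
    have h4 := hl {v} (Finset.singleton_nonempty v) 1 hk
    rw [Finset.card_singleton] at h3 h4
    have h5 : thr q σ (1 - 1) = 1 := by simp [thr]
    rw [h5] at h4
    have h6 : wt k q {v} = 2 ^ (q * (k - 1)) := by simp [wt, hk]
    rw [h6] at h3
    have h7 : (8 * deg l 1 {v} + 1) * 2 ^ (q * (k - 1)) ≤ 9 * 2 ^ (q * (k - 1)) :=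
      Nat.mul_le_mul_right _ (by omega)
    omega
  calc _ ≤ _ := h1
    _ ≤ ∑ v ∈ Finset.range V, 2 * 2 ^ (q * (k - 1)) := Finset.sum_le_sum h2
    _ = _ := by rw [Finset.sum_const, Finset.card_range, smul_eq_mul]; ring

/-! ### Invariant and potential when one clause is processed -/

variable {k q σ V : ℕ} {F P O : List (Finset ℕ)} {C H : Finset ℕ}

/-- The situation when the clause `C` has been taken from the pending or original clauses. -/
structure Popped (k q σ V : ℕ) (F : List (Finset ℕ)) (C : Finset ℕ) (P O : List (Finset ℕ)) :
    Prop where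
  inv : Inv k q σ V F P O
  isC : IsClause k V C
  le : ∀ T ∈ P, C.card ≤ T.card
  deg_self : deg P C.card C = 0

lemma Inv.pop_pending (h : Inv k q σ V F (C :: P) O) : Popped k q σ V F C P O where
  inv :=
    { isF := h.isF
      isP := fun D hD => h.isP D (List.mem_cons_of_mem _ hD)
      isO := h.isO
      goodF := h.goodF
      strict := h.strict
      goodP := fun X hX c hc => by
        have := h.goodP X hX c hc
        rw [deg_cons] at this
        omega
      sorted := h.sorted.of_cons
      anti := h.anti }
  isC := h.isP C (List.mem_cons_self ..)
  le := (List.pairwise_cons.1 h.sorted).1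
  deg_self := by
    have hC := h.isP C (List.mem_cons_self ..)
    -- The threshold for petals of size `0` is `1`, so `C` is listed only once among the pending
    -- clauses.
    have := h.goodP C hC.1 C.card hC.2.2
    rw [deg_cons, if_pos ⟨rfl, subset_rfl⟩] at this
    have h1 : thr q σ (C.card - C.card) = 1 := by simp [thr]
    omega

lemma Inv.pop_original (h : Inv k q σ V F [] (C :: O)) : Popped k q σ V F C [] O where
  inv :=
    { isF := h.isF
      isP := h.isP
      isO := fun D hD => h.isO D (List.mem_cons_of_mem _ hD)
      goodF := h.goodF
      strict := h.strict
      goodP := h.goodP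
      sorted := h.sorted
      anti := h.anti }
  isC := h.isO C (List.mem_cons_self ..)
  le := by simp
  deg_self := rfl

lemma wt_pos (hC : C.card ≤ k) : 0 < wt k q C := by
  rw [wt, if_pos hC]
  positivity

lemma deg_accept_le (hp : Par k q σ V) {c : ℕ} (hc : c ≤ k) (X : Finset ℕ) :
    deg (accept (Finset.range V) F C) c X ≤ deg F c X + if C.card = c ∧ X ⊆ C then 1 else 0 := by
  rw [accept, deg_append, deg_cons, deg_nil, zero_add]
  refine Nat.add_le_add_right ?_ _
  unfold deg
  rw [List.countP_map]
  apply List.countP_mono_left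
  intro D _ hD
  simp only [Function.comp_apply, decide_eq_true_eq] at hD ⊢
  split_ifs at hD with h
  · have := hp.hV
    rw [Finset.card_range] at hD
    omega
  · exact hD

lemma deg_self_eq_zero (hns : ¬ ∃ E ∈ F, E ⊆ C) : deg F C.card C = 0 := by
  apply deg_eq_zero
  intro D hD hcard hsub
  exact hns ⟨D, hD, (Finset.eq_of_subset_of_card_le hsub hcard.le).ge⟩

lemma mem_accept {U D : Finset ℕ} (h : D ∈ accept U F C) : D = U ∨ D = C ∨ D ∈ F ∧ ¬ C ⊆ D := by
  simp only [accept, List.mem_append, List.mem_map, List.mem_singleton] at h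
  rcases h with ⟨D', hD', rfl⟩ | rfl
  · split_ifs with hC
    · exact .inl rfl
    · exact .inr (.inr ⟨hD', hC⟩)
  · exact .inr (.inl rfl)

/-- That no flower is completed means exactly that all degrees stay strictly below their thresholds
when `C` is counted as well. Clauses containing `C` are overwritten by the placeholder, which keeps
the other clauses an antichain. -/
lemma Popped.inv_accept (h : Popped k q σ V F C P O) (hp : Par k q σ V)
    (hns : ¬ ∃ E ∈ F, E ⊆ C) (hf : ∀ H, ¬ Flower q σ F C H) :
    Inv k q σ V (accept (Finset.range V) F C) P O := by
  have hstrict : ∀ X : Finset ℕ, X.Nonempty → ∀ c ≤ k, X.card < c →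
      deg (accept (Finset.range V) F C) c X < thr q σ (c - X.card) := by
    intro X hX c hc hlt
    have h1 := deg_accept_le (F := F) (C := C) hp hc X
    have h2 := h.inv.strict X hX c hc hlt
    split_ifs at h1 with h3
    · obtain ⟨rfl, h4⟩ := h3
      have h5 := hf X
      simp only [Flower, not_and, not_le] at h5
      exact h1.trans_lt (h5 h4 (by rintro rfl; exact absurd hlt (lt_irrefl _)) hX)
    · omega
  refine ⟨fun D hD hU => ?_, h.inv.isP, h.inv.isO, fun X hX c hc => ?_, hstrict, h.inv.goodP,
    h.inv.sorted, fun D hD E hE hU hED => ?_⟩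
  · rcases mem_accept hD with rfl | rfl | ⟨hD, -⟩
    · exact absurd rfl hU
    · exact h.isC
    · exact h.inv.isF D hD hU
  · rcases lt_or_ge X.card c with hlt | hge
    · exact (hstrict X hX c hc hlt).le
    · have h1 := deg_accept_le (F := F) (C := C) hp hc X
      split_ifs at h1 with h3
      · obtain ⟨rfl, h4⟩ := h3
        obtain rfl : X = C := Finset.eq_of_subset_of_card_le h4 hge
        rw [deg_self_eq_zero hns] at h1
        exact h1.trans (thr_pos _ _ _)
      · exact h1.trans (h.inv.goodF X hX c hc)
  · rcases mem_accept hD with rfl | rfl | ⟨hD, hCD⟩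
    · exact absurd rfl hU
    · rcases mem_accept hE with rfl | rfl | ⟨hE, -⟩
      · exact (absurd (hED.antisymm h.isC.2.1).symm hU)
      · rfl
      · exact absurd ⟨E, hE, hED⟩ hns
    · rcases mem_accept hE with rfl | rfl | ⟨hE, -⟩
      · exact (absurd (hED.antisymm (h.inv.isF D hD hU).2.1).symm hU)
      · exact absurd hED hCD
      · exact h.inv.anti D hD E hE hU hED

/-- A pending clause can only cease to be live by containing `C`: the placeholder has more than `k`
elements and is contained in no clause. -/
lemma wts_live_accept (hp : Par k q σ V) (hP : ∀ D ∈ P, IsClause k V D) :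
    wts k q (live F P) ≤ wts k q (live (accept (Finset.range V) F C) P) +
      wts k q (P.filter (fun T => C ⊆ T)) := by
  induction P with
  | nil => simp [live]
  | cons T P ih =>
    have ih' := ih (fun D hD => hP D (List.mem_cons_of_mem _ hD))
    simp only [live, List.filter_cons] at ih' ⊢
    by_cases h1 : ∃ E ∈ F, E ⊆ T
    · simp only [h1, not_true_eq_false, decide_false, Bool.false_eq_true, if_false]
      refine ih'.trans (add_le_add ?_ ?_) <;> split_ifs <;> simp [wts_cons]
    · have hT := hP T (List.mem_cons_self ..)
      have h2 : (¬ ∃ E ∈ accept (Finset.range V) F C, E ⊆ T) ∨ C ⊆ T := by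
        by_contra! h
        obtain ⟨⟨E, hE, hET⟩, hC⟩ := h
        rcases mem_accept hE with rfl | rfl | ⟨hE, -⟩
        · have := Finset.card_le_card hET
          rw [Finset.card_range] at this
          have := hp.hV
          have := hT.2.2
          omega
        · exact hC hET
        · exact h1 ⟨E, hE, hET⟩
      simp only [h1, not_false_eq_true, decide_true, if_true, wts_cons]
      rcases h2 with h2 | h2
      · rw [if_pos (by simpa only [decide_eq_true_eq] using h2), wts_cons]
        split_ifs
        · rw [wts_cons]; omega
        · omega
      · simp only [h2, decide_true, if_true, wts_cons]
        split_ifs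
        · rw [wts_cons]; omega
        · omega

lemma wts_accept (k q : ℕ) (U : Finset ℕ) (F : List (Finset ℕ)) (C : Finset ℕ) :
    wts k q F + wt k q C ≤ wts k q (accept U F C) + wts k q (F.filter (fun D => C ⊆ D)) := by
  rw [accept, wts_append, wts_cons, wts_nil]
  suffices wts k q F ≤ wts k q (F.map (fun D => if C ⊆ D then U else D)) +
      wts k q (F.filter (fun D => C ⊆ D)) by omega
  induction F with
  | nil => simp
  | cons D F ih =>
    by_cases h : C ⊆ D
    · simp only [wts_cons, List.map_cons, List.filter_cons, h, if_true, decide_true]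
      omega
    · simp only [wts_cons, List.map_cons, List.filter_cons, h, if_false, decide_false,
        Bool.false_eq_true]
      omega

/-- The clauses containing `C` weigh at most `wt C / 8` among the kept ones and at most as much
among the pending ones. As kept clauses count twice, the gain is at least `(2 - 3/8) * wt C`. This
exceeds the weight `wt C` of the pending clause that was taken away, and all numbers are integers.
-/
lemma Popped.pot_accept (h : Popped k q σ V F C P O) (hp : Par k q σ V)
    (hns : ¬ ∃ E ∈ F, E ⊆ C) :
    pot k q F P + wt k q C + 1 ≤ pot k q (accept (Finset.range V) F C) P := by
  have h1 := wts_live_accept (F := F) (C := C) hp h.inv.isP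
  have h2 := wts_accept k q (Finset.range V) F C
  have h3 := wts_filter_le hp h.inv.goodF h.isC.1
  have h4 := wts_filter_le hp h.inv.goodP h.isC.1
  rw [deg_self_eq_zero hns] at h3
  rw [h.deg_self] at h4
  have h5 := wt_pos (q := q) h.isC.2.2
  unfold pot
  omega

lemma pot_cons_le : pot k q F (C :: P) ≤ pot k q F P + wt k q C := by
  unfold pot live
  rw [List.filter_cons]
  split_ifs
  · rw [wts_cons]; omega
  · omega

lemma pot_cons_of_subsumed (h : ∃ E ∈ F, E ⊆ C) : pot k q F (C :: P) = pot k q F P := by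
  unfold pot live
  rw [List.filter_cons, if_neg (by simpa using h)]

lemma pot_nil_le : pot k q F [] ≤ pot k q F P := by
  simp [pot, live]

/-- The heart is strictly smaller than `C`, hence than every pending clause: it is the only pending
clause of its size, and the order by size persists. -/
lemma Popped.inv_heart (h : Popped k q σ V F C P O) (hH : Flower q σ F C H) :
    Inv k q σ V F (H :: P) O := by
  have hlt : H.card < C.card := Finset.card_lt_card ⟨hH.1, fun h' => hH.2.1 (hH.1.antisymm h')⟩
  refine ⟨h.inv.isF, fun D hD => ?_, h.inv.isO, h.inv.goodF, h.inv.strict, fun X hX c hc => ?_,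
    List.pairwise_cons.2 ⟨fun T hT => hlt.le.trans (h.le T hT), h.inv.sorted⟩, h.inv.anti⟩
  · rcases List.mem_cons.1 hD with rfl | hD
    · exact ⟨hH.2.2.1, hH.1.trans h.isC.2.1, hlt.le.trans h.isC.2.2⟩
    · exact h.inv.isP D hD
  · rw [deg_cons]
    split_ifs with h1
    · rw [deg_eq_zero, zero_add]
      · exact thr_pos _ _ _
      · intro T hT hcard
        have := h.le T hT
        omega
    · exact h.inv.goodP X hX c hc

lemma not_subsumed_subset (hns : ¬ ∃ E ∈ F, E ⊆ C) (hH : H ⊆ C) : ¬ ∃ E ∈ F, E ⊆ H :=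
  fun ⟨E, hE, hEH⟩ => hns ⟨E, hE, hEH.trans hH⟩

lemma wt_lt_wt (hq : 1 ≤ q) (hC : C.card ≤ k) (hlt : H.card < C.card) :
    wt k q C + 1 ≤ wt k q H := by
  rw [wt, wt, if_pos hC, if_pos (hlt.le.trans hC)]
  apply Nat.pow_lt_pow_right (by norm_num)
  exact Nat.mul_lt_mul_of_pos_left (by omega) hq

/-- The smaller set is strictly heavier, and the heart is live because a kept clause inside it would
also lie inside `C`. -/
lemma Popped.pot_heart (h : Popped k q σ V F C P O) (hp : Par k q σ V)
    (hns : ¬ ∃ E ∈ F, E ⊆ C) (hH : Flower q σ F C H) :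
    pot k q F P + wt k q C + 1 ≤ pot k q F (H :: P) := by
  have hlt : H.card < C.card := Finset.card_lt_card ⟨hH.1, fun h' => hH.2.1 (hH.1.antisymm h')⟩
  have h1 := wt_lt_wt (q := q) hp.hq1 h.isC.2.2 hlt
  have h2 := not_subsumed_subset hns hH.1
  unfold pot live
  rw [List.filter_cons, if_pos (by simpa using h2), wts_cons]
  omega

lemma mem_newPetals {D : Finset ℕ} (h : D ∈ newPetals F C H) :
    D = C \ H ∨ ∃ E ∈ F, E.card = C.card ∧ H ⊆ E ∧ D = E \ H := by
  simp only [newPetals, petals, List.mem_reverse, List.mem_append, List.mem_map, List.mem_filter,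
    List.mem_singleton, decide_eq_true_eq] at h
  rcases h with ⟨E, ⟨hE, h1, h2⟩, rfl⟩ | rfl
  · exact .inr ⟨E, hE, h1, h2, rfl⟩
  · exact .inl rfl

lemma card_newPetals (hH : H ⊆ C) {D : Finset ℕ} (h : D ∈ newPetals F C H) :
    D.card = C.card - H.card := by
  rcases mem_newPetals h with rfl | ⟨E, -, h1, h2, rfl⟩
  · exact Finset.card_sdiff_of_subset hH
  · rw [Finset.card_sdiff_of_subset h2, h1]

lemma length_newPetals : (newPetals F C H).length = deg F C.card H + 1 := by
  simp [newPetals, petals, deg, List.countP_eq_length_filter]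

lemma Popped.ne_univ (h : Popped k q σ V F C P O) (hp : Par k q σ V) {E : Finset ℕ}
    (hE : E.card = C.card) : E ≠ Finset.range V := by
  rintro rfl
  rw [Finset.card_range] at hE
  have := hp.hV
  have := h.isC.2.2
  omega

lemma Popped.isClause_newPetals (h : Popped k q σ V F C P O) (hp : Par k q σ V)
    (hH : Flower q σ F C H) {D : Finset ℕ} (hD : D ∈ newPetals F C H) : IsClause k V D := by
  have hlt : H.card < C.card := Finset.card_lt_card ⟨hH.1, fun h' => hH.2.1 (hH.1.antisymm h')⟩
  have hc := card_newPetals hH.1 hD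
  have hk := h.isC.2.2
  refine ⟨Finset.card_pos.1 (by omega), ?_, by omega⟩
  rcases mem_newPetals hD with rfl | ⟨E, hE, h1, h2, rfl⟩
  · exact Finset.sdiff_subset.trans h.isC.2.1
  · exact Finset.sdiff_subset.trans (h.inv.isF E hE (h.ne_univ hp h1)).2.1

/-- A petal that contains `X` stems from a clause of size `|C|` that contains `X ∪ H`, where `X` and
`H` are disjoint, and thresholds depend on `|C| - |X ∪ H| = c - |X|` only. The extra petal `C \ H`
is absorbed by strictness; if `X ∪ H = C`, no kept clause contributes, because `C` contains none. -/
lemma Popped.good_newPetals (h : Popped k q σ V F C P O)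
    (hns : ¬ ∃ E ∈ F, E ⊆ C) (hH : Flower q σ F C H) :
    Good k q σ (newPetals F C H) := by
  intro X hX c hc
  by_cases hcj : c = C.card - H.card
  swap
  · rw [deg_eq_zero]
    · exact Nat.zero_le _
    · intro D hD hD'
      exact absurd (hD'.symm.trans (card_newPetals hH.1 hD)) hcj
  by_cases hd : Disjoint X H
  swap
  · rw [deg_eq_zero]
    · exact Nat.zero_le _
    · intro D hD _ hXD
      apply hd
      refine Finset.disjoint_of_subset_left hXD ?_
      rcases mem_newPetals hD with rfl | ⟨E, -, -, -, rfl⟩ <;> exact Finset.sdiff_disjoint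
  have h1 : deg (newPetals F C H) c X ≤
      deg F C.card (X ∪ H) + if X ⊆ C \ H then 1 else 0 := by
    have h2 : deg (newPetals F C H) c X = deg (petals F C.card H ++ [C \ H]) c X := by
      unfold deg newPetals
      exact List.countP_reverse
    rw [h2, deg_append, deg_cons, deg_nil, zero_add]
    refine add_le_add ?_ ?_
    · unfold deg petals
      rw [List.countP_map, List.countP_filter]
      apply List.countP_mono_left
      intro D _ hD
      simp only [Function.comp_apply, Bool.and_eq_true, decide_eq_true_eq] at hD ⊢
      exact ⟨hD.2.1, Finset.union_subset (hD.1.2.trans Finset.sdiff_subset) hD.2.2⟩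
    · split_ifs with h3 h4
      · exact le_rfl
      · exact absurd h3.2 h4
      · exact Nat.zero_le _
      · exact Nat.zero_le _
  have hXH : (X ∪ H).Nonempty := hX.mono Finset.subset_union_left
  have hcard : (X ∪ H).card = X.card + H.card := Finset.card_union_of_disjoint hd
  have hsub : C.card - (X ∪ H).card = c - X.card := by omega
  split_ifs at h1 with hXC
  · rcases eq_or_ne (X ∪ H) C with he | hne
    · rw [he, deg_self_eq_zero hns] at h1
      exact h1.trans (thr_pos _ _ _)
    · have hlt : (X ∪ H).card < C.card := by
        have hs : X ∪ H ⊆ C := Finset.union_subset (hXC.trans Finset.sdiff_subset) hH.1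
        exact Finset.card_lt_card ⟨hs, fun h' => hne (hs.antisymm h')⟩
      have := h.inv.strict (X ∪ H) hXH C.card h.isC.2.2 hlt
      rw [hsub] at this
      omega
  · have := h.inv.goodF (X ∪ H) hXH C.card h.isC.2.2
    rw [hsub] at this
    omega

/-- As the heart is not empty, petals are smaller than `C` and than all pending clauses, so degrees
of the new list are those of the petals or those of `P`, never a sum of both. -/
lemma Popped.inv_petals (h : Popped k q σ V F C P O) (hp : Par k q σ V)
    (hns : ¬ ∃ E ∈ F, E ⊆ C) (hH : Flower q σ F C H) :
    Inv k q σ V F (newPetals F C H ++ P) O := by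
  have hlt : H.card < C.card := Finset.card_lt_card ⟨hH.1, fun h' => hH.2.1 (hH.1.antisymm h')⟩
  have hpos := hH.2.2.1.card_pos
  refine ⟨h.inv.isF, fun D hD => ?_, h.inv.isO, h.inv.goodF, h.inv.strict, fun X hX c hc => ?_,
    ?_, h.inv.anti⟩
  · rcases List.mem_append.1 hD with hD | hD
    · exact h.isClause_newPetals hp hH hD
    · exact h.inv.isP D hD
  · rw [deg_append]
    by_cases hcj : c = C.card - H.card
    · rw [deg_eq_zero (l := P), add_zero]
      · exact h.good_newPetals hns hH X hX c hc
      · intro T hT hT'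
        have := h.le T hT
        omega
    · rw [deg_eq_zero (l := newPetals F C H), zero_add]
      · exact h.inv.goodP X hX c hc
      · intro D hD hD'
        exact absurd (hD'.symm.trans (card_newPetals hH.1 hD)) hcj
  · rw [List.pairwise_append]
    refine ⟨?_, h.inv.sorted, fun D hD T hT => ?_⟩
    · rw [List.pairwise_iff_forall_sublist]
      intro A B hAB
      have hA : A ∈ newPetals F C H := hAB.subset (by simp)
      have hB : B ∈ newPetals F C H := hAB.subset (by simp)
      rw [card_newPetals hH.1 hA, card_newPetals hH.1 hB]
    · rw [card_newPetals hH.1 hD]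
      have := h.le T hT
      omega

lemma wts_of_card {l : List (Finset ℕ)} {j : ℕ} (hj : j ≤ k) (h : ∀ D ∈ l, D.card = j) :
    wts k q l = l.length * 2 ^ (q * (k - j)) := by
  induction l with
  | nil => simp
  | cons D l ih =>
    rw [wts_cons, ih (fun E hE => h E (List.mem_cons_of_mem _ hE)), wt,
      h D (List.mem_cons_self ..), if_pos hj, List.length_cons]
    ring

/-- With petals of size `i` there are at least `2^(qi-σ)` of them, each of weight `2^(q(k-i))`:
together at least `2^(qk-σ)`, whatever `i` is. Half of this pays for the loss of `C`. All petals are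
live: a kept clause inside `D \ H` would equal `D` by the antichain property, but `D` contains the
nonempty set `H`. -/
lemma Popped.pot_petals (h : Popped k q σ V F C P O) (hp : Par k q σ V)
    (hns : ¬ ∃ E ∈ F, E ⊆ C) (hH : Flower q σ F C H) :
    pot k q F P + wt k q C + 2 ^ (q * k - σ - 1) ≤ pot k q F (newPetals F C H ++ P) := by
  have hlt : H.card < C.card := Finset.card_lt_card ⟨hH.1, fun h' => hH.2.1 (hH.1.antisymm h')⟩
  have hpos := hH.2.2.1.card_pos
  have hk := h.isC.2.2
  have h1 : live F (newPetals F C H) = newPetals F C H := by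
    rw [live, List.filter_eq_self]
    intro D hD
    simp only [decide_eq_true_eq]
    rintro ⟨E, hE, hED⟩
    rcases mem_newPetals hD with rfl | ⟨D', hD', hc, hHD, rfl⟩
    · exact hns ⟨E, hE, hED.trans Finset.sdiff_subset⟩
    · have h2 := h.inv.anti D' hD' E hE (h.ne_univ hp hc) (hED.trans Finset.sdiff_subset)
      rw [h2] at hED
      have h3 := Finset.disjoint_of_subset_left hED Finset.sdiff_disjoint
      obtain ⟨x, hx⟩ := hH.2.2.1
      exact Finset.disjoint_left.1 h3 (hHD hx) hx
  have h2 : live F (newPetals F C H ++ P) = newPetals F C H ++ live F P := by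
    rw [live, List.filter_append]
    exact congrArg (· ++ _) h1
  have h3 : wts k q (newPetals F C H) =
      (deg F C.card H + 1) * 2 ^ (q * (k - (C.card - H.card))) := by
    rw [wts_of_card (by omega) (fun D hD => card_newPetals hH.1 hD), length_newPetals]
  have h4 : 2 ^ (q * k - σ) ≤ wts k q (newPetals F C H) := by
    rw [h3]
    refine le_trans ?_ (Nat.mul_le_mul_right _ hH.2.2.2)
    rw [thr, ← pow_add]
    apply Nat.pow_le_pow_right (by norm_num)
    obtain ⟨i, hi⟩ : ∃ i, k = (C.card - H.card) + i := ⟨k - (C.card - H.card), by omega⟩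
    rw [show k - (C.card - H.card) = i by omega]
    nth_rewrite 1 [hi]
    rw [mul_add]
    omega
  -- A clause with a nonempty proper subset has at least two elements, and `σ + 1 ≤ 2 * q`.
  have h5 : wt k q C ≤ 2 ^ (q * k - σ - 1) := by
    rw [wt, if_pos hk]
    apply Nat.pow_le_pow_right (by norm_num)
    have h6 : k = (k - C.card) + C.card := by omega
    have h7 : q * 2 ≤ q * C.card := Nat.mul_le_mul_left _ (by omega)
    nth_rewrite 2 [h6]
    rw [mul_add]
    have := hp.hq
    omega
  have h6 : 2 ^ (q * k - σ) = 2 * 2 ^ (q * k - σ - 1) := by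
    rw [← pow_succ']
    congr 1
    have h7 : q * 2 ≤ q * k := Nat.mul_le_mul_left _ (by omega)
    have := hp.hq
    omega
  unfold pot
  rw [h2, wts_append]
  omega

/-- An upper bound for the potential. -/
def maxPot (k q V : ℕ) : ℕ := 6 * V * 2 ^ (q * (k - 1))

lemma Inv.pot_le (h : Inv k q σ V F P O) (hp : Par k q σ V) (hk : 1 ≤ k) :
    pot k q F P ≤ maxPot k q V := by
  have h1 := wts_le hp h.goodF hk h.isF
  have h2 := wts_le hp h.goodP hk (fun D hD _ => h.isP D hD)
  have h3 : wts k q (live F P) ≤ wts k q P := by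
    unfold wts live
    exact (List.filter_sublist.map _).sum_le_sum (by simp)
  unfold pot maxPot
  nlinarith

lemma inv_init (hO : ∀ D ∈ O, IsClause k V D) : Inv k q σ V [] [] O where
  isF := by simp
  isP := by simp
  isO := hO
  goodF := fun X _ c _ => by simp
  strict := fun X _ c _ _ => by simpa using thr_pos _ _ _
  goodP := fun X _ c _ => by simp
  sorted := List.Pairwise.nil
  anti := by simp

/-- The possible results of processing a clause `C`. -/
inductive Outcome (k q σ V n : ℕ) (F : List (Finset ℕ)) (C : Finset ℕ) (P O : List (Finset ℕ))
    (x : ℕ) (t : Tree) : Prop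
  | reject (hs : ∃ E ∈ F, E ⊆ C) (hx : x ≤ pot k q F P)
      (ht : t = tree q σ (Finset.range V) n F P O)
  | accept (hi : Inv k q σ V (accept (Finset.range V) F C) P O)
      (hx : x + 1 ≤ pot k q (accept (Finset.range V) F C) P)
      (ht : t = tree q σ (Finset.range V) n (accept (Finset.range V) F C) P O)
  | branch (H : Finset ℕ) (hH : Flower q σ F C H)
      (hi₁ : Inv k q σ V F (H :: P) O) (hx₁ : x + 1 ≤ pot k q F (H :: P))
      (hi₂ : Inv k q σ V F (newPetals F C H ++ P) O)
      (hx₂ : x + 2 ^ (q * k - σ - 1) ≤ pot k q F (newPetals F C H ++ P))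
      (ht : t = .node (tree q σ (Finset.range V) n F (H :: P) O)
        (tree q σ (Finset.range V) n F (newPetals F C H ++ P) O))

lemma Popped.outcome (h : Popped k q σ V F C P O) (hp : Par k q σ V) {n x : ℕ}
    (hx : x ≤ pot k q F (C :: P)) :
    Outcome k q σ V n F C P O x
      (if ∃ E ∈ F, E ⊆ C then tree q σ (Finset.range V) n F P O
      else if pick q σ F C = ∅ then
        tree q σ (Finset.range V) n (Sparsify.accept (Finset.range V) F C) P O
      else .node (tree q σ (Finset.range V) n F (pick q σ F C :: P) O)
        (tree q σ (Finset.range V) n F (newPetals F C (pick q σ F C) ++ P) O)) := by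
  have hx' := hx.trans pot_cons_le
  split_ifs with hs hpick
  · exact .reject hs (hx.trans (pot_cons_of_subsumed hs).le) rfl
  · have := h.pot_accept hp hs
    exact .accept (h.inv_accept hp hs (pick_eq_empty.1 hpick)) (by omega) rfl
  · have hH := pick_flower hpick
    have h1 := h.pot_heart hp hs hH
    have h2 := h.pot_petals hp hs hH
    exact .branch _ hH (h.inv_heart hH) (by omega) (h.inv_petals hp hs hH) (by omega) rfl

/-- The equations of `tree` for a pending and for an original clause are merged here, so that the
inductions below treat one case distinction only. -/
lemma Inv.tree_succ (h : Inv k q σ V F P O) (hp : Par k q σ V) (n : ℕ) :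
    (P = [] ∧ O = [] ∧ tree q σ (Finset.range V) (n + 1) F P O = .leaf F) ∨
    ∃ C P' O', Inv k q σ V F P' O' ∧ IsClause k V C ∧
      (∀ D, D ∈ P ∨ D ∈ O ↔ D = C ∨ D ∈ P' ∨ D ∈ O') ∧
      P.length + O.length = P'.length + O'.length + 1 ∧
      Outcome k q σ V n F C P' O' (pot k q F P) (tree q σ (Finset.range V) (n + 1) F P O) := by
  rcases P with _ | ⟨C, P⟩
  · rcases O with _ | ⟨C, O⟩
    · exact .inl ⟨rfl, rfl, rfl⟩
    · right
      have := h.pop_original.outcome hp (n := n) (x := pot k q F []) pot_nil_le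
      simp only [List.append_nil] at this
      exact ⟨C, [], O, h.pop_original.inv, h.pop_original.isC, by simp, by simp, this⟩
  · right
    refine ⟨C, P, O, h.pop_pending.inv, h.pop_pending.isC, by simp [or_assoc], by simp; omega, ?_⟩
    exact h.pop_pending.outcome hp le_rfl

/-! ### Size, depth and number of the leaves -/

lemma length_accept (U : Finset ℕ) : (accept U F C).length = F.length + 1 := by simp [accept]

lemma mem_range_accept (hF : ∀ D ∈ F, D ⊆ Finset.range V) (hC : C ⊆ Finset.range V) :
    ∀ D ∈ accept (Finset.range V) F C, D ⊆ Finset.range V := by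
  intro D hD
  rcases mem_accept hD with rfl | rfl | ⟨hD, -⟩
  · exact subset_rfl
  · exact hC
  · exact hF D hD

lemma Inv.subset_range (h : Inv k q σ V F P O) : ∀ D ∈ F, D ⊆ Finset.range V := by
  intro D hD
  by_cases hU : D = Finset.range V
  · exact hU.le
  · exact (h.isF D hD hU).2.1

/-- The list of kept clauses grows only when a clause is accepted, and then the potential grows at
least as much; so its length never exceeds the potential. -/
lemma leaves_valid (hp : Par k q σ V) (hk : 1 ≤ k) (n : ℕ) : ∀ {F P O}, Inv k q σ V F P O →
    F.length ≤ pot k q F P → ∀ F' ∈ (tree q σ (Finset.range V) n F P O).leaves,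
      F'.length ≤ maxPot k q V ∧ ∀ D ∈ F', D ⊆ Finset.range V := by
  induction n with
  | zero =>
    intro F P O h hl F' hF'
    simp only [tree, Tree.leaves, List.mem_singleton] at hF'
    subst hF'
    exact ⟨hl.trans (h.pot_le hp hk), h.subset_range⟩
  | succ n ih =>
    intro F P O h hl F' hF'
    rcases h.tree_succ hp n with ⟨-, -, ht⟩ | ⟨C, P', O', hi, hC, -, -, ho⟩
    · simp only [ht, Tree.leaves, List.mem_singleton] at hF'
      subst hF'
      exact ⟨hl.trans (h.pot_le hp hk), h.subset_range⟩
    · rcases ho with ⟨-, hx, ht⟩ | ⟨hi', hx, ht⟩ | ⟨H, hH, hi₁, hx₁, hi₂, hx₂, ht⟩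
      · exact ih hi (hl.trans hx) F' (ht ▸ hF')
      · exact ih hi' (by rw [length_accept]; omega) F' (ht ▸ hF')
      · rw [ht, Tree.leaves, List.mem_append] at hF'
        rcases hF' with hF' | hF'
        · exact ih hi₁ (by omega) F' hF'
        · have : 0 < 2 ^ (q * k - σ - 1) := by positivity
          exact ih hi₂ (by omega) F' hF'

/-- Each branching raises the potential on both sides by at least one, and the potential is bounded.
-/
lemma depth_tree_le (hp : Par k q σ V) (hk : 1 ≤ k) (n : ℕ) : ∀ {F P O}, Inv k q σ V F P O →
    (tree q σ (Finset.range V) n F P O).depth + pot k q F P ≤ maxPot k q V := by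
  induction n with
  | zero =>
    intro F P O h
    simpa [tree, Tree.depth] using h.pot_le hp hk
  | succ n ih =>
    intro F P O h
    rcases h.tree_succ hp n with ⟨-, -, ht⟩ | ⟨C, P', O', hi, hC, -, -, ho⟩
    · simpa [ht, Tree.depth] using h.pot_le hp hk
    · rcases ho with ⟨-, hx, ht⟩ | ⟨hi', hx, ht⟩ | ⟨H, hH, hi₁, hx₁, hi₂, hx₂, ht⟩
      · have := ih hi
        rw [ht]; omega
      · have := ih hi'
        rw [ht]; omega
      · have h1 := ih hi₁
        have h2 := ih hi₂
        have : 0 < 2 ^ (q * k - σ - 1) := by positivity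
        rw [ht, Tree.depth]; omega

/-- The number of leaves is small if `ρ` satisfies the recursive inequality. -/
lemma length_leaves_le (hp : Par k q σ V) (hk : 1 ≤ k) {ρ : ℝ} (h1 : 1 ≤ ρ) {b : ℕ}
    (hb : b + 1 = 2 ^ (q * k - σ - 1)) (hρ : ρ ^ b + 1 ≤ ρ ^ (b + 1)) (n : ℕ) :
    ∀ {F P O}, Inv k q σ V F P O →
      ((tree q σ (Finset.range V) n F P O).leaves.length : ℝ) ≤
        ρ ^ (maxPot k q V - pot k q F P) := by
  induction n with
  | zero =>
    intro F P O _
    simpa [tree, Tree.leaves] using one_le_pow₀ h1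
  | succ n ih =>
    intro F P O h
    rcases h.tree_succ hp n with ⟨-, -, ht⟩ | ⟨C, P', O', hi, hC, -, -, ho⟩
    · simpa [ht, Tree.leaves] using one_le_pow₀ h1
    · rcases ho with ⟨-, hx, ht⟩ | ⟨hi', hx, ht⟩ | ⟨H, hH, hi₁, hx₁, hi₂, hx₂, ht⟩
      · rw [ht]
        exact (ih hi).trans (pow_le_pow_right₀ h1 (by omega))
      · rw [ht]
        exact (ih hi').trans (pow_le_pow_right₀ h1 (by omega))
      · rw [ht, Tree.leaves, List.length_append, Nat.cast_add]
        have e := hi₂.pot_le hp hk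
        -- The petal branch still respects the bound for the potential, so at least `b + 1` was left
        -- before it.
        obtain ⟨m, hm⟩ : ∃ m, maxPot k q V - pot k q F P = m + (b + 1) :=
          ⟨maxPot k q V - pot k q F P - (b + 1), by omega⟩
        have e1 := (ih hi₁).trans (pow_le_pow_right₀ h1 (show _ ≤ m + b by omega))
        have e2 := (ih hi₂).trans (pow_le_pow_right₀ h1 (show _ ≤ m by omega))
        calc _ ≤ ρ ^ (m + b) + ρ ^ m := add_le_add e1 e2
          _ = ρ ^ m * (ρ ^ b + 1) := by ring
          _ ≤ ρ ^ m * ρ ^ (b + 1) := by gcongr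
          _ = _ := by rw [hm, pow_add ρ m]

/-- The set `T` of literals meets the clause `D`. -/
def Hits (T : Set ℕ) (D : Finset ℕ) : Prop := ∃ i ∈ D, i ∈ T

lemma Hits.mono {T : Set ℕ} {D E : Finset ℕ} (h : Hits T D) (hDE : D ⊆ E) : Hits T E := by
  obtain ⟨i, hi, hT⟩ := h
  exact ⟨i, hDE hi, hT⟩

/-- A sufficient number of steps. -/
def fuel (k q V : ℕ) (F P O : List (Finset ℕ)) : ℕ :=
  P.length + O.length + (maxPot k q V - pot k q F P) * (maxPot k q V + 2)

/-- A unit of potential is worth `maxPot + 2` steps, more than the at most `maxPot + 1` clauses that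
become pending. -/
lemma fuel_lt {F' P' O' : List (Finset ℕ)} {a : ℕ} (h1 : pot k q F P + 1 ≤ pot k q F' P')
    (h2 : pot k q F' P' ≤ maxPot k q V) (ha : P.length + O.length = a + 1)
    (h3 : P'.length + O'.length ≤ a + (maxPot k q V + 1)) :
    fuel k q V F' P' O' + 1 ≤ fuel k q V F P O := by
  unfold fuel
  obtain ⟨m, hm⟩ : ∃ m, maxPot k q V - pot k q F P = m + 1 :=
    ⟨maxPot k q V - pot k q F P - 1, by omega⟩
  have h4 : (maxPot k q V - pot k q F' P') * (maxPot k q V + 2) ≤ m * (maxPot k q V + 2) :=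
    Nat.mul_le_mul_right _ (by omega)
  rw [hm, add_mul, one_mul]
  omega

lemma fuel_lt_of_reject {P' O' : List (Finset ℕ)} (h1 : pot k q F P ≤ pot k q F P')
    (h2 : P.length + O.length = P'.length + O'.length + 1) :
    fuel k q V F P' O' + 1 ≤ fuel k q V F P O := by
  unfold fuel
  have h4 : (maxPot k q V - pot k q F P') * (maxPot k q V + 2) ≤
      (maxPot k q V - pot k q F P) * (maxPot k q V + 2) :=
    Nat.mul_le_mul_right _ (by omega)
  omega

lemma deg_le_length (c : ℕ) (X : Finset ℕ) : deg F c X ≤ F.length := List.countP_le_length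

/-- If `T` meets the heart, the heart branch is satisfied; if it misses the heart, every clause that
contains the heart is met inside its petal. Conversely, the heart and the petal `C \ H` both imply
`C`. The placeholder is harmless because `T` meets it by `hT`. -/
lemma hits_leaves (hp : Par k q σ V) (hk : 1 ≤ k) {T : Set ℕ} (hT : Hits T (Finset.range V))
    (n : ℕ) : ∀ {F P O}, Inv k q σ V F P O → F.length ≤ pot k q F P → fuel k q V F P O ≤ n →
      ((∃ F' ∈ (tree q σ (Finset.range V) n F P O).leaves, ∀ D ∈ F', Hits T D) ↔
        (∀ D ∈ F, Hits T D) ∧ ∀ D, D ∈ P ∨ D ∈ O → Hits T D) := by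
  induction n with
  | zero =>
    intro F P O h hl hz
    have hP : P = [] := List.length_eq_zero_iff.1 (by unfold fuel at hz; omega)
    have hO : O = [] := List.length_eq_zero_iff.1 (by unfold fuel at hz; omega)
    simp [tree, Tree.leaves, hP, hO]
  | succ n ih =>
    intro F P O h hl hz
    rcases h.tree_succ hp n with ⟨rfl, rfl, ht⟩ | ⟨C, P', O', hi, hC, hmem, hlen, ho⟩
    · simp [ht, Tree.leaves]
    have hmem' : (∀ D, D ∈ P ∨ D ∈ O → Hits T D) ↔
        Hits T C ∧ ∀ D, D ∈ P' ∨ D ∈ O' → Hits T D := by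
      simp only [hmem, forall_eq_or_imp]
    rw [hmem']
    rcases ho with ⟨⟨E, hE, hEC⟩, hx, ht⟩ | ⟨hi', hx, ht⟩ | ⟨H, hH, hi₁, hx₁, hi₂, hx₂, ht⟩
    · have := fuel_lt_of_reject (V := V) hx hlen
      rw [ht, ih hi (hl.trans hx) (by omega)]
      constructor
      · rintro ⟨h1, h2⟩
        exact ⟨h1, (h1 E hE).mono hEC, h2⟩
      · rintro ⟨h1, -, h2⟩
        exact ⟨h1, h2⟩
    · have := fuel_lt (V := V) (O' := O') hx (hi'.pot_le hp hk) hlen (by omega)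
      rw [ht, ih hi' (by rw [length_accept]; omega) (by omega)]
      constructor
      · rintro ⟨h1, h2⟩
        have hC' : Hits T C := h1 C (by simp [accept])
        refine ⟨fun D hD => ?_, hC', h2⟩
        by_cases hCD : C ⊆ D
        · exact hC'.mono hCD
        · exact h1 D (by simp only [accept, List.mem_append, List.mem_map]
                         exact .inl ⟨D, hD, if_neg hCD⟩)
      · rintro ⟨h1, hC', h2⟩
        refine ⟨fun D hD => ?_, h2⟩
        rcases mem_accept hD with rfl | rfl | ⟨hD, -⟩
        · exact hT
        · exact hC'
        · exact h1 D hD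
    · have hpos : 0 < 2 ^ (q * k - σ - 1) := by positivity
      have f1 := fuel_lt (V := V) (O' := O') hx₁ (hi₁.pot_le hp hk) hlen
        (by rw [List.length_cons]; omega)
      have hl' := hl.trans (h.pot_le hp hk)
      have hd := deg_le_length (F := F) C.card H
      have f2 := fuel_lt (V := V) (O' := O') (show pot k q F P + 1 ≤ _ by omega)
        (hi₂.pot_le hp hk) hlen (by
          rw [List.length_append, length_newPetals]; omega)
      have e1 := ih hi₁ (by omega) (by omega)
      have e2 := ih hi₂ (by omega) (by omega)
      simp only [ht, Tree.leaves, List.mem_append, or_and_right, exists_or]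
      rw [e1, e2]
      constructor
      · rintro (⟨h1, h2⟩ | ⟨h1, h2⟩)
        · exact ⟨h1, (h2 H (by simp)).mono hH.1, fun D hD => h2 D (by
            rcases hD with hD | hD <;> simp [hD])⟩
        · exact ⟨h1, (h2 (C \ H) (.inl (List.mem_append_left _ (by simp [newPetals])))).mono
            Finset.sdiff_subset, fun D hD => h2 D (by
            rcases hD with hD | hD <;> simp [hD])⟩
      · rintro ⟨h1, hC', h2⟩
        by_cases hTH : Hits T H
        · refine .inl ⟨h1, fun D hD => ?_⟩
          rw [List.mem_cons, or_assoc] at hD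
          rcases hD with rfl | hD
          · exact hTH
          · exact h2 D hD
        · have key : ∀ D, Hits T D → Hits T (D \ H) := by
            rintro D ⟨i, hi, hiT⟩
            exact ⟨i, Finset.mem_sdiff.2 ⟨hi, fun hiH => hTH ⟨i, hiH, hiT⟩⟩, hiT⟩
          refine .inr ⟨h1, fun D hD => ?_⟩
          rw [List.mem_append, or_assoc] at hD
          rcases hD with hD | hD
          · rcases mem_newPetals hD with rfl | ⟨E, hE, -, -, rfl⟩
            · exact key _ hC'
            · exact key _ (h1 E hE)
          · exact h2 D hD

/-! ### Enumeration of the leaves -/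

/-- The walk from the root to the leaf whose interval in `[0, y)` contains `x`; the result is the
leaf and the length of its interval. -/
def Tree.walk : Tree → ℕ → ℕ → List (Finset ℕ) × ℕ
  | .leaf F, _, y => (F, y)
  | .node l r, x, y => if y / 2 ≤ x then r.walk (x - y / 2) (y / 2) else l.walk x (y / 2)

/-- Each node halves its interval, so a leaf at depth `t` owns a dyadic interval of length
`2^(L-t)`, which is not empty as `t ≤ L`. The intervals of consecutive leaves abut; adding the
returned length to the current position leads to the next leaf, without any record of the tree. -/
lemma Tree.exists_enumeration (t : Tree) : ∀ {L : ℕ}, t.depth ≤ L →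
    ∃ pos : ℕ → ℕ, pos 0 = 0 ∧ pos t.leaves.length = 2 ^ L ∧
      ∀ i (hi : i < t.leaves.length), pos i < pos (i + 1) ∧ pos (i + 1) ≤ 2 ^ L ∧
        t.walk (pos i) (2 ^ L) = (t.leaves[i], pos (i + 1) - pos i) := by
  induction t with
  | leaf F =>
    intro L _
    refine ⟨fun i => if i = 0 then 0 else 2 ^ L, rfl, by simp [leaves], fun i hi => ?_⟩
    obtain rfl : i = 0 := by simpa [leaves] using hi
    simp [walk, leaves]
  | node l r ihl ihr =>
    intro L hL
    rw [depth] at hL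
    obtain ⟨L, rfl⟩ : ∃ L', L = L' + 1 := ⟨L - 1, by omega⟩
    obtain ⟨pl, hl0, hl1, hl⟩ := ihl (L := L) (by omega)
    obtain ⟨pr, hr0, hr1, hr⟩ := ihr (L := L) (by omega)
    have h2 : 2 ^ (L + 1) / 2 = 2 ^ L := by rw [pow_succ]; omega
    have h3 : 2 ^ (L + 1) = 2 ^ L + 2 ^ L := by rw [pow_succ]; omega
    refine ⟨fun i => if i < l.leaves.length then pl i else 2 ^ L + pr (i - l.leaves.length),
      ?_, ?_, fun i hi => ?_⟩
    · show (if 0 < l.leaves.length then pl 0 else _) = 0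
      split_ifs with h
      · exact hl0
      · have : l.leaves.length = 0 := by omega
        rw [this, hl0] at hl1
        have : 0 < 2 ^ L := by positivity
        omega
    · simp [leaves, hr1, h3]
    · rw [leaves, List.length_append] at hi
      by_cases h : i < l.leaves.length
      · obtain ⟨e1, e2, e3⟩ := hl i h
        -- At the last leaf of `l` both descriptions of the right end agree: `pl` ends in `2 ^ L`,
        -- and `pr` starts in `0`.
        have e4 : (if i + 1 < l.leaves.length then pl (i + 1) else
            2 ^ L + pr (i + 1 - l.leaves.length)) = pl (i + 1) := by
          split_ifs with h'
          · rfl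
          · have : i + 1 = l.leaves.length := by omega
            rw [this, Nat.sub_self, hr0, hl1, add_zero]
        simp only [h, if_true, e4]
        refine ⟨e1, by omega, ?_⟩
        rw [walk, h2, if_neg (by omega), e3]
        simp [leaves, List.getElem_append_left h]
      · obtain ⟨e1, e2, e3⟩ := hr (i - l.leaves.length) (by omega)
        have h' : ¬ i + 1 < l.leaves.length := by omega
        simp only [h, h', if_false]
        rw [show i + 1 - l.leaves.length = i - l.leaves.length + 1 by omega]
        refine ⟨by omega, by omega, ?_⟩
        rw [walk, h2, if_pos (by omega), Nat.add_sub_cancel_left, e3]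
        simp only [leaves, List.getElem_append_right (not_lt.1 h), Prod.mk.injEq, true_and]
        omega

end Sparsify

namespace WordRAM

/-! ### Notation for expressions and commands -/

section Notation

variable {V : Type}

instance : Add (Expr V) := ⟨.bin .add⟩
instance : Sub (Expr V) := ⟨.bin .sub⟩
instance : Mul (Expr V) := ⟨.bin .mul⟩
instance : Div (Expr V) := ⟨.bin .div⟩
instance : Mod (Expr V) := ⟨.bin .mod⟩
instance : AndOp (Expr V) := ⟨.bin .and⟩
instance : OrOp (Expr V) := ⟨.bin .or⟩
instance : XorOp (Expr V) := ⟨.bin .xor⟩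
instance : ShiftLeft (Expr V) := ⟨.bin .shl⟩

variable (s : Store V) (w : ℕ) (a b : Expr V)

@[simp] lemma Expr.val_num (n : ℕ) : (Expr.num n : Expr V).val s = n := rfl
@[simp] lemma Expr.val_var (r : V) : (Expr.var r).val s = s.reg r := rfl
@[simp] lemma Expr.val_get : (Expr.get a).val s = s.mem (a.val s) := rfl
@[simp] lemma Expr.val_add : (a + b).val s = a.val s + b.val s := rfl
@[simp] lemma Expr.val_sub : (a - b).val s = a.val s - b.val s := rfl
@[simp] lemma Expr.val_mul : (a * b).val s = a.val s * b.val s := rfl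
@[simp] lemma Expr.val_div : (a / b).val s = a.val s / b.val s := rfl
@[simp] lemma Expr.val_mod : (a % b).val s = a.val s % b.val s := rfl
@[simp] lemma Expr.val_and : (a &&& b).val s = a.val s &&& b.val s := rfl
@[simp] lemma Expr.val_or : (a ||| b).val s = a.val s ||| b.val s := rfl
@[simp] lemma Expr.val_xor : (a ^^^ b).val s = a.val s ^^^ b.val s := rfl
@[simp] lemma Expr.val_shl : (a <<< b).val s = a.val s * 2 ^ b.val s := Nat.shiftLeft_eq _ _

@[simp] lemma Expr.fits_num (n : ℕ) : (Expr.num n : Expr V).Fits w s ↔ n < 2 ^ w := Iff.rfl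
@[simp] lemma Expr.fits_var (r : V) : (Expr.var r).Fits w s ↔ True := Iff.rfl
@[simp] lemma Expr.fits_get : (Expr.get a).Fits w s ↔ a.Fits w s := Iff.rfl
@[simp] lemma Expr.fits_add :
    (a + b).Fits w s ↔ a.Fits w s ∧ b.Fits w s ∧ a.val s + b.val s < 2 ^ w :=
  ⟨fun h => ⟨h.1, h.2.1, h.2.2 trivial⟩, fun h => ⟨h.1, h.2.1, fun _ => h.2.2⟩⟩
@[simp] lemma Expr.fits_mul :
    (a * b).Fits w s ↔ a.Fits w s ∧ b.Fits w s ∧ a.val s * b.val s < 2 ^ w :=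
  ⟨fun h => ⟨h.1, h.2.1, h.2.2 trivial⟩, fun h => ⟨h.1, h.2.1, fun _ => h.2.2⟩⟩
@[simp] lemma Expr.fits_shl :
    (a <<< b).Fits w s ↔ a.Fits w s ∧ b.Fits w s ∧ a.val s * 2 ^ b.val s < 2 ^ w := by
  rw [← Nat.shiftLeft_eq]
  exact ⟨fun h => ⟨h.1, h.2.1, h.2.2 trivial⟩, fun h => ⟨h.1, h.2.1, fun _ => h.2.2⟩⟩
@[simp] lemma Expr.fits_sub : (a - b).Fits w s ↔ a.Fits w s ∧ b.Fits w s :=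
  ⟨fun h => ⟨h.1, h.2.1⟩, fun h => ⟨h.1, h.2, fun h => h.elim⟩⟩
@[simp] lemma Expr.fits_div : (a / b).Fits w s ↔ a.Fits w s ∧ b.Fits w s :=
  ⟨fun h => ⟨h.1, h.2.1⟩, fun h => ⟨h.1, h.2, fun h => h.elim⟩⟩
@[simp] lemma Expr.fits_mod : (a % b).Fits w s ↔ a.Fits w s ∧ b.Fits w s :=
  ⟨fun h => ⟨h.1, h.2.1⟩, fun h => ⟨h.1, h.2, fun h => h.elim⟩⟩
@[simp] lemma Expr.fits_and : (a &&& b).Fits w s ↔ a.Fits w s ∧ b.Fits w s :=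
  ⟨fun h => ⟨h.1, h.2.1⟩, fun h => ⟨h.1, h.2, fun h => h.elim⟩⟩
@[simp] lemma Expr.fits_or : (a ||| b).Fits w s ↔ a.Fits w s ∧ b.Fits w s :=
  ⟨fun h => ⟨h.1, h.2.1⟩, fun h => ⟨h.1, h.2, fun h => h.elim⟩⟩
@[simp] lemma Expr.fits_xor : (a ^^^ b).Fits w s ↔ a.Fits w s ∧ b.Fits w s :=
  ⟨fun h => ⟨h.1, h.2.1⟩, fun h => ⟨h.1, h.2, fun h => h.elim⟩⟩

@[simp] lemma Expr.cost_num (n : ℕ) : (Expr.num n : Expr V).cost = 1 := rfl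
@[simp] lemma Expr.cost_var (r : V) : (Expr.var r).cost = 1 := rfl
@[simp] lemma Expr.cost_get : (Expr.get a).cost = a.cost + 1 := rfl
@[simp] lemma Expr.cost_add : (a + b).cost = a.cost + b.cost + 1 := rfl
@[simp] lemma Expr.cost_sub : (a - b).cost = a.cost + b.cost + 1 := rfl
@[simp] lemma Expr.cost_mul : (a * b).cost = a.cost + b.cost + 1 := rfl
@[simp] lemma Expr.cost_div : (a / b).cost = a.cost + b.cost + 1 := rfl
@[simp] lemma Expr.cost_mod : (a % b).cost = a.cost + b.cost + 1 := rfl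
@[simp] lemma Expr.cost_and : (a &&& b).cost = a.cost + b.cost + 1 := rfl
@[simp] lemma Expr.cost_or : (a ||| b).cost = a.cost + b.cost + 1 := rfl
@[simp] lemma Expr.cost_xor : (a ^^^ b).cost = a.cost + b.cost + 1 := rfl
@[simp] lemma Expr.cost_shl : (a <<< b).cost = a.cost + b.cost + 1 := rfl

end Notation

infixr:60 ";;" => Cmd.seq

/-! ### Total correctness -/

variable {V : Type} [DecidableEq V] {w : ℕ} {c d : Cmd V} {s : Store V} {T : ℕ}
  {Q R : Store V → Prop} {e a : Expr V} {r : V}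

/-- From the store `s`, the command terminates within `T` steps in a store that satisfies `Q`. -/
def Cmd.Ho (w : ℕ) (c : Cmd V) (s : Store V) (T : ℕ) (Q : Store V → Prop) : Prop :=
  ∃ t ≤ T, ∃ s', c.Exec w s t s' ∧ Q s'

namespace Cmd.Ho

lemma conseq {T' : ℕ} (h : Ho w c s T' R) (hT : T' ≤ T) (hQ : ∀ s', R s' → Q s') :
    Ho w c s T Q := by
  obtain ⟨t, ht, s', hs, hq⟩ := h
  exact ⟨t, ht.trans hT, s', hs, hQ _ hq⟩

lemma skip (h : Q s) : Ho w .skip s T Q := ⟨0, Nat.zero_le _, s, .skip, h⟩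

lemma set (hf : e.Fits w s) (hT : e.cost + 1 ≤ T)
    (h : Q ⟨Function.update s.reg r (e.val s), s.mem⟩) : Ho w (.set r e) s T Q :=
  ⟨_, hT, _, .set hf, h⟩

lemma put (ha : a.Fits w s) (hf : e.Fits w s) (hT : a.cost + e.cost + 1 ≤ T)
    (h : Q ⟨s.reg, Function.update s.mem (a.val s) (e.val s)⟩) : Ho w (.put a e) s T Q :=
  ⟨_, hT, _, .put ha hf, h⟩

lemma seq {T' : ℕ} (h : Ho w c s T' R) (hT : T' ≤ T)
    (h' : ∀ s', R s' → Ho w d s' (T - T') Q) : Ho w (c;;d) s T Q := by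
  obtain ⟨t, ht, s', hs, hr⟩ := h
  obtain ⟨t', ht', s'', hs', hq⟩ := h' s' hr
  exact ⟨t + t', by omega, s'', .seq hs hs', hq⟩

lemma set_seq (hf : e.Fits w s) (hT : e.cost + 1 ≤ T)
    (h : Ho w d ⟨Function.update s.reg r (e.val s), s.mem⟩ (T - (e.cost + 1)) Q) :
    Ho w (.set r e;;d) s T Q :=
  seq (set hf le_rfl rfl) hT (by rintro _ rfl; exact h)

lemma put_seq (ha : a.Fits w s) (hf : e.Fits w s) (hT : a.cost + e.cost + 1 ≤ T)
    (h : Ho w d ⟨s.reg, Function.update s.mem (a.val s) (e.val s)⟩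
      (T - (a.cost + e.cost + 1)) Q) : Ho w (.put a e;;d) s T Q :=
  seq (put ha hf le_rfl rfl) hT (by rintro _ rfl; exact h)

lemma ite (hf : e.Fits w s) (hT : e.cost + 3 ≤ T)
    (h : e.val s ≠ 0 → Ho w c s (T - (e.cost + 3)) Q)
    (h' : e.val s = 0 → Ho w d s (T - (e.cost + 3)) Q) : Ho w (.ite e c d) s T Q := by
  by_cases hv : e.val s = 0
  · obtain ⟨t, ht, s', hs, hq⟩ := h' hv
    exact ⟨_, by omega, s', .ite_false hf hv hs, hq⟩
  · obtain ⟨t, ht, s', hs, hq⟩ := h hv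
    exact ⟨_, by omega, s', .ite_true hf hv hs, hq⟩

/-- A loop with a decreasing measure. -/
lemma loop (I : ℕ → Store V → Prop) {n T' : ℕ} (h : I n s)
    (hf : ∀ j s, j ≤ n → I j s → e.Fits w s)
    (hstep : ∀ j s, j ≤ n → I j s → e.val s ≠ 0 → Ho w c s T' (fun s' => ∃ j' < j, I j' s'))
    (hQ : ∀ j s, j ≤ n → I j s → e.val s = 0 → Q s) (hT : (n + 1) * (T' + e.cost + 3) ≤ T) :
    Ho w (.loop e c) s T Q := by
  suffices ∀ j ≤ n, ∀ s, I j s → Ho w (.loop e c) s ((j + 1) * (T' + e.cost + 3)) Q from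
    conseq (this n le_rfl s h) hT fun _ h => h
  intro j
  induction j using Nat.strong_induction_on with
  | _ j ih =>
    intro hj s hs
    by_cases hv : e.val s = 0
    · refine ⟨e.cost + 1, ?_, s, .loop_false (hf j s hj hs) hv, hQ j s hj hs hv⟩
      rw [add_mul]; omega
    · obtain ⟨t, ht, s', hc, j', hj', hs'⟩ := hstep j s hj hs hv
      obtain ⟨t', ht', s'', hl, hq⟩ := ih j' hj' (by omega) s' hs'
      refine ⟨_, ?_, s'', .loop_true (hf j s hj hs) hv hc hl, hq⟩
      have : (j' + 1) * (T' + e.cost + 3) ≤ j * (T' + e.cost + 3) :=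
        Nat.mul_le_mul_right _ hj'
      rw [add_mul]
      omega

/-- A loop with a known number of rounds. -/
lemma count (I : ℕ → Store V → Prop) (n T' : ℕ) (h : I 0 s)
    (hf : ∀ i s, i ≤ n → I i s → e.Fits w s ∧ (e.val s = 0 ↔ i = n))
    (hstep : ∀ i s, i < n → I i s → Ho w c s T' (I (i + 1)))
    (hQ : ∀ s, I n s → Q s) (hT : (n + 1) * (T' + e.cost + 3) ≤ T) :
    Ho w (.loop e c) s T Q := by
  refine loop (fun j s => j ≤ n ∧ I (n - j) s) (n := n) (T' := T') ⟨le_rfl, by simpa using h⟩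
    (fun j s hj hI => (hf _ s (Nat.sub_le _ _) hI.2).1) (fun j s hj hI hv => ?_)
    (fun j s hj hI hv => ?_) hT
  · have h1 : n - j ≠ n := fun h' => hv ((hf _ s (Nat.sub_le _ _) hI.2).2.2 h')
    refine conseq (hstep (n - j) s (by omega) hI.2) le_rfl fun s' hs' => ?_
    exact ⟨j - 1, by omega, by omega, by rwa [show n - (j - 1) = n - j + 1 by omega]⟩
  · have h1 := (hf _ s (Nat.sub_le _ _) hI.2).2.1 hv
    exact hQ s (h1 ▸ hI.2)

end Cmd.Ho

/-! ### What a command leaves unchanged -/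

/-- The command may change the register `x`. -/
def Cmd.Writes (x : V) : Cmd V → Prop
  | .skip => False
  | .set r _ => x = r
  | .put _ _ => False
  | .seq c d => c.Writes x ∨ d.Writes x
  | .ite _ c d => c.Writes x ∨ d.Writes x
  | .loop _ c => c.Writes x
  | .sim _ _ r => x = r

/-- The command does not write into the memory. -/
def Cmd.Pure : Cmd V → Prop
  | .skip => True
  | .set _ _ => True
  | .put _ _ => False
  | .seq c d => c.Pure ∧ d.Pure
  | .ite _ c d => c.Pure ∧ d.Pure
  | .loop _ c => c.Pure
  | .sim _ _ _ => False

lemma Cmd.Exec.reg_eq {s' : Store V} {t : ℕ} (h : Exec w c s t s') {x : V} (hx : ¬ c.Writes x) :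
    s'.reg x = s.reg x := by
  induction h with
  | skip | put | loop_false => rfl
  | set | sim => simpa [Writes, Function.update_apply] using fun h => absurd h hx
  | seq _ _ ih₁ ih₂ =>
    simp only [Writes, not_or] at hx
    rw [ih₂ hx.2, ih₁ hx.1]
  | ite_true _ _ _ ih =>
    simp only [Writes, not_or] at hx
    exact ih hx.1
  | ite_false _ _ _ ih =>
    simp only [Writes, not_or] at hx
    exact ih hx.2
  | loop_true _ _ _ _ ih₁ ih₂ => rw [ih₂ hx, ih₁ hx]

lemma Cmd.Exec.mem_eq {s' : Store V} {t : ℕ} (h : Exec w c s t s') (hc : c.Pure) :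
    s'.mem = s.mem := by
  induction h with
  | skip | set | loop_false => rfl
  | put | sim => exact hc.elim
  | seq _ _ ih₁ ih₂ => rw [ih₂ hc.2, ih₁ hc.1]
  | ite_true _ _ _ ih => exact ih hc.1
  | ite_false _ _ _ ih => exact ih hc.2
  | loop_true _ _ _ _ ih₁ ih₂ => rw [ih₂ hc, ih₁ hc]

/-- `t` has the registers and the memory of `s`, except for what `c` may write into. -/
structure Cmd.Keeps (c : Cmd V) (s t : Store V) : Prop where
  reg : ∀ x, ¬ c.Writes x → t.reg x = s.reg x
  mem : c.Pure → t.mem = s.mem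

lemma Cmd.Keeps.refl (c : Cmd V) (s : Store V) : c.Keeps s s := ⟨fun _ _ => rfl, fun _ => rfl⟩

lemma Cmd.Keeps.trans {s t u : Store V} (h : c.Keeps s t) (h' : c.Keeps t u) : c.Keeps s u :=
  ⟨fun x hx => (h'.reg x hx).trans (h.reg x hx), fun hc => (h'.mem hc).trans (h.mem hc)⟩

lemma Cmd.Ho.keeps (h : Ho w c s T Q) : Ho w c s T (fun t => Q t ∧ c.Keeps s t) := by
  obtain ⟨t, ht, s', hs, hq⟩ := h
  exact ⟨t, ht, s', hs, hq, fun x hx => hs.reg_eq hx, fun hc => hs.mem_eq hc⟩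

/-- A loop with a decreasing measure, where the invariant need not mention what the body does not
change. -/
lemma Cmd.Ho.loop_keeps (I : ℕ → Store V → Prop) {n T' : ℕ} (h : I n s)
    (hf : ∀ j t, j ≤ n → I j t → c.Keeps s t → e.Fits w t)
    (hstep : ∀ j t, j ≤ n → I j t → c.Keeps s t → e.val t ≠ 0 →
      Ho w c t T' (fun t' => ∃ j' < j, I j' t'))
    (hQ : ∀ j t, j ≤ n → I j t → c.Keeps s t → e.val t = 0 → Q t)
    (hT : (n + 1) * (T' + e.cost + 3) ≤ T) : Ho w (.loop e c) s T Q := by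
  refine loop (fun j t => I j t ∧ c.Keeps s t) ⟨h, .refl _ _⟩ (fun j t hj hI => hf j t hj hI.1 hI.2)
    (fun j t hj hI hv => ?_) (fun j t hj hI hv => hQ j t hj hI.1 hI.2 hv) hT
  refine (hstep j t hj hI.1 hI.2 hv).keeps.conseq le_rfl ?_
  rintro t' ⟨⟨j', hj', hI'⟩, hk⟩
  exact ⟨j', hj', hI', hI.2.trans hk⟩

/-- A loop with a known number of rounds, where the invariant need not mention what the body does
not change. -/
lemma Cmd.Ho.count_keeps (I : ℕ → Store V → Prop) (n T' : ℕ) (h : I 0 s)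
    (hf : ∀ i t, i ≤ n → I i t → c.Keeps s t → e.Fits w t ∧ (e.val t = 0 ↔ i = n))
    (hstep : ∀ i t, i < n → I i t → c.Keeps s t → Ho w c t T' (I (i + 1)))
    (hQ : ∀ t, I n t → c.Keeps s t → Q t) (hT : (n + 1) * (T' + e.cost + 3) ≤ T) :
    Ho w (.loop e c) s T Q := by
  refine count (fun i t => I i t ∧ c.Keeps s t) n T' ⟨h, .refl _ _⟩
    (fun i t hi hI => hf i t hi hI.1 hI.2)
    (fun i t hi hI => ?_) (fun t hI => hQ t hI.1 hI.2) hT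
  exact (hstep i t hi hI.1 hI.2).keeps.conseq le_rfl fun t' ht' => ⟨ht'.1, hI.2.trans ht'.2⟩

end WordRAM

namespace Reduction

open WordRAM Sparsify Filter

/-! ### The program -/

/-- The registers of the reduction. -/
inductive Reg where
  | ans | h | m | bF | bP | S | U | N | lim | x | y | xr | base | dim | f | p | mo | po | C | c
  | H | Hf | cnt | j | D | d | tmp | rej | row | addr | M | res
  deriving DecidableEq

/-- The contents of a register as an expression. -/
abbrev v (r : Reg) : Expr Reg := .var r

/-- A constant as an expression. -/
abbrev n (x : ℕ) : Expr Reg := .num x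

/-- Count the bits of `src`. -/
def popc (src dst : Reg) : Cmd Reg :=
  .set .tmp (v src);; .set dst (n 0);;
  .loop (v .tmp) (.set dst (v dst + v .tmp % (n 2));; .set .tmp (v .tmp / (n 2)))

/-- Is the clause `C` implied by a kept clause? -/
def checkReject : Cmd Reg :=
  .set .rej (n 0);; .set .j (n 0);;
  .loop (v .f - v .j) (
    .set .D (.get (v .bF + v .j));;
    -- The tested word is zero iff `D ⊆ C`.
    .ite ((v .D &&& v .C) ^^^ v .D) .skip (.set .rej (n 1));;
    .set .j (v .j + (n 1)))

/-- One more than the number of kept clauses of size `c` that contain `H`. -/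
def countFlower : Cmd Reg :=
  .set .cnt (n 1);; .set .j (n 0);;
  .loop (v .f - v .j) (
    .set .D (.get (v .bF + v .j));;
    .ite ((v .D &&& v .H) ^^^ v .H) .skip (
      popc .D .d;;
      .ite (v .d ^^^ v .c) .skip (.set .cnt (v .cnt + (n 1))));;
    .set .j (v .j + (n 1)))

/-- Find the heart `Hf` of a flower that is completed by `C`. -/
def findFlower (q σ : ℕ) : Cmd Reg :=
  popc .C .c;; .set .Hf (n 0);; .set .H ((v .C - (n 1)) &&& v .C);;
  .loop (v .H) (
    countFlower;;
    popc .H .d;;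
    -- By truncated subtraction this is nonzero iff the threshold is at most `cnt`, which already
    -- counts `C`.
    .ite (v .cnt + (n 1) - ((n 1) <<< ((n q) * (v .c - v .d) - (n σ)))) (.set .Hf (v .H)) .skip;;
    .set .H ((v .H - (n 1)) &&& v .C))

/-- Put the petals of the flower with heart `Hf` on the stack. -/
def pushPetals : Cmd Reg :=
  .set .j (n 0);;
  .loop (v .f - v .j) (
    .set .D (.get (v .bF + v .j));;
    .ite ((v .D &&& v .Hf) ^^^ v .Hf) .skip (
      popc .D .d;;
      .ite (v .d ^^^ v .c) .skip (
        .put (v .bP + v .p) (v .D - v .Hf);; .set .p (v .p + (n 1))));;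
    .set .j (v .j + (n 1)));;
  .put (v .bP + v .p) (v .C - v .Hf);; .set .p (v .p + (n 1))

/-- Keep the clause `C`. -/
def acceptClause : Cmd Reg :=
  .set .j (n 0);;
  .loop (v .f - v .j) (
    .set .D (.get (v .bF + v .j));;
    .ite ((v .D &&& v .C) ^^^ v .C) .skip (.put (v .bF + v .j) (v .U));;
    .set .j (v .j + (n 1)));;
  .put (v .bF + v .f) (v .C);; .set .f (v .f + (n 1))

/-- Replace the flower with heart `Hf` by its heart or by its petals. -/
def branch : Cmd Reg :=
  .set .y (v .y / (n 2));;
  .ite (v .xr + (n 1) - v .y) (.set .xr (v .xr - v .y);; pushPetals)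
    (.put (v .bP + v .p) (v .Hf);; .set .p (v .p + (n 1)))

/-- Process the clause `C`. -/
def process (q σ : ℕ) : Cmd Reg :=
  checkReject;;
  .ite (v .rej) .skip (findFlower q σ;; .ite (v .Hf) branch acceptClause)

/-- Read the next original clause into `C`. -/
def readClause (k : ℕ) : Cmd Reg :=
  .set .C (n 0);; .set .j (n 0);;
  .loop ((n k) - v .j) (
    .set .D (.get (v .po));;
    -- The input word `2x + s` becomes the literal `x + s * 2h`: numbers below `2h` are negative
    -- literals, the others positive ones.
    .set .C (v .C ||| ((n 1) <<< (v .D / (n 2) + (v .D % (n 2)) * ((n 2) * v .h))));;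
    .set .po (v .po + (n 1));;
    .set .j (v .j + (n 1)));;
  .set .mo (v .mo - (n 1))

/-- Take the next clause from the stack or the original clauses. -/
def popClause (k : ℕ) : Cmd Reg :=
  .ite (v .p) (.set .p (v .p - (n 1));; .set .C (.get (v .bP + v .p))) (readClause k)

/-- Sparsification along the path given by `x`. -/
def sparsify (k q σ : ℕ) : Cmd Reg :=
  .set .f (n 0);; .set .p (n 0);; .set .mo (v .m);; .set .po (n 2);; .set .xr (v .x);; .set .y (v .lim);;
  .loop (v .p + v .mo) (popClause k;; process q σ)

/-- Add clauses that are always satisfied and make the vectors different. -/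
def addDummies : Cmd Reg :=
  .set .j (n 0);;
  .loop (v .h - v .j) (
    .put (v .bF + v .f) (((n 1) <<< ((n 2) * v .h + v .j)) |||
      (((n 1) <<< v .h) ||| ((n 1) <<< ((n 3) * v .h))));;
    .set .f (v .f + (n 1));;
    .put (v .bF + v .f) (((n 1) <<< ((n 3) * v .h + v .j)) ||| ((n 1) ||| ((n 1) <<< ((n 2) * v .h))));;
    .set .f (v .f + (n 1));;
    .set .j (v .j + (n 1)))

/-- The literals satisfied by the assignment `row` to the first half of the variables. -/
def rowMask : Expr Reg := (v .row <<< ((n 2) * v .h)) ||| ((v .N - (n 1)) ^^^ v .row)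

/-- Write the rows of a matrix; `body` writes two entries. -/
def rows (e : Expr Reg) (body : Cmd Reg) : Cmd Reg :=
  .set .row (n 0);;
  .loop (v .N - v .row) (
    .set .M e;; .set .j (n 0);;
    .loop (v .f - v .j) (body;; .set .j (v .j + (n 1)));;
    .set .addr (v .addr + v .dim);; .set .row (v .row + (n 1)))

/-- Write two entries of the first matrix. -/
def entriesA : Cmd Reg :=
  -- The memory is zero beforehand, so only ones have to be written.
  .ite (.get (v .bF + v .j) &&& v .M) (.put (v .addr + (n 2) * v .j) (n 1))
    (.put (v .addr + (n 2) * v .j + (n 1)) (n 1))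

/-- Write two entries of the second matrix. -/
def entriesB : Cmd Reg :=
  .put (v .addr + (n 2) * v .j) (n 1);;
  .ite (.get (v .bF + v .j) &&& v .M) (.put (v .addr + (n 2) * v .j + (n 1)) (n 1)) .skip

/-- Write the instance and solve it. -/
def solve (p : Program) : Cmd Reg :=
  addDummies;;
  .put (v .base) (v .N);; .put (v .base + (n 1)) (v .dim);; .put (v .base + (n 2)) (v .f);;
  .set .addr (v .base + (n 3));; rows rowMask entriesA;;
  rows (rowMask <<< v .h) entriesB;;
  .sim p .base .res;;
  .ite (v .res) (.set .ans (n 1)) .skip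

/-- Initialization of the registers. -/
def setup (h₀ G L : ℕ) : Cmd Reg :=
  .set .h (.get (n 0) / (n 2) + (n h₀));; .set .m (.get (n 1));;
  .set .S ((n 1) <<< ((n G) * v .h));;
  .set .bF (v .S);; .set .bP ((n 2) * v .S);; .set .base ((n 3) * v .S);;
  .set .U (((n 1) <<< ((n 4) * v .h)) - (n 1));; .set .N ((n 1) <<< v .h);;
  .set .lim ((n 1) <<< ((n L) * v .h));;
  .set .x (n 0);; .set .ans (n 0)

/-- The whole program; the command `getDim` puts the dimension into `dim`. -/
def main (k q σ h₀ G L : ℕ) (getDim : Cmd Reg) (p : Program) : Cmd Reg :=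
  -- The block from `3 * S` to `4 * S` is the workspace of `getDim`; the instances start above it.
  setup h₀ G L;; getDim;; .set .base (v .base + v .S);;
  .loop (v .lim - v .x) (
    sparsify k q σ;; solve p;;
    -- The next leaf gets a block that is still zero; `y` is the length of the interval of the leaf
    -- just treated.
    .set .base (v .base + v .S);; .set .x (v .x + v .y))

/-! ### Verification: sparsification -/

/-- The numbers that occur in the analysis. -/
structure Cfg where
  -- `S` is the length of a block of memory. `Y` bounds the lengths of kept lists and the number of
  -- subsets of a clause; the time of one round is a polynomial in `Y`.
  (k q σ h S w Y : ℕ)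
  par : Par k q σ (4 * h)
  k_pos : 1 ≤ k
  mask : 2 ^ (4 * h) ≤ S
  thr : 2 ^ (q * k) ≤ S
  word : 64 * S ≤ 2 ^ w
  lits : 4 * h + 2 ≤ Y
  pot : maxPot k q (4 * h) + 2 * h + 2 ≤ Y
  subs : 2 ^ k ≤ Y
  small : Y ≤ S

lemma Cfg.w_ne_zero (Γ : Cfg) : Γ.w ≠ 0 := by
  intro h
  have hY := Γ.lits
  have hS := Γ.small
  have hw := Γ.word
  rw [h] at hw
  omega

/-- The list `l` of clauses is stored from the address `b` on. -/
def Arr (m : ℕ → ℕ) (b : ℕ) (l : List (Finset ℕ)) : Prop :=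
  ∀ j (h : j < l.length), m (b + j) = enc l[j]

/-- The store holds the list `F` of kept clauses. -/
structure Kept (Γ : Cfg) (s : Store Reg) (F : List (Finset ℕ)) : Prop where
  bF : s.reg .bF = Γ.S
  f : s.reg .f = F.length
  arr : Arr s.mem Γ.S F
  sub : ∀ D ∈ F, D ⊆ Finset.range (4 * Γ.h)
  len : F.length + 1 ≤ Γ.Y

lemma popc_spec (Γ : Cfg) {s : Store Reg} {A : Finset ℕ} {src dst : Reg} (hs : s.reg src = enc A)
    (hA : A ⊆ Finset.range (4 * Γ.h)) (h1 : dst ≠ .tmp) (h2 : dst ≠ src) :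
    (popc src dst).Ho Γ.w s (40 * Γ.Y) (fun t => t.reg dst = A.card ∧ (popc src dst).Keeps s t) := by
  have hY := Γ.lits
  have hS := Γ.small
  have hw := Γ.word
  have hw0 := Γ.w_ne_zero
  have hcard : A.card ≤ 4 * Γ.h := by simpa using Finset.card_le_card hA
  apply Cmd.Ho.keeps
  unfold popc
  refine .set_seq (by simp) (by simp; omega) (.set_seq (by simp) (by simp; omega) ?_)
  refine .loop_keeps (fun j t => t.reg .tmp < 2 ^ j ∧ t.reg dst + popcount (t.reg .tmp) = A.card)
    (n := 4 * Γ.h) (T' := 10) ?_ (by simp) ?_ ?_ ?_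
  · have h3 : src ≠ dst := h2.symm
    simp [Function.update_apply, h1.symm, hs, popcount_enc, enc_lt hA]
  · rintro j t hj ⟨ht1, ht2⟩ - hne
    simp only [Expr.val_var] at hne
    have := popcount_eq (t.reg .tmp)
    refine .set_seq (by simp; omega) (by simp) (.set (by simp; omega) (by simp) ?_)
    have hj0 : j ≠ 0 := by rintro rfl; simp at ht1; exact hne ht1
    refine ⟨j - 1, by omega, ?_, ?_⟩
    · have : 2 ^ j = 2 * 2 ^ (j - 1) := by rw [← pow_succ']; congr 1; omega
      simp only [Function.update_self, Expr.val_div, Expr.val_var, Expr.val_num,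
        Function.update_of_ne h1.symm]
      omega
    · simp [Function.update_apply, h1, h1.symm]
      omega
  · rintro j t hj ⟨ht1, ht2⟩ - h0
    simp only [Expr.val_var] at h0
    simpa [h0, popcount] using ht2
  · simp
    omega

lemma Kept.keeps {Γ : Cfg} {s t : Store Reg} {F : List (Finset ℕ)} (h : Kept Γ s F) {c : Cmd Reg}
    (hk : c.Keeps s t) (hp : c.Pure) (h1 : ¬ c.Writes .bF) (h2 : ¬ c.Writes .f) : Kept Γ t F :=
  ⟨(hk.reg _ h1).trans h.bF, (hk.reg _ h2).trans h.f, fun j hj => by rw [hk.mem hp, h.arr j hj],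
    h.sub, h.len⟩

lemma checkReject_spec (Γ : Cfg) {s : Store Reg} {F : List (Finset ℕ)} (hF : Kept Γ s F)
    {C : Finset ℕ} (hC : s.reg .C = enc C) :
    checkReject.Ho Γ.w s (40 * Γ.Y) (fun t => (t.reg .rej ≠ 0 ↔ ∃ E ∈ F, E ⊆ C) ∧
      checkReject.Keeps s t) := by
  have hY := Γ.lits
  have hS := Γ.small
  have hw := Γ.word
  have hw0 := Γ.w_ne_zero
  have hlen := hF.len
  apply Cmd.Ho.keeps
  unfold checkReject
  refine .set_seq (by simp) (by simp; omega) (.set_seq (by simp) (by simp; omega) ?_)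
  refine .count_keeps (fun i t => t.reg .j = i ∧
    (t.reg .rej ≠ 0 ↔ ∃ E ∈ F.take i, E ⊆ C)) F.length 19 ?_ ?_ ?_ ?_ ?_
  · simp [Function.update_apply]
  · rintro i t hi ⟨hj, -⟩ hk
    have e1 := hk.reg .f (by simp [Cmd.Writes])
    simp [Function.update_apply, hF.f] at e1
    simp [hj, e1]
    omega
  · rintro i t hi ⟨hj, hr⟩ hk
    have e1 := hk.reg .bF (by simp [Cmd.Writes])
    have e2 := hk.reg .C (by simp [Cmd.Writes])
    have e3 := hk.mem (by simp [Cmd.Pure])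
    simp [Function.update_apply, hF.bF, hC] at e1 e2 e3
    have e4 := hF.arr i hi
    have hx : (enc F[i] &&& enc C) ^^^ enc F[i] = 0 ↔ F[i] ⊆ C := by
      rw [Nat.xor_eq_zero_iff, enc_and_eq_left]
    refine .set_seq (by simp; omega) (by simp) (.seq (T' := 10) (R := fun u => u.reg .j = i ∧ 
      (u.reg .rej ≠ 0 ↔ ∃ E ∈ F.take (i + 1), E ⊆ C)) ?_ (by simp) ?_)
    · simp only [List.take_succ_eq_append_getElem hi, List.mem_append, List.mem_singleton, or_and_right, exists_or,
        exists_eq_left]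
      refine .ite (by simp) (by simp) (fun hne => .skip ?_) (fun h0 => .set ?_ ?_ ?_)
      · simp [Function.update_apply, e1, e2, e3, e4, hj, hx] at hne ⊢
        simpa [hne] using hr
      · simp; omega
      · simp
      · simp [Function.update_apply, e1, e2, e3, e4, hj, hx] at h0 ⊢
        simp [h0]
    · rintro u ⟨hu1, hu2⟩
      refine .set (by simp [hu1]; omega) (by simp) ?_
      simpa [Function.update_apply, hu1] using hu2
  · rintro t ⟨-, hr⟩ -
    simpa using hr
  · simp
    omega


lemma Cfg.pow_bounds (Γ : Cfg) : Γ.Y ≤ Γ.Y ^ 2 ∧ Γ.Y ^ 2 ≤ Γ.Y ^ 3 ∧ 1 ≤ Γ.Y := by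
  have : 1 ≤ Γ.Y := by have := Γ.lits; omega
  exact ⟨Nat.le_self_pow (by norm_num) _, Nat.pow_le_pow_right this (by norm_num), this⟩

lemma countFlower_spec (Γ : Cfg) {s : Store Reg} {F : List (Finset ℕ)} (hF : Kept Γ s F)
    {H : Finset ℕ} (hH : s.reg .H = enc H) {c : ℕ} (hc : s.reg .c = c) :
    countFlower.Ho Γ.w s (110 * Γ.Y ^ 2)
      (fun t => t.reg .cnt = deg F c H + 1 ∧ countFlower.Keeps s t) := by
  have hY := Γ.lits
  have hS := Γ.small
  have hw := Γ.word
  have hw0 := Γ.w_ne_zero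
  have hlen := hF.len
  obtain ⟨hY2, -, hY1⟩ := Γ.pow_bounds
  apply Cmd.Ho.keeps
  unfold countFlower
  refine .set_seq (by simp [hw0]) (by simp; omega) (.set_seq (by simp) (by simp; omega) ?_)
  refine .count_keeps (fun i t => t.reg .j = i ∧ t.reg .cnt = deg (F.take i) c H + 1)
    F.length (40 * Γ.Y + 40) ?_ ?_ ?_ ?_ ?_
  · simp [Function.update_apply]
  · rintro i t hi ⟨hj, -⟩ hk
    have e1 := hk.reg .f (by simp [Cmd.Writes, popc])
    simp [Function.update_apply, hF.f] at e1
    simp [hj, e1]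
    omega
  · rintro i t hi ⟨hj, hr⟩ hk
    have e1 := hk.reg .bF (by simp [Cmd.Writes, popc])
    have e2 := hk.reg .H (by simp [Cmd.Writes, popc])
    have e3 := hk.mem (by simp [Cmd.Pure, popc])
    have e5 := hk.reg .c (by simp [Cmd.Writes, popc])
    simp [Function.update_apply, hF.bF, hH, hc] at e1 e2 e3 e5
    have e4 := hF.arr i hi
    have hx : (enc F[i] &&& enc H) ^^^ enc H = 0 ↔ H ⊆ F[i] := by
      rw [Nat.xor_eq_zero_iff, enc_and_eq_right]
    have hdeg : deg (F.take i) c H ≤ F.length :=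
      (deg_le_length _ _).trans (by rw [List.length_take]; omega)
    refine .set_seq (by simp; omega) (by simp) (.seq (T' := 40 * Γ.Y + 25) (R := fun u =>
      u.reg .j = i ∧ u.reg .cnt = deg (F.take (i + 1)) c H + 1) ?_ (by simp) ?_)
    · simp only [List.take_succ_eq_append_getElem hi, deg_append, deg_cons, deg_nil, zero_add]
      refine .ite (by simp) (by simp) (fun hne => .skip ?_) (fun h0 => ?_)
      · simp [Function.update_apply, e1, e2, e3, e4, hj, hx] at hne ⊢
        simp [hr, hne]
      · simp [Function.update_apply, e1, e2, e3, e4, hj, hx] at h0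
        refine .seq (popc_spec Γ (A := F[i]) ?_ (hF.sub _ (List.getElem_mem hi)) (by simp)
          (by simp)) (by simp) ?_
        · simp [Function.update_apply, e1, e2, e3, e4, hj]
        rintro u ⟨hu, hku⟩
        have g1 := hku.reg .c (by simp [Cmd.Writes, popc])
        have g2 := hku.reg .cnt (by simp [Cmd.Writes, popc])
        have g3 := hku.reg .j (by simp [Cmd.Writes, popc])
        simp [Function.update_apply, e5, hr, hj] at g1 g2 g3
        refine .ite (by simp) (by simp) (fun hne => .skip ?_) (fun h0' => .set ?_ ?_ ?_)
        · simp [hu, g1] at hne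
          simp [g2, g3, hne]
        · simp; omega
        · simp
        · simp [hu, g1] at h0'
          simp [Function.update_apply, g2, g3, h0', h0]
    · rintro u ⟨hu1, hu2⟩
      refine .set (by simp [hu1]; omega) (by simp) ?_
      simpa [Function.update_apply, hu1] using hu2
  · rintro t ⟨-, hr⟩ -
    simpa using hr
  · simp
    have h1 : (F.length + 1) * (40 * Γ.Y + 40 + 3 + 3) ≤ Γ.Y * (86 * Γ.Y) :=
      Nat.mul_le_mul hlen (by omega)
    have h2 : Γ.Y * (86 * Γ.Y) = 86 * Γ.Y ^ 2 := by ring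
    omega

/-- Subsets of `C` are visited by decreasing code, and a later find overwrites an earlier one, so
the last heart found is the one of least code. The invariant `Good` says that `Hf` is a heart no
larger than any heart above the current `H`, or zero while there is none above. The measure is the
number of subsets with code at most `enc H`. -/
lemma findFlower_spec (Γ : Cfg) {s : Store Reg} {F : List (Finset ℕ)} (hF : Kept Γ s F)
    {C : Finset ℕ} (hC : s.reg .C = enc C) (hCl : IsClause Γ.k (4 * Γ.h) C) :
    (findFlower Γ.q Γ.σ).Ho Γ.w s (600 * Γ.Y ^ 3)
      (fun t => (t.reg .Hf = enc (pick Γ.q Γ.σ F C) ∧ t.reg .c = C.card) ∧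
        (findFlower Γ.q Γ.σ).Keeps s t) := by
  have hY := Γ.lits
  have hS := Γ.small
  have hw := Γ.word
  have hw0 := Γ.w_ne_zero
  have hlen := hF.len
  obtain ⟨hY2, hY3, hY1⟩ := Γ.pow_bounds
  have hcard : C.card ≤ 4 * Γ.h := by simpa using Finset.card_le_card hCl.2.1
  apply Cmd.Ho.keeps
  unfold findFlower
  refine .seq (popc_spec Γ hC hCl.2.1 (by simp) (by simp)) (by omega) ?_
  rintro t₀ ⟨hc₀, hk₀⟩
  have hF₀ := hF.keeps hk₀ (by simp [popc, Cmd.Pure]) (by simp [popc, Cmd.Writes])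
    (by simp [popc, Cmd.Writes])
  have hC₀ : t₀.reg .C = enc C := by rw [hk₀.reg _ (by simp [popc, Cmd.Writes]), hC]
  refine .set_seq (by simp) (by simp; omega) (.set_seq (by simp [hw0]) (by simp; omega) ?_)
  let Good : Store Reg → Finset ℕ → Prop := fun t H =>
    (t.reg .Hf = 0 ∧ ∀ G, Flower Γ.q Γ.σ F C G → enc G ≤ enc H) ∨
    ∃ G, t.reg .Hf = enc G ∧ Flower Γ.q Γ.σ F C G ∧
      ∀ G', Flower Γ.q Γ.σ F C G' → enc H < enc G' → enc G ≤ enc G'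
  refine .loop_keeps (fun j t => ∃ H ⊆ C, H ≠ C ∧ t.reg .H = enc H ∧ Good t H ∧
    (C.powerset.filter (fun G => enc G ≤ enc H)).card ≤ j) (n := 2 ^ C.card)
    (T' := 250 * Γ.Y ^ 2) ?_ (by simp) ?_ ?_ ?_
  · obtain ⟨H, hH⟩ := exists_enc ((enc C - 1) &&& enc C)
    have hHC : H ⊆ C := by
      rw [← enc_and_eq_left, hH, Nat.and_assoc, Nat.and_self]
    have hpos : 0 < enc C := Nat.pos_of_ne_zero (by rw [Ne, enc_eq_zero]; exact hCl.1.ne_empty)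
    refine ⟨H, hHC, ?_, ?_, .inl ⟨?_, ?_⟩, ?_⟩
    · rintro rfl
      have : (enc H - 1) &&& enc H ≤ enc H - 1 := Nat.and_le_left
      omega
    · simp [Function.update_apply, hC₀, hH]
    · simp [Function.update_apply]
    · intro G hG
      rw [hH]
      refine le_pred_and (Nat.and_self _) (enc_and_eq_left.2 hG.1) ?_
      exact lt_of_le_of_ne (enc_mono hG.1) (fun h => hG.2.1 (enc_injective h))
    · exact (Finset.card_filter_le _ _).trans (by rw [Finset.card_powerset])
  · rintro j t hj ⟨H, hHC, hHne, hH, hGood, hcnt⟩ hk hv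
    simp only [Expr.val_var, hH, Ne, enc_eq_zero] at hv
    have e1 : t.reg .C = enc C := by
      rw [hk.reg _ (by simp [Cmd.Writes, popc, countFlower])]
      simp [Function.update_apply, hC₀]
    have e2 : t.reg .c = C.card := by
      rw [hk.reg _ (by simp [Cmd.Writes, popc, countFlower])]
      simp [Function.update_apply, hc₀]
    have hFt : Kept Γ t F := by
      have := hF₀
      refine ⟨?_, ?_, ?_, this.sub, this.len⟩
      · rw [hk.reg _ (by simp [Cmd.Writes, popc, countFlower])]
        simp [Function.update_apply, this.bF]
      · rw [hk.reg _ (by simp [Cmd.Writes, popc, countFlower])]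
        simp [Function.update_apply, this.f]
      · rw [hk.mem (by simp [Cmd.Pure, popc, countFlower])]
        exact this.arr
    have hHcard : H.card < C.card :=
      Finset.card_lt_card ⟨hHC, fun h' => hHne (hHC.antisymm h')⟩
    refine .seq (countFlower_spec Γ hFt hH e2) (by omega) ?_
    rintro t₁ ⟨hcnt₁, hk₁⟩
    have f1 : t₁.reg .C = enc C := by rw [hk₁.reg _ (by simp [Cmd.Writes, popc, countFlower]), e1]
    have f2 : t₁.reg .c = C.card := by rw [hk₁.reg _ (by simp [Cmd.Writes, popc, countFlower]), e2]
    have f3 : t₁.reg .H = enc H := by rw [hk₁.reg _ (by simp [Cmd.Writes, popc, countFlower]), hH]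
    have f4 : t₁.reg .Hf = t.reg .Hf := hk₁.reg _ (by simp [Cmd.Writes, popc, countFlower])
    refine .seq (popc_spec Γ f3 (hHC.trans hCl.2.1) (by simp) (by simp)) (by omega) ?_
    rintro t₂ ⟨hd₂, hk₂⟩
    have g1 : t₂.reg .C = enc C := by rw [hk₂.reg _ (by simp [Cmd.Writes, popc]), f1]
    have g2 : t₂.reg .c = C.card := by rw [hk₂.reg _ (by simp [Cmd.Writes, popc]), f2]
    have g3 : t₂.reg .H = enc H := by rw [hk₂.reg _ (by simp [Cmd.Writes, popc]), f3]
    have g4 : t₂.reg .Hf = t.reg .Hf := by rw [hk₂.reg _ (by simp [Cmd.Writes, popc]), f4]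
    have g5 : t₂.reg .cnt = deg F C.card H + 1 := by
      rw [hk₂.reg _ (by simp [Cmd.Writes, popc]), hcnt₁]
    have hq : Γ.q * (C.card - H.card) ≤ Γ.q * Γ.k :=
      Nat.mul_le_mul_left _ ((Nat.sub_le _ _).trans hCl.2.2)
    have hq1 : Γ.q * Γ.k < 2 ^ (Γ.q * Γ.k) := Nat.lt_two_pow_self
    have hq2 := Γ.thr
    have hq3 : 2 ^ (Γ.q * (C.card - H.card) - Γ.σ) ≤ 2 ^ (Γ.q * Γ.k) :=
      Nat.pow_le_pow_right (by norm_num) (by omega)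
    have hpar := Γ.par.hσ
    have hk0 := Γ.k_pos
    have hqk : Γ.q * 1 ≤ Γ.q * Γ.k := Nat.mul_le_mul_left _ hk0
    have hdl := deg_le_length (F := F) C.card H
    have hflower : Flower Γ.q Γ.σ F C H ↔
        2 ^ (Γ.q * (C.card - H.card) - Γ.σ) ≤ deg F C.card H + 1 :=
      ⟨fun h => h.2.2.2, fun h => ⟨hHC, hHne, Finset.nonempty_iff_ne_empty.2 hv, h⟩⟩
    refine .seq (T' := 30) (R := fun u => u.reg .H = enc H ∧ u.reg .C = enc C ∧
      ((Flower Γ.q Γ.σ F C H ∧ u.reg .Hf = enc H) ∨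
        (¬ Flower Γ.q Γ.σ F C H ∧ u.reg .Hf = t.reg .Hf))) ?_ (by omega) ?_
    · refine .ite ?_ (by simp) (fun hne => .set (by simp) (by simp) ?_) (fun h0 => .skip ?_)
      · simp [hw0, g2, g5, hd₂]
        omega
      · simp [g2, g5, hd₂] at hne
        simp [Function.update_apply, g1, g3, hflower]
        omega
      · simp [g2, g5, hd₂] at h0
        simp [Function.update_apply, g1, g3, hflower, g4]
        omega
    · rintro u ⟨hu1, hu2, hu3⟩
      refine .set (by simp [hw0]) (by simp; omega) ?_
      obtain ⟨H', hH'⟩ := exists_enc ((enc H - 1) &&& enc C)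
      have hH'C : H' ⊆ C := by
        rw [← enc_and_eq_left, hH', Nat.and_assoc, Nat.and_self]
      have hpos : 0 < enc H := Nat.pos_of_ne_zero (by rw [Ne, enc_eq_zero]; exact hv)
      have hlt : enc H' < enc H := by
        have : (enc H - 1) &&& enc C ≤ enc H - 1 := Nat.and_le_left
        omega
      -- By `le_pred_and` no subset of `C` lies strictly between the codes of `H'` and `H`, so no
      -- heart is skipped.
      have hmax : ∀ G, Flower Γ.q Γ.σ F C G → enc H' < enc G → G = H ∨ enc H < enc G := by
        intro G hG hlt'
        rcases lt_trichotomy (enc G) (enc H) with h | h | h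
        · have := le_pred_and (enc_and_eq_left.2 hHC) (enc_and_eq_left.2 hG.1) h
          omega
        · exact .inl (enc_injective h)
        · exact .inr h
      have hsub : C.powerset.filter (fun G => enc G ≤ enc H') ⊂
          C.powerset.filter (fun G => enc G ≤ enc H) := by
        refine ⟨fun G hG => ?_, fun h => ?_⟩
        · simp only [Finset.mem_filter] at hG ⊢
          exact ⟨hG.1, by omega⟩
        · have := @h H (by simp [hHC])
          simp only [Finset.mem_filter] at this
          omega
      refine ⟨(C.powerset.filter (fun G => enc G ≤ enc H')).card,
        (Finset.card_lt_card hsub).trans_le hcnt, H', hH'C, ?_, ?_, ?_, le_rfl⟩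
      · rintro rfl
        have := enc_mono hHC
        omega
      · simp [Function.update_apply, hu1, hu2, hH']
      · rcases hu3 with ⟨hfl, hu3⟩ | ⟨hfl, hu3⟩
        · refine .inr ⟨H, by simp [Function.update_apply, hu3], hfl, fun G' hG' hlt' => ?_⟩
          rcases hmax G' hG' hlt' with rfl | h
          · exact le_rfl
          · exact h.le
        · rcases hGood with ⟨h0, hall⟩ | ⟨G, hG, hGf, hmin⟩
          · refine .inl ⟨by simp [Function.update_apply, hu3, h0], fun G hG => ?_⟩
            by_contra! hcon
            rcases hmax G hG hcon with rfl | h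
            · exact hfl hG
            · exact absurd (hall G hG) (not_le.2 h)
          · refine .inr ⟨G, by simp [Function.update_apply, hu3, hG], hGf, fun G' hG' hlt' => ?_⟩
            rcases hmax G' hG' hlt' with rfl | h
            · exact absurd hG' hfl
            · exact hmin G' hG' h
  · rintro j t hj ⟨H, hHC, hHne, hH, hGood, hcnt⟩ hk hv
    simp only [Expr.val_var, hH, enc_eq_zero] at hv
    subst hv
    refine ⟨?_, ?_⟩
    · rcases hGood with ⟨h0, hall⟩ | ⟨G, hG, hGf, hmin⟩
      · rw [h0, pick_eq_empty.2, enc_empty]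
        intro G hG
        have := hall G hG
        simp only [enc_empty, nonpos_iff_eq_zero, enc_eq_zero] at this
        exact hG.2.2.1.ne_empty this
      · rw [hG, pick_eq ⟨hGf, fun G' hG' => hmin G' hG' ?_⟩]
        rw [enc_empty]
        exact Nat.pos_of_ne_zero (by rw [Ne, enc_eq_zero]; exact hG'.2.2.1.ne_empty)
    · rw [hk.reg _ (by simp [Cmd.Writes, popc, countFlower])]
      simp [Function.update_apply, hc₀]
  · simp
    have h1 : 2 ^ C.card ≤ 2 ^ Γ.k := Nat.pow_le_pow_right (by norm_num) hCl.2.2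
    have h2 := Γ.subs
    have h3 : (2 ^ C.card + 1) * (250 * Γ.Y ^ 2 + 1 + 3) ≤ (2 * Γ.Y) * (254 * Γ.Y ^ 2) :=
      Nat.mul_le_mul (by omega) (by omega)
    have h4 : (2 * Γ.Y) * (254 * Γ.Y ^ 2) = 508 * Γ.Y ^ 3 := by ring
    omega


/-- The pending clauses are stored as a stack. -/
structure Pend (Γ : Cfg) (s : Store Reg) (P : List (Finset ℕ)) : Prop where
  bP : s.reg .bP = 2 * Γ.S
  p : s.reg .p = P.length
  arr : Arr s.mem (2 * Γ.S) P.reverse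

/-- The stores agree outside of the memory for clauses. -/
def Outside (Γ : Cfg) (s t : Store Reg) : Prop :=
  ∀ a, a < Γ.S ∨ 3 * Γ.S ≤ a → t.mem a = s.mem a

lemma Pend.keeps {Γ : Cfg} {s t : Store Reg} {P : List (Finset ℕ)} (h : Pend Γ s P) {c : Cmd Reg}
    (hk : c.Keeps s t) (hp : c.Pure) (h1 : ¬ c.Writes .bP) (h2 : ¬ c.Writes .p) : Pend Γ t P :=
  ⟨(hk.reg _ h1).trans h.bP, (hk.reg _ h2).trans h.p, fun j hj => by rw [hk.mem hp, h.arr j hj]⟩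

lemma Arr.congr {m m' : ℕ → ℕ} {b : ℕ} {l : List (Finset ℕ)} (h : Arr m b l)
    (h' : ∀ j < l.length, m' (b + j) = m (b + j)) : Arr m' b l :=
  fun j hj => (h' j hj).trans (h j hj)

lemma Arr.concat {m : ℕ → ℕ} {b : ℕ} {l : List (Finset ℕ)} (h : Arr m b l) (C : Finset ℕ) :
    Arr (Function.update m (b + l.length) (enc C)) b (l ++ [C]) := by
  intro j hj
  by_cases hj' : j < l.length
  · rw [Function.update_of_ne (by omega), List.getElem_append_left hj', h j hj']
  · obtain rfl : j = l.length := by simp at hj; omega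
    simp

lemma petals_concat (l : List (Finset ℕ)) (D : Finset ℕ) (c : ℕ) (H : Finset ℕ) :
    petals (l ++ [D]) c H = petals l c H ++ if D.card = c ∧ H ⊆ D then [D \ H] else [] := by
  simp only [petals, List.filter_append, List.map_append, List.filter_cons, List.filter_nil]
  split_ifs <;> simp_all

lemma length_petals_le (l : List (Finset ℕ)) (c : ℕ) (H : Finset ℕ) :
    (petals l c H).length ≤ l.length := by
  simpa [petals] using List.length_filter_le _ l

/-- The stack is stored with its top last, so pushing appends to `P.reverse`. The reversal in
`newPetals` makes the outcome agree with the list without any reordering. -/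
lemma pushPetals_spec (Γ : Cfg) {s : Store Reg} {F P : List (Finset ℕ)} (hF : Kept Γ s F)
    (hP : Pend Γ s P) (hroom : P.length + Γ.Y ≤ Γ.S) {C H : Finset ℕ} (hC : s.reg .C = enc C)
    (hH : s.reg .Hf = enc H) (hc : s.reg .c = C.card) (hHC : H ⊆ C) :
    pushPetals.Ho Γ.w s (150 * Γ.Y ^ 2) (fun t => (Kept Γ t F ∧
      Pend Γ t (newPetals F C H ++ P) ∧ Outside Γ s t) ∧ pushPetals.Keeps s t) := by
  have hY := Γ.lits
  have hS := Γ.small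
  have hw := Γ.word
  have hw0 := Γ.w_ne_zero
  have hlen := hF.len
  obtain ⟨hY2, -, hY1⟩ := Γ.pow_bounds
  refine (Cmd.Ho.keeps (Q := fun t => Arr t.mem (2 * Γ.S) (newPetals F C H ++ P).reverse ∧
    t.reg .p = (newPetals F C H ++ P).length ∧
    ∀ a, a < 2 * Γ.S ∨ 3 * Γ.S ≤ a → t.mem a = s.mem a) ?_).conseq le_rfl ?_
  swap
  · rintro t ⟨⟨ht1, ht2, ht3⟩, hk⟩
    refine ⟨⟨⟨?_, ?_, fun j hj => ?_, hF.sub, hF.len⟩, ⟨?_, ht2, ht1⟩, fun a ha => ht3 a (by omega)⟩,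
      hk⟩
    · rw [hk.reg _ (by simp [pushPetals, popc, Cmd.Writes]), hF.bF]
    · rw [hk.reg _ (by simp [pushPetals, popc, Cmd.Writes]), hF.f]
    · rw [ht3 _ (by omega), hF.arr j hj]
    · rw [hk.reg _ (by simp [pushPetals, popc, Cmd.Writes]), hP.bP]
  unfold pushPetals
  refine .set_seq (by simp) (by simp; omega) (.seq (T' := 110 * Γ.Y ^ 2)
    (R := fun t => (t.reg .p = (P.reverse ++ petals F C.card H).length ∧
      Arr t.mem (2 * Γ.S) (P.reverse ++ petals F C.card H) ∧
      ∀ a, a < 2 * Γ.S ∨ 3 * Γ.S ≤ a → t.mem a = s.mem a) ∧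
      pushPetals.Keeps s t) ?_ (by simp; omega) ?_)
  · refine .count_keeps (fun i t => t.reg .j = i ∧
      t.reg .p = (P.reverse ++ petals (F.take i) C.card H).length ∧
      Arr t.mem (2 * Γ.S) (P.reverse ++ petals (F.take i) C.card H) ∧
      ∀ a, a < 2 * Γ.S ∨ 3 * Γ.S ≤ a → t.mem a = s.mem a) F.length (40 * Γ.Y + 64) ?_ ?_ ?_ ?_ ?_
    · simpa [Function.update_apply, petals, hP.p] using hP.arr
    · rintro i t hi ⟨hj, -⟩ hk
      have e1 := hk.reg .f (by simp [Cmd.Writes, popc])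
      simp [Function.update_apply, hF.f] at e1
      simp [hj, e1]
      omega
    · rintro i t hi ⟨hj, hr1, hr2, hr3⟩ hk
      have e1 := hk.reg .bF (by simp [Cmd.Writes, popc])
      have e2 := hk.reg .Hf (by simp [Cmd.Writes, popc])
      have e5 := hk.reg .c (by simp [Cmd.Writes, popc])
      have e6 := hk.reg .bP (by simp [Cmd.Writes, popc])
      simp [Function.update_apply, hF.bF, hH, hc, hP.bP] at e1 e2 e5 e6
      have e4 : t.mem (Γ.S + i) = enc F[i] := by rw [hr3 _ (by omega), hF.arr i hi]
      have hx : (enc F[i] &&& enc H) ^^^ enc H = 0 ↔ H ⊆ F[i] := by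
        rw [Nat.xor_eq_zero_iff, enc_and_eq_right]
      have hpl := length_petals_le (F.take i) C.card H
      rw [List.length_take] at hpl
      rw [List.length_append, List.length_reverse] at hr1
      refine .set_seq (by simp; omega) (by simp) (.seq (T' := 40 * Γ.Y + 50) (R := fun u =>
        u.reg .j = i ∧ u.reg .p = (P.reverse ++ petals (F.take (i + 1)) C.card H).length ∧
        Arr u.mem (2 * Γ.S) (P.reverse ++ petals (F.take (i + 1)) C.card H) ∧
        ∀ a, a < 2 * Γ.S ∨ 3 * Γ.S ≤ a → u.mem a = s.mem a) ?_ (by simp) ?_)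
      · rw [List.take_succ_eq_append_getElem hi, petals_concat, ← List.append_assoc]
        refine .ite (by simp) (by simp) (fun hne => .skip ?_) (fun h0 => ?_)
        · simp [Function.update_apply, e1, e2, e4, hj, hx] at hne
          rw [if_neg (by tauto), List.append_nil]
          refine ⟨by simp [hj], by simp [hr1], hr2, hr3⟩
        · simp [Function.update_apply, e1, e2, e4, hj, hx] at h0
          refine .seq (popc_spec Γ (A := F[i]) ?_ (hF.sub _ (List.getElem_mem hi)) (by simp)
            (by simp)) (by simp) ?_
          · simp [Function.update_apply, e1, e4, hj]
          rintro u ⟨hu, hku⟩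
          have g1 := hku.reg .c (by simp [Cmd.Writes, popc])
          have g2 := hku.reg .D (by simp [Cmd.Writes, popc])
          have g3 := hku.reg .j (by simp [Cmd.Writes, popc])
          have g4 := hku.reg .p (by simp [Cmd.Writes, popc])
          have g5 := hku.reg .bP (by simp [Cmd.Writes, popc])
          have g6 := hku.reg .Hf (by simp [Cmd.Writes, popc])
          have g7 := hku.mem (by simp [Cmd.Pure, popc])
          simp [Function.update_apply, e1, e2, e4, e5, e6, hr1, hj] at g1 g2 g3 g4 g5 g6 g7
          refine .ite (by simp) (by simp) (fun hne => .skip ?_)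
            (fun h0' => .put_seq ?_ (by simp) (by simp) (.set ?_ (by simp) ?_))
          · simp [hu, g1] at hne
            rw [if_neg (by tauto), List.append_nil, g7]
            exact ⟨g3, by simp [g4], hr2, hr3⟩
          · simp [g4, g5]; omega
          · simp [g4]; omega
          · simp [hu, g1] at h0'
            rw [if_pos ⟨h0', h0⟩]
            refine ⟨by simp [g3], by simp [g4]; omega, ?_, fun a ha => ?_⟩
            · have := hr2.concat (F[i] \ H)
              simpa [g2, g4, g5, g6, g7, enc_sub h0] using this
            · simp only [Expr.val_add, Expr.val_var, g4, g5, g7]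
              rw [Function.update_of_ne (by omega), hr3 a ha]
      · rintro u ⟨hu1, hu2, hu3, hu4⟩
        refine .set (by simp [hu1]; omega) (by simp) ?_
        exact ⟨by simp [hu1], by simp [Function.update_apply, hu2], hu3, hu4⟩
    · rintro t ⟨-, hr1, hr2, hr3⟩ hk
      rw [List.take_length] at hr1 hr2
      refine ⟨⟨hr1, hr2, hr3⟩, fun r hx => ?_, fun h => ?_⟩
      · simp only [pushPetals, popc, Cmd.Writes] at hx
        rw [hk.reg _ (by simp [Cmd.Writes, popc]; tauto)]
        exact Function.update_of_ne (by tauto) _ _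
      · simp [pushPetals, Cmd.Pure] at h
    · simp
      have h1 : (F.length + 1) * (40 * Γ.Y + 64 + 3 + 3) ≤ Γ.Y * (110 * Γ.Y) :=
        Nat.mul_le_mul hlen (by omega)
      have h2 : Γ.Y * (110 * Γ.Y) = 110 * Γ.Y ^ 2 := by ring
      omega
  · rintro t ⟨⟨hr1, hr2, hr3⟩, hk⟩
    have hpl := length_petals_le F C.card H
    have hr1' := hr1
    rw [List.length_append, List.length_reverse] at hr1
    have g5 := hk.reg .bP (by simp [Cmd.Writes, popc, pushPetals])
    have g6 := hk.reg .Hf (by simp [Cmd.Writes, popc, pushPetals])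
    have g7 := hk.reg .C (by simp [Cmd.Writes, popc, pushPetals])
    rw [hP.bP] at g5
    rw [hH] at g6
    rw [hC] at g7
    refine .put_seq ?_ (by simp) (by simp; omega) (.set ?_ (by simp; omega) ?_)
    · simp [g5, hr1]; omega
    · simp [hr1]; omega
    · refine ⟨?_, ?_, fun a ha => ?_⟩
      · have := hr2.concat (C \ H)
        simpa [g5, g6, g7, hr1, enc_sub hHC, newPetals] using this
      · simp [hr1, newPetals]; omega
      · simp only [Expr.val_add, Expr.val_var, g5, hr1]
        rw [Function.update_of_ne (by omega), hr3 a ha]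

lemma acceptClause_spec (Γ : Cfg) {s : Store Reg} {F : List (Finset ℕ)} (hF : Kept Γ s F)
    (hroom : F.length + 2 ≤ Γ.Y) {C : Finset ℕ} (hC : s.reg .C = enc C)
    (hCV : C ⊆ Finset.range (4 * Γ.h)) (hU : s.reg .U = enc (Finset.range (4 * Γ.h))) :
    acceptClause.Ho Γ.w s (60 * Γ.Y) (fun t =>
      (Kept Γ t (accept (Finset.range (4 * Γ.h)) F C) ∧
        ∀ a, a < Γ.S ∨ 2 * Γ.S ≤ a → t.mem a = s.mem a) ∧ acceptClause.Keeps s t) := by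
  have hY := Γ.lits
  have hS := Γ.small
  have hw := Γ.word
  have hw0 := Γ.w_ne_zero
  set U := Finset.range (4 * Γ.h) with hUdef
  refine (Cmd.Ho.keeps (Q := fun t => Arr t.mem Γ.S (accept U F C) ∧
    t.reg .f = F.length + 1 ∧
    ∀ a, a < Γ.S ∨ 2 * Γ.S ≤ a → t.mem a = s.mem a) ?_).conseq le_rfl ?_
  swap
  · rintro t ⟨⟨ht1, ht2, ht3⟩, hk⟩
    refine ⟨⟨⟨?_, by rw [ht2, length_accept], ht1, mem_range_accept hF.sub hCV,
      by rw [length_accept]; omega⟩, ht3⟩, hk⟩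
    rw [hk.reg _ (by simp [acceptClause, Cmd.Writes]), hF.bF]
  unfold acceptClause
  refine .set_seq (by simp) (by simp; omega) (.seq (T' := 40 * Γ.Y)
    (R := fun t => (Arr t.mem Γ.S (F.map (fun D => if C ⊆ D then U else D)) ∧
      ∀ a, a < Γ.S ∨ 2 * Γ.S ≤ a → t.mem a = s.mem a) ∧
      (t.reg .f = F.length ∧ t.reg .bF = Γ.S ∧ t.reg .C = enc C)) ?_ (by simp; omega) ?_)
  · refine .count_keeps (fun i t => t.reg .j = i ∧
      (∀ j (h : j < F.length), t.mem (Γ.S + j) =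
        enc (if j < i ∧ C ⊆ F[j] then U else F[j])) ∧
      ∀ a, a < Γ.S ∨ 2 * Γ.S ≤ a → t.mem a = s.mem a) F.length 32 ?_ ?_ ?_ ?_ ?_
    · simpa using fun j h => hF.arr j h
    · rintro i t hi ⟨hj, -⟩ hk
      have e1 := hk.reg .f (by simp [Cmd.Writes])
      simp [Function.update_apply, hF.f] at e1
      simp [hj, e1]
      omega
    · rintro i t hi ⟨hj, hr1, hr2⟩ hk
      have e1 := hk.reg .bF (by simp [Cmd.Writes])
      have e2 := hk.reg .C (by simp [Cmd.Writes])
      have e3 := hk.reg .U (by simp [Cmd.Writes])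
      simp [Function.update_apply, hF.bF, hC, hU] at e1 e2 e3
      have e4 : t.mem (Γ.S + i) = enc F[i] := by rw [hr1 i hi, if_neg (by simp)]
      have hx : (enc F[i] &&& enc C) ^^^ enc C = 0 ↔ C ⊆ F[i] := by
        rw [Nat.xor_eq_zero_iff, enc_and_eq_right]
      refine .set_seq (by simp; omega) (by simp) (.seq (T' := 20) (R := fun u =>
        u.reg .j = i ∧ (∀ j (h : j < F.length), u.mem (Γ.S + j) =
        enc (if j < i + 1 ∧ C ⊆ F[j] then U else F[j])) ∧
        ∀ a, a < Γ.S ∨ 2 * Γ.S ≤ a → u.mem a = s.mem a) ?_ (by simp) ?_)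
      · refine .ite (by simp) (by simp) (fun hne => .skip ?_) (fun h0 => .put ?_ (by simp)
          (by simp) ?_)
        · simp [Function.update_apply, e1, e2, e4, hj, hx] at hne
          refine ⟨by simp [hj], fun j hj' => ?_, hr2⟩
          rw [show (_ : Store Reg).mem (Γ.S + j) = _ from hr1 j hj']
          congr 1
          have : j < i + 1 ↔ j < i ∨ j = i := by omega
          by_cases hji : j = i
          · subst hji; simp [hne]
          · simp [this, hji]
        · simp [Function.update_apply, hj, e1]; omega
        · simp [Function.update_apply, e1, e2, e4, hj, hx] at h0
          refine ⟨by simp [hj], fun j hj' => ?_, fun a ha => ?_⟩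
          · simp only [Expr.val_add, Expr.val_var, Function.update_apply, hj, e1, e3]
            by_cases hji : j = i
            · subst hji; simp [h0, hj, e1, e3]
            · have : j < i + 1 ↔ j < i := by omega
              simp [hji, this, hr1 j hj', hj, e1]
          · simp only [Expr.val_add, Expr.val_var, Function.update_of_ne (show Reg.bF ≠ Reg.D by simp),
              Function.update_of_ne (show Reg.j ≠ Reg.D by simp), hj, e1]
            rw [Function.update_of_ne (by omega), hr2 a ha]
      · rintro u ⟨hu1, hu2, hu3⟩
        refine .set (by simp [hu1]; omega) (by simp) ?_
        exact ⟨by simp [hu1], hu2, hu3⟩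
    · rintro t ⟨-, hr1, hr2⟩ hk
      refine ⟨⟨fun j hj => ?_, hr2⟩, ?_, ?_, ?_⟩
      · simp only [List.length_map] at hj
        rw [hr1 j hj, List.getElem_map]
        simp [hj]
      · rw [hk.reg _ (by simp [Cmd.Writes])]; simp [Function.update_apply, hF.f]
      · rw [hk.reg _ (by simp [Cmd.Writes])]; simp [Function.update_apply, hF.bF]
      · rw [hk.reg _ (by simp [Cmd.Writes])]; simp [Function.update_apply, hC]
    · simp
      omega
  · rintro t ⟨⟨hr1, hr2⟩, hf, hb, hC'⟩
    refine .put_seq ?_ (by simp) (by simp; omega) (.set ?_ (by simp; omega) ?_)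
    · simp [hb, hf]; omega
    · simp [hf]; omega
    · refine ⟨?_, by simp [hf], fun a ha => ?_⟩
      · have := hr1.concat C
        simpa [hf, hb, hC', accept] using this
      · simp only [Expr.val_add, Expr.val_var, hf, hb]
        rw [Function.update_of_ne (by omega), hr2 a ha]

end Reduction

/-! ### One round of the program as one step down the tree -/

namespace Sparsify

variable {k q σ V : ℕ} {F P O : List (Finset ℕ)} {C : Finset ℕ} {x y : ℕ}

/-- The results of processing the clause `C` on the path given by `x` and `y`. -/
inductive Next (q σ V : ℕ) (F : List (Finset ℕ)) (C : Finset ℕ) (P : List (Finset ℕ)) (x y : ℕ) :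
    List (Finset ℕ) → List (Finset ℕ) → ℕ → ℕ → Prop
  | reject (hs : ∃ E ∈ F, E ⊆ C) : Next q σ V F C P x y F P x y
  | accept (hs : ¬ ∃ E ∈ F, E ⊆ C) (hp : pick q σ F C = ∅) :
      Next q σ V F C P x y (accept (Finset.range V) F C) P x y
  | heart (hs : ¬ ∃ E ∈ F, E ⊆ C) (hp : pick q σ F C ≠ ∅) (hx : x < y / 2) :
      Next q σ V F C P x y F (pick q σ F C :: P) x (y / 2)
  | petals (hs : ¬ ∃ E ∈ F, E ⊆ C) (hp : pick q σ F C ≠ ∅) (hx : y / 2 ≤ x) :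
      Next q σ V F C P x y F (newPetals F C (pick q σ F C) ++ P) (x - y / 2) (y / 2)

/-- The clause `C` may come from the stack or from the original clauses. `P₀` and `O₀` stand for the
lists before it was taken, and the fuel is compared with theirs; this serves both sources at once.
-/
lemma Popped.next (h : Popped k q σ V F C P O) (hp : Par k q σ V) (hk : 1 ≤ k)
    {F' P' : List (Finset ℕ)} {x' y' : ℕ} (hn : Next q σ V F C P x y F' P' x' y')
    {P₀ O₀ : List (Finset ℕ)} (hx₀ : pot k q F P₀ ≤ pot k q F (C :: P)) (hl : F.length ≤ pot k q F P₀)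
    (hlen : P₀.length + O₀.length = P.length + O.length + 1) (n : ℕ) :
    Inv k q σ V F' P' O ∧ F'.length ≤ pot k q F' P' ∧ x' ≤ x ∧
      fuel k q V F' P' O + 1 ≤ fuel k q V F P₀ O₀ ∧
      Tree.walk (if ∃ E ∈ F, E ⊆ C then tree q σ (Finset.range V) n F P O
      else if pick q σ F C = ∅ then
        tree q σ (Finset.range V) n (Sparsify.accept (Finset.range V) F C) P O
      else .node (tree q σ (Finset.range V) n F (pick q σ F C :: P) O)
        (tree q σ (Finset.range V) n F (newPetals F C (pick q σ F C) ++ P) O)) x y =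
      (tree q σ (Finset.range V) n F' P' O).walk x' y' := by
  have hx' := hx₀.trans pot_cons_le
  cases hn with
  | reject hs =>
    have h1 := (hx₀.trans (pot_cons_of_subsumed hs).le)
    exact ⟨h.inv, hl.trans h1, le_rfl, fuel_lt_of_reject h1 hlen, by rw [if_pos hs]⟩
  | accept hs hpick =>
    have h1 := h.pot_accept hp hs
    have hi := h.inv_accept hp hs (pick_eq_empty.1 hpick)
    exact ⟨hi, by rw [length_accept]; omega, le_rfl,
      fuel_lt (by omega) (hi.pot_le hp hk) hlen (by omega), by rw [if_neg hs, if_pos hpick]⟩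
  | heart hs hpick hx =>
    have hH := pick_flower hpick
    have h1 := h.pot_heart hp hs hH
    have hi := h.inv_heart hH
    refine ⟨hi, by omega, le_rfl,
      fuel_lt (by omega) (hi.pot_le hp hk) hlen (by simp; omega), ?_⟩
    rw [if_neg hs, if_neg hpick, Tree.walk, if_neg (by omega)]
  | petals hs hpick hx =>
    have hH := pick_flower hpick
    have h1 := h.pot_petals hp hs hH
    have hi := h.inv_petals hp hs hH
    have h2 := h.inv_heart hH
    have hpos : 0 < 2 ^ (q * k - σ - 1) := by positivity
    have hm := hi.pot_le hp hk
    have hd := deg_le_length (F := F) C.card (pick q σ F C)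
    refine ⟨hi, by omega, Nat.sub_le _ _,
      fuel_lt (by omega) hm hlen (by rw [List.length_append, length_newPetals]; omega), ?_⟩
    rw [if_neg hs, if_neg hpick, Tree.walk, if_pos hx]

end Sparsify

/-! ### Correctness of the walk to a leaf -/

namespace Reduction

open WordRAM Sparsify Filter

/-- The position of the current leaf. -/
structure Pos (s : Store Reg) (x y : ℕ) : Prop where
  xr : s.reg .xr = x
  y : s.reg .y = y

lemma Pos.keeps {s t : Store Reg} {x y : ℕ} (h : Pos s x y) {c : Cmd Reg} (hk : c.Keeps s t)
    (h1 : ¬ c.Writes .xr) (h2 : ¬ c.Writes .y) : Pos t x y :=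
  ⟨(hk.reg _ h1).trans h.xr, (hk.reg _ h2).trans h.y⟩

lemma process_spec (Γ : Cfg) {s : Store Reg} {F P : List (Finset ℕ)} (hF : Kept Γ s F)
    (hlen : F.length + 2 ≤ Γ.Y) (hP : Pend Γ s P) (hroom : P.length + Γ.Y ≤ Γ.S) {C : Finset ℕ}
    (hC : s.reg .C = enc C) (hCl : IsClause Γ.k (4 * Γ.h) C)
    (hU : s.reg .U = enc (Finset.range (4 * Γ.h))) {x y : ℕ} (hpos : Pos s x y)
    (hx : x + 1 < 2 ^ Γ.w) :
    (process Γ.q Γ.σ).Ho Γ.w s (900 * Γ.Y ^ 3) (fun t => (∃ F' P' x' y',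
      Next Γ.q Γ.σ (4 * Γ.h) F C P x y F' P' x' y' ∧ Kept Γ t F' ∧ Pend Γ t P' ∧ Pos t x' y' ∧
      Outside Γ s t) ∧ (process Γ.q Γ.σ).Keeps s t) := by
  have hY := Γ.lits
  have hS := Γ.small
  have hw := Γ.word
  have hw0 := Γ.w_ne_zero
  obtain ⟨hY2, hY3, hY1⟩ := Γ.pow_bounds
  apply Cmd.Ho.keeps
  unfold process
  refine .seq (checkReject_spec Γ hF hC) (by omega) ?_
  rintro t ⟨hrej, hk⟩
  have hp : checkReject.Pure := by simp [checkReject, Cmd.Pure]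
  have hF₁ := hF.keeps hk hp (by simp [checkReject, Cmd.Writes]) (by simp [checkReject, Cmd.Writes])
  have hP₁ := hP.keeps hk hp (by simp [checkReject, Cmd.Writes]) (by simp [checkReject, Cmd.Writes])
  have hpos₁ := hpos.keeps hk (by simp [checkReject, Cmd.Writes]) (by simp [checkReject, Cmd.Writes])
  have hC₁ : t.reg .C = enc C := by rw [hk.reg _ (by simp [checkReject, Cmd.Writes]), hC]
  have hU₁ : t.reg .U = enc (Finset.range (4 * Γ.h)) := by
    rw [hk.reg _ (by simp [checkReject, Cmd.Writes]), hU]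
  have hm₁ := hk.mem hp
  refine .ite (by simp) (by simp; omega) (fun hne => .skip ?_) (fun h0 => ?_)
  · simp only [Expr.val_var, hrej] at hne
    exact ⟨F, P, x, y, .reject hne, hF₁, hP₁, hpos₁, fun a _ => by rw [hm₁]⟩
  simp only [Expr.val_var] at h0
  have hs : ¬ ∃ E ∈ F, E ⊆ C := fun h => hrej.2 h h0
  refine .seq (findFlower_spec Γ hF₁ hC₁ hCl) (by simp; omega) ?_
  rintro u ⟨⟨hHf, hc⟩, hk'⟩
  have hp' : (findFlower Γ.q Γ.σ).Pure := by simp [findFlower, countFlower, popc, Cmd.Pure]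
  have hF₂ := hF₁.keeps hk' hp' (by simp [findFlower, countFlower, popc, Cmd.Writes])
    (by simp [findFlower, countFlower, popc, Cmd.Writes])
  have hP₂ := hP₁.keeps hk' hp' (by simp [findFlower, countFlower, popc, Cmd.Writes])
    (by simp [findFlower, countFlower, popc, Cmd.Writes])
  have hpos₂ := hpos₁.keeps hk' (by simp [findFlower, countFlower, popc, Cmd.Writes])
    (by simp [findFlower, countFlower, popc, Cmd.Writes])
  have hC₂ : u.reg .C = enc C := by
    rw [hk'.reg _ (by simp [findFlower, countFlower, popc, Cmd.Writes]), hC₁]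
  have hU₂ : u.reg .U = enc (Finset.range (4 * Γ.h)) := by
    rw [hk'.reg _ (by simp [findFlower, countFlower, popc, Cmd.Writes]), hU₁]
  have hm₂ : u.mem = s.mem := by rw [hk'.mem hp', hm₁]
  refine .ite (by simp) (by simp; omega) (fun hne => ?_) (fun h0 => ?_)
  · simp only [Expr.val_var, hHf, Ne, enc_eq_zero] at hne
    unfold branch
    have h2w : 2 < 2 ^ Γ.w := by omega
    refine .set_seq (by simpa using h2w) (by simp; omega) (.ite ?_ (by simp; omega)
      (fun h1 => ?_) (fun h1 => ?_))
    · simp [Function.update_apply, hpos₂.xr, hw0]; omega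
    · simp [Function.update_apply, hpos₂.xr, hpos₂.y] at h1
      refine .set_seq (by simp) (by simp; omega) ?_
      refine (pushPetals_spec Γ (F := F) (P := P)
        ⟨?_, ?_, ?_, hF₂.sub, hF₂.len⟩ ⟨?_, ?_, ?_⟩ hroom (C := C) (H := pick Γ.q Γ.σ F C)
        ?_ ?_ ?_ (pick_flower hne).1).conseq
        (by simp; omega) ?_
      · simpa using hF₂.bF
      · simpa using hF₂.f
      · exact hF₂.arr
      · simpa using hP₂.bP
      · simpa using hP₂.p
      · exact hP₂.arr
      · simpa using hC₂
      · simpa using hHf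
      · simpa using hc
      · rintro t' ⟨⟨hF', hP', ho⟩, hk⟩
        refine ⟨_, _, _, _, .petals hs hne (by omega), hF', hP', ⟨?_, ?_⟩, fun a ha => ?_⟩
        · rw [hk.reg _ (by simp [pushPetals, popc, Cmd.Writes])]
          simp [hpos₂.xr, hpos₂.y]
        · rw [hk.reg _ (by simp [pushPetals, popc, Cmd.Writes])]
          simp [hpos₂.xr, hpos₂.y]
        · rw [ho a ha, ← hm₂]
    · simp [Function.update_apply, hpos₂.xr, hpos₂.y] at h1
      refine .put_seq ?_ (by simp) (by simp; omega) (.set ?_ (by simp; omega) ?_)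
      · simp [hP₂.bP, hP₂.p]; omega
      · simp [hP₂.p, hw0]; omega
      · refine ⟨_, _, _, _, .heart hs hne (by omega), ⟨?_, ?_, ?_, hF.sub, hF.len⟩, ⟨?_, ?_, ?_⟩,
          ⟨?_, ?_⟩, fun a ha => ?_⟩
        · simpa using hF₂.bF
        · simpa using hF₂.f
        · refine hF₂.arr.congr fun j hj => ?_
          simp [hP₂.bP, hP₂.p]
          rw [Function.update_of_ne (by omega)]
        · simpa using hP₂.bP
        · simpa using hP₂.p
        · have := hP₂.arr.concat (pick Γ.q Γ.σ F C)
          simpa [hP₂.bP, hP₂.p, hHf] using this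
        · simpa using hpos₂.xr
        · simp [hpos₂.y]
        · simp [hP₂.bP, hP₂.p]
          rw [Function.update_of_ne (by omega), hm₂]
  · simp only [Expr.val_var, hHf, enc_eq_zero] at h0
    refine (acceptClause_spec Γ hF₂ hlen hC₂ hCl.2.1 hU₂).conseq (by simp; omega) ?_
    rintro t' ⟨⟨hF', ho⟩, hk⟩
    refine ⟨_, _, _, _, .accept hs h0, hF', ⟨?_, ?_, ?_⟩, ?_, fun a ha => ?_⟩
    · rw [hk.reg _ (by simp [acceptClause, Cmd.Writes]), hP₂.bP]
    · rw [hk.reg _ (by simp [acceptClause, Cmd.Writes]), hP₂.p]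
    · exact hP₂.arr.congr fun j hj => ho _ (by omega)
    · exact hpos₂.keeps hk (by simp [acceptClause, Cmd.Writes]) (by simp [acceptClause, Cmd.Writes])
    · rw [ho a (by omega), hm₂]

/-- The literal denoted by an input word. -/
def litOf (h ℓ : ℕ) : ℕ := ℓ / 2 + ℓ % 2 * (2 * h)

/-- The original clauses `O` are stored from the address `a` on. -/
def Orig (k h : ℕ) (m : ℕ → ℕ) : ℕ → List (Finset ℕ) → Prop
  | _, [] => True
  | a, C :: O => C = (Finset.range k).image (fun j => litOf h (m (a + j))) ∧ Orig k h m (a + k) O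

lemma Orig.congr {k h b : ℕ} {m m' : ℕ → ℕ} (hm : ∀ a < b, m' a = m a) :
    ∀ {O : List (Finset ℕ)} {a : ℕ}, a + k * O.length ≤ b → Orig k h m a O → Orig k h m' a O
  | [], _, _, _ => trivial
  | C :: O, a, hb, ho => by
    rw [List.length_cons, mul_add, mul_one] at hb
    refine ⟨ho.1.trans (Finset.image_congr fun j hj => ?_), Orig.congr hm (by omega) ho.2⟩
    have : j < k := by simpa using hj
    rw [hm _ (by omega)]

/-- The original clauses that are still to be read. -/
structure Rest (Γ : Cfg) (s : Store Reg) (a : ℕ) (O : List (Finset ℕ)) : Prop where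
  po : s.reg .po = a
  mo : s.reg .mo = O.length
  orig : Orig Γ.k Γ.h s.mem a O
  room : a + Γ.k * O.length ≤ Γ.S

lemma readClause_spec (Γ : Cfg) {s : Store Reg} {a : ℕ} {C : Finset ℕ} {O : List (Finset ℕ)}
    (hr : Rest Γ s a (C :: O)) (hC : C ⊆ Finset.range (4 * Γ.h)) (hh : s.reg .h = Γ.h) :
    (readClause Γ.k).Ho Γ.w s (60 * Γ.Y) (fun t => (t.reg .C = enc C ∧ Rest Γ t (a + Γ.k) O) ∧
      (readClause Γ.k).Keeps s t) := by
  have hY := Γ.lits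
  have hS := Γ.small
  have hw := Γ.word
  have hw0 := Γ.w_ne_zero
  have hkY : Γ.k < Γ.Y := Nat.lt_two_pow_self.trans_le Γ.subs
  have hroom := hr.room
  rw [List.length_cons, mul_add, mul_one] at hroom
  have hlit : ∀ j < Γ.k, litOf Γ.h (s.mem (a + j)) < 4 * Γ.h := by
    intro j hj
    have := hC (hr.orig.1 ▸ Finset.mem_image_of_mem (fun j => litOf Γ.h (s.mem (a + j)))
      (Finset.mem_range.2 hj))
    simpa using this
  apply Cmd.Ho.keeps
  unfold readClause
  refine .set_seq (by simp) (by simp; omega) (.set_seq (by simp) (by simp; omega) ?_)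
  refine .seq (T' := (Γ.k + 1) * 46) (R := fun t => (t.reg .C = enc C ∧ t.reg .po = a + Γ.k) ∧
      (t.reg .mo = O.length + 1 ∧ t.mem = s.mem)) ?_ (by simp; omega) ?_
  · refine .count_keeps (fun i t => t.reg .j = i ∧ t.reg .po = a + i ∧
      t.reg .C = enc ((Finset.range i).image (fun j => litOf Γ.h (s.mem (a + j))))) Γ.k 40
      ?_ ?_ ?_ ?_ ?_
    · simp [Function.update_apply, hr.po]
    · rintro i t hi ⟨hj, -⟩ hk
      simp [hj]
      omega
    · rintro i t hi ⟨hj, hpo, hCt⟩ hk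
      have e1 := hk.reg .h (by simp [Cmd.Writes])
      have e2 := hk.mem (by simp [Cmd.Pure])
      simp [Function.update_apply, hh] at e1 e2
      have hl := hlit i hi
      have hl2 : 2 ^ litOf Γ.h (s.mem (a + i)) ≤ 2 ^ (4 * Γ.h) :=
        Nat.pow_le_pow_right (by norm_num) hl.le
      have hm := Γ.mask
      have h2 : s.mem (a + i) % 2 * (2 * Γ.h) ≤ 1 * (2 * Γ.h) :=
        Nat.mul_le_mul_right _ (by omega)
      have hle := hl
      unfold litOf at hle
      refine .set_seq (by simp) (by simp) (.set_seq ?_ (by simp) (.set_seq ?_ (by simp)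
        (.set ?_ (by simp) ?_)))
      · simp [hpo, e1, e2, hw0]
        unfold litOf at hl2
        omega
      · simp [hpo, hw0]; omega
      · simp [hj, hw0]; omega
      · refine ⟨by simp [hj], by simp [hpo]; omega, ?_⟩
        rw [Finset.range_add_one, Finset.image_insert, Finset.insert_eq, Finset.union_comm,
          ← enc_or, enc_singleton]
        simp [hpo, hCt, e1, e2, litOf]
    · rintro t ⟨hj, hpo, hCt⟩ hk
      refine ⟨⟨hCt.trans (by rw [← hr.orig.1]), hpo⟩, ?_, ?_⟩
      · rw [hk.reg _ (by simp [Cmd.Writes])]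
        simp [hr.mo]
      · rw [hk.mem (by simp [Cmd.Pure])]
    · simp
  · rintro t ⟨⟨hCt, hpo⟩, hmo, hm⟩
    refine .set (by simp [hw0]) (by simp; omega) ⟨by simpa using hCt, by simpa using hpo,
      by simp [hmo], by simpa [hm] using hr.orig.2, by omega⟩


/-- The state of the sparsification. -/
structure Sparse (Γ : Cfg) (s₀ s : Store Reg) (x₀ : ℕ) (F P O : List (Finset ℕ)) (x y : ℕ) :
    Prop where
  kept : Kept Γ s F
  pend : Pend Γ s P
  rest : ∃ a, Rest Γ s a O
  pos : Pos s x y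
  inv : Inv Γ.k Γ.q Γ.σ (4 * Γ.h) F P O
  len : F.length ≤ Sparsify.pot Γ.k Γ.q F P
  le : x ≤ x₀
  out : Outside Γ s₀ s

lemma round_spec (Γ : Cfg) {s₀ s : Store Reg} {F P O : List (Finset ℕ)} {x₀ x y : ℕ}
    (hs : Sparse Γ s₀ s x₀ F P O x y) (hPO : P.length + O.length ≠ 0)
    (hroom : P.length + Γ.Y ≤ Γ.S) (hx₀ : x₀ + 1 < 2 ^ Γ.w) (hh : s.reg .h = Γ.h)
    (hU : s.reg .U = enc (Finset.range (4 * Γ.h))) (n : ℕ) :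
    (popClause Γ.k;; process Γ.q Γ.σ).Ho Γ.w s (1000 * Γ.Y ^ 3) (fun t => ∃ F' P' O' x' y',
      Sparse Γ s₀ t x₀ F' P' O' x' y' ∧
      fuel Γ.k Γ.q (4 * Γ.h) F' P' O' + 1 ≤ fuel Γ.k Γ.q (4 * Γ.h) F P O ∧
      (tree Γ.q Γ.σ (Finset.range (4 * Γ.h)) (n + 1) F P O).walk x y =
        (tree Γ.q Γ.σ (Finset.range (4 * Γ.h)) n F' P' O').walk x' y') := by
  have hY := Γ.lits
  have hS := Γ.small
  have hw := Γ.word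
  have hw0 := Γ.w_ne_zero
  obtain ⟨hY2, hY3, hY1⟩ := Γ.pow_bounds
  have hl := hs.len.trans (hs.inv.pot_le Γ.par Γ.k_pos)
  have hpot := Γ.pot
  obtain ⟨a, hrest⟩ := hs.rest
  have hP := hs.pend
  -- The intermediate assertion forgets where `C` came from and keeps only the common form of the
  -- equation of `tree`.
  refine .seq (T' := 80 * Γ.Y) (R := fun t => ∃ C P' O' a', t.reg .C = enc C ∧ Kept Γ t F ∧
      Pend Γ t P' ∧ Rest Γ t a' O' ∧ Pos t x y ∧ t.mem = s.mem ∧ P'.length ≤ P.length ∧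
      t.reg .U = enc (Finset.range (4 * Γ.h)) ∧ Popped Γ.k Γ.q Γ.σ (4 * Γ.h) F C P' O' ∧
      P.length + O.length = P'.length + O'.length + 1 ∧
      Sparsify.pot Γ.k Γ.q F P ≤ Sparsify.pot Γ.k Γ.q F (C :: P') ∧
      tree Γ.q Γ.σ (Finset.range (4 * Γ.h)) (n + 1) F P O =
      (if ∃ E ∈ F, E ⊆ C then tree Γ.q Γ.σ (Finset.range (4 * Γ.h)) n F P' O'
      else if pick Γ.q Γ.σ F C = ∅ then
        tree Γ.q Γ.σ (Finset.range (4 * Γ.h)) n (accept (Finset.range (4 * Γ.h)) F C) P' O'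
      else .node (tree Γ.q Γ.σ (Finset.range (4 * Γ.h)) n F (pick Γ.q Γ.σ F C :: P') O')
        (tree Γ.q Γ.σ (Finset.range (4 * Γ.h)) n F (newPetals F C (pick Γ.q Γ.σ F C) ++ P') O')))
      ?_ (by omega) ?_
  · unfold popClause
    refine .ite (by simp) (by simp; omega) (fun hne => ?_) (fun h0 => ?_)
    · simp only [Expr.val_var, hP.p] at hne
      rcases P with _ | ⟨C, P⟩
      · simp at hne
      have harr := hP.arr
      rw [List.reverse_cons] at harr
      have hCm : s.mem (2 * Γ.S + P.length) = enc C := by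
        have := harr P.length (by simp)
        rw [this]
        congr 1
        rw [List.getElem_append_right (by simp)]
        simp
      have hp := hP.p
      rw [List.length_cons] at hp hroom
      refine .set_seq (by simp [hw0]) (by simp; omega) (.set ?_ (by simp; omega) ?_)
      · simp [hP.bP, hp]; omega
      · refine ⟨C, P, O, a, ?_, ⟨?_, ?_, hs.kept.arr, hs.kept.sub, hs.kept.len⟩, ⟨?_, ?_, ?_⟩,
          ⟨?_, ?_, hrest.orig, hrest.room⟩, ⟨?_, ?_⟩, rfl, by simp, ?_,
          hs.inv.pop_pending, by simp; omega, le_rfl, rfl⟩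
        · simp [hP.bP, hp, hCm]
        · simpa using hs.kept.bF
        · simpa using hs.kept.f
        · simpa using hP.bP
        · simp [hp]
        · intro j hj
          have := harr j (by simp at hj ⊢; omega)
          rw [List.getElem_append_left hj] at this
          exact this
        · simpa using hrest.po
        · simpa using hrest.mo
        · simpa using hs.pos.xr
        · simpa using hs.pos.y
        · simpa using hU
    · simp only [Expr.val_var, hP.p, List.length_eq_zero_iff] at h0
      subst h0
      rcases O with _ | ⟨C, O⟩
      · simp at hPO
      refine (readClause_spec Γ hrest hs.inv.pop_original.isC.2.1 hh).conseq
        (by simp; omega) ?_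
      rintro t ⟨⟨hC, hr⟩, hk⟩
      have hm := hk.mem (by simp [readClause, Cmd.Pure])
      have hp' := hs.inv.pop_original
      refine ⟨C, [], O, _, hC, hs.kept.keeps hk ?_ ?_ ?_, hP.keeps hk ?_ ?_ ?_, hr,
        hs.pos.keeps hk ?_ ?_, hm, le_rfl, ?_, hp', by simp, pot_nil_le, ?_⟩
      · simp [readClause, Cmd.Pure]
      · simp [readClause, Cmd.Writes]
      · simp [readClause, Cmd.Writes]
      · simp [readClause, Cmd.Pure]
      · simp [readClause, Cmd.Writes]
      · simp [readClause, Cmd.Writes]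
      · simp [readClause, Cmd.Writes]
      · simp [readClause, Cmd.Writes]
      · rw [hk.reg _ (by simp [readClause, Cmd.Writes]), hU]
      · simp [tree]
  · rintro t ⟨C, P', O', a', hC, hF, hP', hr, hpos, hm, hPl, hUt, hpop, hlen, hpot', htree⟩
    have hle := hs.le
    refine (process_spec Γ hF (by omega) hP' (by omega) hC hpop.isC hUt hpos (by omega)).conseq
      (by omega) ?_
    rintro u ⟨⟨F'', P'', x', y', hn, hF'', hP'', hpos'', hout⟩, hk⟩
    obtain ⟨i1, i2, i3, i4, i5⟩ := hpop.next Γ.par Γ.k_pos hn hpot' hs.len hlen n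
    refine ⟨F'', P'', O', x', y', ⟨hF'', hP'', ⟨a', ?_, ?_, ?_, hr.room⟩, hpos'', i1, i2,
      i3.trans hs.le, fun b hb => ?_⟩, i4, ?_⟩
    · rw [hk.reg _ (by simp [process, checkReject, findFlower, countFlower, popc, branch, pushPetals,
        acceptClause, Cmd.Writes]), hr.po]
    · rw [hk.reg _ (by simp [process, checkReject, findFlower, countFlower, popc, branch, pushPetals,
        acceptClause, Cmd.Writes]), hr.mo]
    · exact hr.orig.congr (fun b hb => hout b (.inl hb)) hr.room
    · rw [hout b hb, hm, hs.out b hb]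
    · rw [htree, i5]

/-- The fixed values of the registers. -/
structure Fixed (Γ : Cfg) (s : Store Reg) : Prop where
  h : s.reg .h = Γ.h
  S : s.reg .S = Γ.S
  bF : s.reg .bF = Γ.S
  bP : s.reg .bP = 2 * Γ.S
  U : s.reg .U = enc (Finset.range (4 * Γ.h))

/-- The invariant of the loop is that the walk from `(x', y')` in the remaining tree, with the
remaining fuel `j`, has the same result as the whole walk from the root. -/
lemma sparsify_spec (Γ : Cfg) {s : Store Reg} (hs : Fixed Γ s) {O : List (Finset ℕ)}
    (hm : s.reg .m = O.length) (hO : Orig Γ.k Γ.h s.mem 2 O)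
    (hcl : ∀ D ∈ O, IsClause Γ.k (4 * Γ.h) D) (hOr : 2 + Γ.k * O.length ≤ Γ.S)
    {J : ℕ} (hJ : fuel Γ.k Γ.q (4 * Γ.h) [] [] O ≤ J) (hJS : J + Γ.Y ≤ Γ.S) {x y : ℕ}
    (hx : s.reg .x = x) (hy : s.reg .lim = y) (hxw : x + 1 < 2 ^ Γ.w) :
    (sparsify Γ.k Γ.q Γ.σ).Ho Γ.w s ((J + 2) * (1100 * Γ.Y ^ 3)) (fun t => (∃ F y',
      Kept Γ t F ∧ t.reg .y = y' ∧ Outside Γ s t ∧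
      (tree Γ.q Γ.σ (Finset.range (4 * Γ.h)) J [] [] O).walk x y = (F, y')) ∧
      (sparsify Γ.k Γ.q Γ.σ).Keeps s t) := by
  have hY := Γ.lits
  have hS := Γ.small
  have hw := Γ.word
  have hw0 := Γ.w_ne_zero
  have h2w : 2 < 2 ^ Γ.w := by omega
  obtain ⟨hY2, hY3, hY1⟩ := Γ.pow_bounds
  have hbig : (J + 2) * (1100 * Γ.Y ^ 3) = (J + 1) * (1100 * Γ.Y ^ 3) + 1100 * Γ.Y ^ 3 := by ring
  have hbig' : (J + 1) * (1000 * Γ.Y ^ 3 + 3 + 3) ≤ (J + 1) * (1100 * Γ.Y ^ 3) :=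
    Nat.mul_le_mul_left _ (by omega)
  apply Cmd.Ho.keeps
  unfold sparsify
  refine .set_seq (by simp) (by simp; omega) (.set_seq (by simp) (by simp; omega)
    (.set_seq (by simp) (by simp; omega) (.set_seq (by simpa using h2w) (by simp; omega)
    (.set_seq (by simp) (by simp; omega) (.set_seq (by simp) (by simp; omega) ?_)))))
  refine .loop_keeps (fun j t => ∃ F P O' x' y', Sparse Γ s t x F P O' x' y' ∧
    fuel Γ.k Γ.q (4 * Γ.h) F P O' ≤ j ∧
      (tree Γ.q Γ.σ (Finset.range (4 * Γ.h)) J [] [] O).walk x y =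
        (tree Γ.q Γ.σ (Finset.range (4 * Γ.h)) j F P O').walk x' y') (n := J)
      (T' := 1000 * Γ.Y ^ 3) ?_ ?_ ?_ ?_ ?_
  · refine ⟨[], [], O, x, y, ⟨⟨?_, ?_, ?_, by simp, ?_⟩, ⟨?_, ?_, ?_⟩, ⟨2, ?_, ?_, hO, hOr⟩, ⟨?_, ?_⟩,
      inv_init hcl, by simp, le_rfl, fun a _ => rfl⟩, hJ, rfl⟩
    · simpa using hs.bF
    · simp [Function.update_apply]
    · intro j hj; simp at hj
    · simp; omega
    · simpa using hs.bP
    · simp [Function.update_apply]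
    · intro j hj; simp at hj
    · simp
    · simp [hm]
    · simp [hx]
    · simp [hy]
  · rintro j t hj ⟨F, P, O', x', y', ht, hf, -⟩ hk
    obtain ⟨a, hr⟩ := ht.rest
    have hfl : P.length + O'.length ≤ fuel Γ.k Γ.q (4 * Γ.h) F P O' := by
      unfold fuel; omega
    simp [ht.pend.p, hr.mo]
    omega
  · rintro j t hj ⟨F, P, O', x', y', ht, hf, hwalk⟩ hk hv
    obtain ⟨a, hr⟩ := ht.rest
    have hfl : P.length + O'.length ≤ fuel Γ.k Γ.q (4 * Γ.h) F P O' := by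
      unfold fuel; omega
    simp only [Expr.val_add, Expr.val_var, ht.pend.p, hr.mo] at hv
    obtain ⟨j, rfl⟩ : ∃ j', j = j' + 1 := ⟨j - 1, by omega⟩
    have e1 : t.reg .h = Γ.h := by
      rw [hk.reg _ (by simp [popClause, readClause, process, checkReject, findFlower, countFlower,
        popc, branch, pushPetals, acceptClause, Cmd.Writes])]
      simpa using hs.h
    have e2 : t.reg .U = enc (Finset.range (4 * Γ.h)) := by
      rw [hk.reg _ (by simp [popClause, readClause, process, checkReject, findFlower, countFlower,
        popc, branch, pushPetals, acceptClause, Cmd.Writes])]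
      simpa using hs.U
    refine (round_spec Γ ht hv (by omega) hxw e1 e2 j).conseq le_rfl ?_
    rintro u ⟨F', P', O'', x'', y'', hu, hf', hwalk'⟩
    exact ⟨j, by omega, F', P', O'', x'', y'', hu, by omega, hwalk.trans hwalk'⟩
  · rintro j t hj ⟨F, P, O', x', y', ht, hf, hwalk⟩ hk hv
    obtain ⟨a, hr⟩ := ht.rest
    simp only [Expr.val_add, Expr.val_var, ht.pend.p, hr.mo, Nat.add_eq_zero_iff,
      List.length_eq_zero_iff] at hv
    obtain ⟨rfl, rfl⟩ := hv
    refine ⟨F, y', ht.kept, ht.pos.y, ht.out, hwalk.trans ?_⟩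
    -- Without pending and original clauses the tree is a leaf, for any amount of fuel.
    rcases j with _ | j <;> rfl
  · simp
    omega

end Reduction

/-! ### Memory that a simulated program cannot reach -/

namespace WordRAM

lemma Instr.exec_mem_eq {s : State} {B : ℕ} (hs : ∀ r, s.reg r < B) (i : Instr) {a : ℕ} (ha : B ≤ a) :
    (i.exec s).mem a = s.mem a := by
  cases i with
  | store r x => exact Function.update_of_ne (by have := hs r; omega) _ _
  | _ => rfl

/-- A program can only change the memory cells whose addresses occur in its registers. -/
lemma iterate_step_mem_eq (p : Program) {s : State} {B t : ℕ}
    (hs : ∀ j ≤ t, ∀ r, ((step p)^[j] s).reg r < B) {a : ℕ} (ha : B ≤ a) :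
    ((step p)^[t] s).mem a = s.mem a := by
  induction t with
  | zero => rfl
  | succ t ih =>
    rw [Function.iterate_succ_apply', ← ih fun j hj => hs j (by omega)]
    unfold step
    split
    · rfl
    · exact Instr.exec_mem_eq (hs t (by omega)) _ ha

variable {V : Type} [DecidableEq V]

/-- The simulated program sees the memory from `b` on as its own. With words below `2 ^ w₀` it can
address no cell outside of the `2 ^ w₀` cells from there on, so what lies below is kept and what
lies above is still zero for later use. -/
lemma Cmd.Ho.sim {w w₀ τ T' out : ℕ} {T : ℝ} {p : Program} {b r : V} {s : Store V}
    {Q : Store V → Prop} {x : List ℕ} (hx : ∀ a, s.mem (s.reg b + a) = x.getD a 0)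
    (ho : Outputs p x T w₀ out) (hT : T ≤ τ) (hw : 2 ^ w₀ + s.reg b ≤ 2 ^ w)
    (hτ : 2 * τ + p.regs + 2 ≤ T')
    (hQ : ∀ m', (∀ a < s.reg b, m' a = s.mem a) → (∀ a, s.reg b + 2 ^ w₀ ≤ a → m' a = s.mem a) →
      Q ⟨Function.update s.reg r out, m'⟩) : Ho w (.sim p b r) s T' Q := by
  obtain ⟨t, ht, hpc, hout, hb⟩ := ho
  have hinit : s.shifted (s.reg b) = init x := by
    simp only [Store.shifted, init, hx]
  have ht' : t ≤ τ := by exact_mod_cast ht.trans hT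
  refine ⟨_, ?_, _, .sim (t := t) (fun j hj a => ?_) ?_, ?_⟩
  · omega
  · rw [hinit]
    have := (hb j hj a).1
    unfold run at this
    omega
  · rw [hinit]; exact hpc
  · rw [hinit]
    unfold run at hout
    rw [hout]
    refine hQ _ (fun a ha => if_pos ha) fun a ha => ?_
    have h1 : ¬ a < s.reg b := not_lt.2 ((Nat.le_add_right _ _).trans ha)
    simp only [h1, if_false]
    rw [iterate_step_mem_eq p (fun j hj r => (hb j hj r).1)
      (show 2 ^ w₀ ≤ a - s.reg b by omega)]
    simp only [init]
    rw [← hx]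
    congr 1
    omega

end WordRAM

/-! ### Writing the matrices -/

namespace Reduction

open WordRAM Sparsify Filter

/-- The list `l`, followed by zeros, is stored from the address `b` on. -/
def Filled (m : ℕ → ℕ) (b : ℕ) (l : List ℕ) : Prop := ∀ a, m (b + a) = l.getD a 0

lemma Filled.append {m m' : ℕ → ℕ} {b : ℕ} {l : List ℕ} (h : Filled m b l) (l' : List ℕ)
    (h₁ : ∀ a < b + l.length, m' a = m a) (h₂ : ∀ a, m' (b + l.length + a) = l'.getD a 0) :
    Filled m' b (l ++ l') := by
  intro a
  by_cases ha : a < l.length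
  · rw [h₁ _ (by omega), h, List.getD_append _ _ _ _ ha]
  · obtain ⟨c, rfl⟩ : ∃ c, a = l.length + c := ⟨a - l.length, by omega⟩
    rw [← add_assoc, h₂, List.getD_append_right _ _ _ _ (by omega), Nat.add_sub_cancel_left]

/-- The rows `0, …, r - 1` of a matrix with `d` columns. -/
def rowList (d : ℕ) (M : ℕ → ℕ → Bool) (r : ℕ) : List ℕ :=
  ((List.range r).map fun i => (List.range d).map fun c => (M i c).toNat).flatten

lemma rowList_succ (d : ℕ) (M : ℕ → ℕ → Bool) (r : ℕ) :
    rowList d M (r + 1) = rowList d M r ++ (List.range d).map fun c => (M r c).toNat := by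
  simp [rowList, List.range_succ]

lemma length_rowList (d : ℕ) (M : ℕ → ℕ → Bool) (r : ℕ) : (rowList d M r).length = r * d := by
  induction r with
  | zero => simp [rowList]
  | succ r ih => rw [rowList_succ, List.length_append, ih]; simp; ring

lemma encodeRows_eq {N d : ℕ} (M : ℕ → ℕ → Bool) :
    encodeRows (fun (i : Fin N) (c : Fin d) => M i c) = rowList d M N := by
  unfold encodeRows rowList
  simp only [List.ofFn_eq_map]
  congr 1
  rw [← List.map_coe_finRange_eq_range (n := N), List.map_map]
  refine List.map_congr_left fun i _ => ?_
  rw [Function.comp_apply, ← List.map_coe_finRange_eq_range (n := d), List.map_map]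
  rfl

/-- This serves both matrices; `R M c` is the entry in column `c` of the row with mask `M`. Only the
first `2 * G.length` columns are visited, the others being zero already. Hence the time does not
depend on the dimension `d`, which may be large. -/
lemma rows_spec (Γ : Cfg) {s : Store Reg} {G : List (Finset ℕ)} (hG : Kept Γ s G)
    (R : ℕ → ℕ → Bool) (mask : ℕ → ℕ) {e : Expr Reg} {body : Cmd Reg} {N d β : ℕ} {l : List ℕ}
    (hreg : ∀ x, ¬ body.Writes x) (hcost : e.cost ≤ 20) (hNS : N ≤ Γ.S)
    (hN : s.reg .N = N) (hd : s.reg .dim = d) (hl : Filled s.mem β l)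
    (haddr : s.reg .addr = β + l.length) (hβ : 3 * Γ.S ≤ β) (hroom : β + l.length + N * d < 2 ^ Γ.w)
    (hfd : 2 * G.length ≤ d) (hR : ∀ M c, 2 * G.length ≤ c → R M c = false)
    (he : ∀ t, t.reg .h = s.reg .h → t.reg .N = N → t.reg .row < N →
      e.Fits Γ.w t ∧ e.val t = mask (t.reg .row))
    (hbody : ∀ t i M, i < G.length → Kept Γ t G → t.reg .j = i → t.reg .M = M →
      3 * Γ.S ≤ t.reg .addr → t.reg .addr + 2 * i + 1 < 2 ^ Γ.w → t.mem (t.reg .addr + 2 * i) = 0 →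
      t.mem (t.reg .addr + 2 * i + 1) = 0 → body.Ho Γ.w t 40 (fun u => u.mem =
        Function.update (Function.update t.mem (t.reg .addr + 2 * i) (R M (2 * i)).toNat)
          (t.reg .addr + 2 * i + 1) (R M (2 * i + 1)).toNat)) :
    (rows e body).Ho Γ.w s ((N + 2) * (200 * Γ.Y)) (fun t =>
      (Filled t.mem β (l ++ rowList d (fun i => R (mask i)) N) ∧
        t.reg .addr = β + (l ++ rowList d (fun i => R (mask i)) N).length ∧
        ∀ a < β, t.mem a = s.mem a) ∧ (rows e body).Keeps s t) := by
  have hY := Γ.lits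
  have hS := Γ.small
  have hw := Γ.word
  have hw0 := Γ.w_ne_zero
  have hlen := hG.len
  apply Cmd.Ho.keeps
  have hT : (N + 2) * (200 * Γ.Y) = (N + 1) * (200 * Γ.Y) + 200 * Γ.Y := by ring
  have hT' : (N + 1) * (140 * Γ.Y + 3 + 3) ≤ (N + 1) * (200 * Γ.Y) :=
    Nat.mul_le_mul_left _ (by omega)
  unfold rows
  refine .set_seq (by simp) (by simp; omega) ?_
  refine .count_keeps (fun r t => t.reg .row = r ∧
    t.reg .addr = β + (l ++ rowList d (fun i => R (mask i)) r).length ∧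
    Filled t.mem β (l ++ rowList d (fun i => R (mask i)) r) ∧
    ∀ a < β, t.mem a = s.mem a) N (140 * Γ.Y) ?_ ?_ ?_ ?_ ?_
  · simpa [Function.update_apply, rowList, haddr] using hl
  · rintro r t hr ⟨hrow, -⟩ hk
    have e1 := hk.reg .N (by simp [Cmd.Writes, hreg])
    simp [hN] at e1
    simp [hrow, e1]
    omega
  · rintro r t hr ⟨hrow, hadd, hfill, hlow⟩ hk
    have e1 := hk.reg .N (by simp [Cmd.Writes, hreg])
    have e2 := hk.reg .dim (by simp [Cmd.Writes, hreg])
    have e3 := hk.reg .h (by simp [Cmd.Writes, hreg])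
    have e4 := hk.reg .bF (by simp [Cmd.Writes, hreg])
    have e5 := hk.reg .f (by simp [Cmd.Writes, hreg])
    simp [hN, hd, hG.bF, hG.f] at e1 e2 e3 e4 e5
    obtain ⟨he1, he2⟩ := he t e3 e1 (by omega)
    rw [hrow] at he2
    set l' := l ++ rowList d (fun i => R (mask i)) r with hl'
    have hl'len : l'.length = l.length + r * d := by rw [hl', List.length_append, length_rowList]
    have hrd : r * d + d ≤ N * d := by
      calc r * d + d = (r + 1) * d := by ring
        _ ≤ _ := Nat.mul_le_mul_right _ hr
    refine .set_seq he1 (by omega) (.set_seq (by simp) (by simp; omega) ?_)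
    refine .seq (T' := 100 * Γ.Y) (R := fun u => u.reg .row = r ∧ u.reg .addr = β + l'.length ∧
      u.reg .dim = d ∧
      (∀ a < β + l'.length, u.mem a = t.mem a) ∧
      ∀ a, u.mem (β + l'.length + a) = (R (mask r) a).toNat) ?_ (by simp; omega) ?_
    · refine .count_keeps (fun i u => u.reg .j = i ∧ (∀ a < β + l'.length, u.mem a = t.mem a) ∧
        ∀ a, u.mem (β + l'.length + a) = if a < 2 * i then (R (mask r) a).toNat else 0) G.length 50
        ?_ ?_ ?_ ?_ ?_
      · refine ⟨by simp, fun a _ => rfl, fun a => ?_⟩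
        simp only [add_assoc, hfill _]
        simp
      · rintro i u hi ⟨hj, -⟩ hku
        have g1 := hku.reg .f (by simp [Cmd.Writes, hreg])
        simp [e5] at g1
        simp [hj, g1]
        omega
      · rintro i u hi ⟨hj, hu1, hu2⟩ hku
        have g1 := hku.reg .f (by simp [Cmd.Writes, hreg])
        have g2 := hku.reg .bF (by simp [Cmd.Writes, hreg])
        have g3 := hku.reg .addr (by simp [Cmd.Writes, hreg])
        have g4 := hku.reg .M (by simp [Cmd.Writes, hreg])
        simp [Function.update_apply, e5, e4, hadd, he2] at g1 g2 g3 g4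
        refine .seq ((hbody u i (mask r) hi ⟨g2, g1, ?_, hG.sub, hG.len⟩ hj g4 ?_ ?_ ?_ ?_).keeps)
          (by omega) ?_
        · refine hG.arr.congr fun j hj => ?_
          rw [hu1 _ (by omega), hlow _ (by omega)]
        · omega
        · omega
        · rw [g3, hu2, if_neg (by omega)]
        · rw [g3, add_assoc, hu2, if_neg (by omega)]
        · rintro u' ⟨hu', hku'⟩
          have hj' : u'.reg .j = i := by rw [hku'.reg _ (hreg _), hj]
          refine .set (by simp [hj']; omega) (by simp) ⟨by simp [hj'], fun a ha => ?_, fun a => ?_⟩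
          · simp only [hu', g3]
            rw [Function.update_of_ne (by omega), Function.update_of_ne (by omega), hu1 a ha]
          · simp only [hu', g3, Function.update_apply]
            rw [hu2 a]
            by_cases h1 : a = 2 * i
            · subst h1
              rw [if_neg (by omega), if_pos rfl, if_pos (by omega)]
            · by_cases h2 : a = 2 * i + 1
              · subst h2
                rw [if_pos (by omega), if_pos (by omega)]
              · rw [if_neg (by omega), if_neg (by omega)]
                congr 1
                simp
                omega
      · rintro u ⟨hj, hu1, hu2⟩ hku
        have g1 := hku.reg .row (by simp [Cmd.Writes, hreg])
        have g3 := hku.reg .addr (by simp [Cmd.Writes, hreg])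
        have g4 := hku.reg .dim (by simp [Cmd.Writes, hreg])
        simp [Function.update_apply, hrow, hadd, e2] at g1 g3 g4
        refine ⟨g1, g3, g4, hu1, fun a => ?_⟩
        rw [hu2]
        split_ifs with h
        · rfl
        · rw [hR _ _ (by omega)]; rfl
      · simp
        omega
    · rintro u ⟨hu1, hu2, hu3, hu4, hu5⟩
      refine .set_seq (by simp [hu2, hu3]; omega) (by simp; omega) (.set ?_ (by simp; omega) ?_)
      · simp [hu1, hw0]
        omega
      · rw [rowList_succ, ← List.append_assoc, ← hl']
        refine ⟨by simp [hu1], by simp [hu2, hu3]; omega, ?_, fun a ha => ?_⟩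
        · refine hfill.append _ hu4 fun a => ?_
          rw [hu5]
          by_cases ha : a < d
          · simp [List.getD_eq_getElem?_getD, List.getElem?_range, ha]
          · rw [hR _ _ (by omega), List.getD_eq_default _ _ (by simp; omega)]; rfl
        · rw [hu4 a (by omega), hlow a ha]
  · rintro t ⟨hrow, hadd, hfill, hlow⟩ hk
    exact ⟨hfill, hadd, hlow⟩
  · simp
    omega


/-! ### The instance for one leaf -/

/-- The code of the literals on the first half of the variables that are satisfied by `a`. -/
def maskA (h a : ℕ) : ℕ := a * 2 ^ (2 * h) ||| ((2 ^ h - 1) ^^^ a)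

/-- The code of the literals on the second half of the variables that are satisfied by `b`. -/
def maskB (h b : ℕ) : ℕ := maskA h b * 2 ^ h

/-- The literals that are satisfied by `a` and `b`. -/
def trueLits (h a b : ℕ) : Set ℕ := {i | (maskA h a).testBit i ∨ (maskB h b).testBit i}

/-- Two clauses that are always satisfied. -/
def dummy (h i : ℕ) : List (Finset ℕ) := [{2 * h + i, h, 3 * h}, {3 * h + i, 0, 2 * h}]

/-- A list of clauses that are always satisfied. -/
def dummies (h r : ℕ) : List (Finset ℕ) := (List.range r).flatMap (dummy h)

/-- Does the set `M` of literals satisfy the clause `j`? -/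
def hit (G : List (Finset ℕ)) (M j : ℕ) : Bool := decide (enc (G.getD j ∅) &&& M ≠ 0)

/-- The entries of the first matrix. -/
def entA (G : List (Finset ℕ)) (M c : ℕ) : Bool :=
  decide (c < 2 * G.length) && if c % 2 = 0 then hit G M (c / 2) else !hit G M (c / 2)

/-- The entries of the second matrix. -/
def entB (G : List (Finset ℕ)) (M c : ℕ) : Bool :=
  decide (c < 2 * G.length) && if c % 2 = 0 then true else hit G M (c / 2)

/-- Bit `x` with `x < 2h` stands for the negation of the variable `x`, bit `x + 2h` for the variable
itself, and the first half consists of the variables below `h`. So `a` satisfies the negative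
literals in its complement and the positive literals in `a` shifted by `2h`. -/
lemma testBit_maskA {h a : ℕ} (ha : a < 2 ^ h) (i : ℕ) :
    (maskA h a).testBit i = if i < h then !a.testBit i else decide (2 * h ≤ i) && a.testBit (i - 2 * h) := by
  unfold maskA
  rw [Nat.testBit_or, Nat.testBit_mul_two_pow, Nat.testBit_xor, Nat.testBit_two_pow_sub_one]
  split_ifs with hi
  · simp [hi, show ¬ 2 * h ≤ i by omega]
  · have : a.testBit i = false := Nat.testBit_lt_two_pow (ha.trans_le
      (Nat.pow_le_pow_right (by norm_num) (not_lt.1 hi)))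
    simp [hi, this]

lemma testBit_maskB {h a : ℕ} (ha : a < 2 ^ h) (i : ℕ) : (maskB h a).testBit i =
    (decide (h ≤ i) && if i < 2 * h then !a.testBit (i - h)
      else decide (3 * h ≤ i) && a.testBit (i - 3 * h)) := by
  unfold maskB
  rw [Nat.testBit_mul_two_pow, testBit_maskA ha]
  by_cases hi : h ≤ i
  · simp only [hi, decide_true, Bool.true_and, Nat.sub_sub]
    rw [show h + 2 * h = 3 * h by ring]
    have e1 : i - h < h ↔ i < 2 * h := by omega
    have e2 : 2 * h ≤ i - h ↔ 3 * h ≤ i := by omega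
    simp only [e1, e2]
  · simp [hi]

lemma maskA_lt {h a : ℕ} (ha : a < 2 ^ h) : maskA h a < 2 ^ (3 * h) := by
  refine Nat.lt_pow_two_of_testBit _ fun i hi => ?_
  rw [testBit_maskA ha]
  have : a.testBit (i - 2 * h) = false := Nat.testBit_lt_two_pow (ha.trans_le
      (Nat.pow_le_pow_right (by norm_num) (by omega)))
  split_ifs with h1
  · have : h = 0 ∨ i < h := by omega
    omega
  · simp [this]

lemma enc_and_ne_zero (D : Finset ℕ) (M : ℕ) : enc D &&& M ≠ 0 ↔ ∃ i ∈ D, M.testBit i := by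
  obtain ⟨B, rfl⟩ := exists_enc M
  simp [enc_and, enc_eq_zero, testBit_enc, Finset.ext_iff]

lemma hits_trueLits {h a b : ℕ} {D : Finset ℕ} : Hits (trueLits h a b) D ↔
    enc D &&& maskA h a ≠ 0 ∨ enc D &&& maskB h b ≠ 0 := by
  simp only [enc_and_ne_zero, Hits, trueLits, Set.mem_ofPred_eq, and_or_left, exists_or]

lemma mem_dummies {h r : ℕ} {D : Finset ℕ} :
    D ∈ dummies h r ↔ ∃ i < r, D = {2 * h + i, h, 3 * h} ∨ D = {3 * h + i, 0, 2 * h} := by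
  simp [dummies, dummy]

lemma dummies_succ (h r : ℕ) : dummies h (r + 1) = dummies h r ++ dummy h r := by
  simp [dummies, List.range_succ]

lemma length_dummies (h r : ℕ) : (dummies h r).length = 2 * r := by
  induction r with
  | zero => rfl
  | succ r ih => rw [dummies_succ, List.length_append, ih]; simp [dummy]; omega

lemma dummies_subset {h : ℕ} {D : Finset ℕ} (hD : D ∈ dummies h h) :
    D ⊆ Finset.range (4 * h) := by
  obtain ⟨i, hi, rfl | rfl⟩ := mem_dummies.1 hD <;>
  · intro x hx
    simp only [Finset.mem_insert, Finset.mem_singleton] at hx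
    rw [Finset.mem_range]
    omega

/-- Each of these clauses contains a variable together with its negation: `h` and `3h` belong to the
variable `h`, and `0` and `2h` to the variable `0`. -/
lemma hits_dummies {h a b : ℕ} (ha : a < 2 ^ h) (hb : b < 2 ^ h) {D : Finset ℕ}
    (hD : D ∈ dummies h h) : Hits (trueLits h a b) D := by
  obtain ⟨i, hi, rfl | rfl⟩ := mem_dummies.1 hD
  · cases hb0 : b.testBit 0
    · refine ⟨h, by simp, .inr ?_⟩
      rw [testBit_maskB hb]
      simp [hb0, show h < 2 * h by omega]
    · refine ⟨3 * h, by simp, .inr ?_⟩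
      rw [testBit_maskB hb]
      simp [hb0, show h ≤ 3 * h by omega, show ¬ 3 * h < 2 * h by omega]
  · cases ha0 : a.testBit 0
    · refine ⟨0, by simp, .inl ?_⟩
      rw [testBit_maskA ha]
      simp [ha0, show 0 < h by omega]
    · refine ⟨2 * h, by simp, .inl ?_⟩
      rw [testBit_maskA ha]
      simp [ha0, show ¬ 2 * h < h by omega]

lemma hit_getElem {G : List (Finset ℕ)} {j : ℕ} (hj : j < G.length) (M : ℕ) :
    hit G M j = decide (enc G[j] &&& M ≠ 0) := by
  rw [hit, List.getD_eq_getElem _ _ hj]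

/-- The complementary pair `h`, `3h` belongs to the second half, so an assignment of the first half
meets the clause only through the literal `2h + i`, which is its bit `i`. In this way the dummies
separate the vectors. -/
lemma hit_dummy_A {h a i : ℕ} (ha : a < 2 ^ h) (hi : i < h) :
    (enc {2 * h + i, h, 3 * h} &&& maskA h a ≠ 0) ↔ a.testBit i := by
  have : a.testBit h = false := Nat.testBit_lt_two_pow ha
  rw [enc_and_ne_zero]
  simp [testBit_maskA ha, show ¬ 2 * h + i < h by omega, show ¬ 2 * h ≤ h by omega,
    show ¬ 3 * h < h by omega, show 3 * h - 2 * h = h by omega, this]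

lemma hit_dummy_B {h a i : ℕ} (ha : a < 2 ^ h) (hi : i < h) :
    (enc {3 * h + i, 0, 2 * h} &&& maskB h a ≠ 0) ↔ a.testBit i := by
  have : a.testBit h = false := Nat.testBit_lt_two_pow ha
  rw [enc_and_ne_zero]
  simp [testBit_maskB ha, show ¬ 3 * h + i < 2 * h by omega, show h ≤ 3 * h + i by omega,
    show ¬ h = 0 by omega, show ¬ 3 * h ≤ 2 * h by omega]

lemma eq_of_testBit {h a a' : ℕ} (ha : a < 2 ^ h) (ha' : a' < 2 ^ h)
    (hb : ∀ i < h, (a.testBit i = true ↔ a'.testBit i = true)) : a = a' := by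
  refine Nat.eq_of_testBit_eq fun i => ?_
  by_cases hi : i < h
  · exact Bool.eq_iff_iff.2 (hb i hi)
  · have : 2 ^ h ≤ 2 ^ i := Nat.pow_le_pow_right (by norm_num) (not_lt.1 hi)
    rw [Nat.testBit_lt_two_pow (ha.trans_le this), Nat.testBit_lt_two_pow (ha'.trans_le this)]

lemma sum_range_pairs (g : ℕ → ℕ) (f : ℕ) :
    ∑ c ∈ Finset.range (2 * f), g c = ∑ j ∈ Finset.range f, (g (2 * j) + g (2 * j + 1)) := by
  induction f with
  | zero => rfl
  | succ f ih => rw [mul_add, mul_one, Finset.sum_range_succ, Finset.sum_range_succ, ih,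
      Finset.sum_range_succ, add_assoc]

/-- Columns `2j` and `2j + 1` contribute `α * 1 + (1 - α) * β`, which is `1` iff `α` or `β` is, and
later columns contribute nothing. So the product is the number of clauses met, and it reaches
`G.length` only if all are. -/
lemma le_binDot_iff {G : List (Finset ℕ)} {d : ℕ} (hd : 2 * G.length ≤ d) (h a b : ℕ) :
    G.length ≤ binDot (fun c : Fin d => entA G (maskA h a) c) (fun c => entB G (maskB h b) c) ↔
      ∀ D ∈ G, Hits (trueLits h a b) D := by
  have e1 : binDot (fun c : Fin d => entA G (maskA h a) c) (fun c => entB G (maskB h b) c) =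
      ∑ j ∈ Finset.range G.length, if hit G (maskA h a) j || hit G (maskB h b) j then 1 else 0 := by
    unfold binDot
    rw [Fin.sum_univ_eq_sum_range
      (fun c => (entA G (maskA h a) c).toNat * (entB G (maskB h b) c).toNat)]
    rw [← Finset.sum_subset (Finset.range_mono hd), sum_range_pairs]
    · refine Finset.sum_congr rfl fun j hj => ?_
      rw [Finset.mem_range] at hj
      have h1 : (2 * j + 1) / 2 = j := by omega
      have h2 : 2 * j + 1 < 2 * G.length := by omega
      simp only [entA, entB, show 2 * j < 2 * G.length by omega, h1, h2, decide_true, Bool.true_and,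
        Nat.mul_mod_right, if_true, show ¬ (2 * j + 1) % 2 = 0 by omega, if_false,
        Nat.mul_div_cancel_left j (show 0 < 2 by norm_num)]
      cases hit G (maskA h a) j <;> cases hit G (maskB h b) j <;> rfl
    · intro c _ hc
      rw [Finset.mem_range] at hc
      simp [entA, hc]
  have e2 : (∀ D ∈ G, Hits (trueLits h a b) D) ↔
      ∀ j ∈ Finset.range G.length, (hit G (maskA h a) j || hit G (maskB h b) j) = true := by
    rw [List.forall_mem_iff_getElem]
    refine forall_congr' fun j => ?_
    rw [Finset.mem_range]
    refine forall_congr' fun hj => ?_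
    rw [hits_trueLits, hit_getElem hj, hit_getElem hj]
    simp
  rw [e1, e2, ← Finset.card_filter]
  have h3 := Finset.card_filter_le (Finset.range G.length)
    (fun j => (hit G (maskA h a) j || hit G (maskB h b) j) = true)
  rw [Finset.card_range] at h3
  rw [← Finset.filter_eq_self]
  constructor
  · intro h4
    exact Finset.eq_of_subset_of_card_le (Finset.filter_subset _ _) (by rwa [Finset.card_range])
  · intro h4
    rw [h4, Finset.card_range]

/-- The instance for the clauses `F`. -/
def inst (h d : ℕ) (F : List (Finset ℕ)) (hh : 1 ≤ h) (hN : F.length + 2 * h ≤ 2 ^ h)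
    (hd : 2 * (F.length + 2 * h) ≤ d) : TVPP (2 ^ h) d where
  A i c := entA (F ++ dummies h h) (maskA h i) c
  B i c := entB (F ++ dummies h h) (maskB h i) c
  t := F.length + 2 * h
  one_le_t := by omega
  t_le := hN
  A_injective a a' haa := by
    refine Fin.ext (eq_of_testBit a.2 a'.2 fun i hi => ?_)
    obtain ⟨j, hj, hD⟩ := List.getElem_of_mem (show ({2 * h + i, h, 3 * h} : Finset ℕ) ∈
      F ++ dummies h h from List.mem_append_right _ (mem_dummies.2 ⟨i, hi, .inl rfl⟩))
    have hl : (F ++ dummies h h).length = F.length + 2 * h := by simp [length_dummies]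
    -- In the first matrix, column `2j` for the dummy clause of `i` shows the bit `i` of the row
    -- number.
    have := congrFun haa ⟨2 * j, by omega⟩
    simp only [entA, show 2 * j < 2 * (F ++ dummies h h).length by omega, decide_true, Bool.true_and,
        Nat.mul_mod_right, if_true, Nat.mul_div_cancel_left j (show 0 < 2 by norm_num),
        hit_getElem hj, hD, decide_eq_decide] at this
    rwa [hit_dummy_A a.2 hi, hit_dummy_A a'.2 hi] at this
  B_injective a a' haa := by
    refine Fin.ext (eq_of_testBit a.2 a'.2 fun i hi => ?_)
    obtain ⟨j, hj, hD⟩ := List.getElem_of_mem (show ({3 * h + i, 0, 2 * h} : Finset ℕ) ∈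
      F ++ dummies h h from List.mem_append_right _ (mem_dummies.2 ⟨i, hi, .inr rfl⟩))
    have hl : (F ++ dummies h h).length = F.length + 2 * h := by simp [length_dummies]
    -- In the second matrix the even columns are constant, so the odd column of the dummy clause is
    -- compared.
    have := congrFun haa ⟨2 * j + 1, by omega⟩
    have h1 : (2 * j + 1) / 2 = j := by omega
    simp only [entB, show 2 * j + 1 < 2 * (F ++ dummies h h).length by omega, decide_true,
      Bool.true_and, show ¬ (2 * j + 1) % 2 = 0 by omega, if_false, h1,
        hit_getElem hj, hD, decide_eq_decide] at this
    rwa [hit_dummy_B a.2 hi, hit_dummy_B a'.2 hi] at this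

lemma inst_isYes {h d : ℕ} {F : List (Finset ℕ)} (hh : 1 ≤ h) (hN : F.length + 2 * h ≤ 2 ^ h)
    (hd : 2 * (F.length + 2 * h) ≤ d) : (inst h d F hh hN hd).IsYes ↔
      ∃ a < 2 ^ h, ∃ b < 2 ^ h, ∀ D ∈ F, Hits (trueLits h a b) D := by
  have hl : (F ++ dummies h h).length = F.length + 2 * h := by simp [length_dummies]
  unfold TVPP.IsYes inst
  simp only [← hl]
  rw [← hl] at hd
  simp only [le_binDot_iff hd]
  constructor
  · rintro ⟨a, b, hab⟩
    exact ⟨a, a.2, b, b.2, fun D hD => hab D (List.mem_append_left _ hD)⟩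
  · rintro ⟨a, ha, b, hb, hab⟩
    refine ⟨⟨a, ha⟩, ⟨b, hb⟩, fun D hD => ?_⟩
    rcases List.mem_append.1 hD with hD | hD
    · exact hab D hD
    · exact hits_dummies ha hb hD

lemma inst_encode {h d : ℕ} {F : List (Finset ℕ)} (hh : 1 ≤ h) (hN : F.length + 2 * h ≤ 2 ^ h)
    (hd : 2 * (F.length + 2 * h) ≤ d) : (inst h d F hh hN hd).encode =
      [2 ^ h, d, F.length + 2 * h] ++
        rowList d (fun i => entA (F ++ dummies h h) (maskA h i)) (2 ^ h) ++
        rowList d (fun i => entB (F ++ dummies h h) (maskB h i)) (2 ^ h) := by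
  unfold TVPP.encode inst
  rw [← encodeRows_eq, ← encodeRows_eq]

/-! ### Verification: writing and solving the instance -/

lemma addDummies_spec (Γ : Cfg) {s : Store Reg} {F : List (Finset ℕ)} (hF : Kept Γ s F)
    (hlen : F.length ≤ maxPot Γ.k Γ.q (4 * Γ.h)) (hh : s.reg .h = Γ.h) :
    addDummies.Ho Γ.w s (100 * Γ.Y) (fun t => (Kept Γ t (F ++ dummies Γ.h Γ.h) ∧
      ∀ a, a < Γ.S ∨ 2 * Γ.S ≤ a → t.mem a = s.mem a) ∧ addDummies.Keeps s t) := by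
  have hY := Γ.lits
  have hS := Γ.small
  have hw := Γ.word
  have hw0 := Γ.w_ne_zero
  have hpot := Γ.pot
  refine (Cmd.Ho.keeps (Q := fun t => t.reg .f = (F ++ dummies Γ.h Γ.h).length ∧
    Arr t.mem Γ.S (F ++ dummies Γ.h Γ.h) ∧
    ∀ a, a < Γ.S ∨ 2 * Γ.S ≤ a → t.mem a = s.mem a) ?_).conseq le_rfl ?_
  swap
  · rintro t ⟨⟨h1, h2, h3⟩, hk⟩
    refine ⟨⟨⟨?_, h1, h2, fun D hD => ?_, ?_⟩, h3⟩, hk⟩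
    · rw [hk.reg _ (by simp [addDummies, Cmd.Writes]), hF.bF]
    · rcases List.mem_append.1 hD with hD | hD
      · exact hF.sub D hD
      · exact dummies_subset hD
    · rw [List.length_append, length_dummies]; omega
  unfold addDummies
  refine .set_seq (by simp) (by simp; omega) ?_
  refine .count_keeps (fun i t => t.reg .j = i ∧ t.reg .f = (F ++ dummies Γ.h i).length ∧
    Arr t.mem Γ.S (F ++ dummies Γ.h i) ∧
    ∀ a, a < Γ.S ∨ 2 * Γ.S ≤ a → t.mem a = s.mem a) Γ.h 60 ?_ ?_ ?_ ?_ ?_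
  · simpa [dummies, Function.update_apply, hF.f] using hF.arr
  · rintro i t hi ⟨hj, -⟩ hk
    have e1 := hk.reg .h (by simp [Cmd.Writes])
    simp [hh] at e1
    simp [hj, e1]
    omega
  · rintro i t hi ⟨hj, hf, harr, hlow⟩ hk
    have e1 := hk.reg .h (by simp [Cmd.Writes])
    have e2 := hk.reg .bF (by simp [Cmd.Writes])
    simp [hh, hF.bF] at e1 e2
    have hmask := Γ.mask
    have hp : ∀ x, x ≤ 4 * Γ.h → 2 ^ x ≤ Γ.S := fun x hx =>
      (Nat.pow_le_pow_right (by norm_num) hx).trans hmask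
    have p1 := hp (2 * Γ.h + i) (by omega)
    have p2 := hp Γ.h (by omega)
    have p3 := hp (3 * Γ.h) (by omega)
    have p4 := hp (3 * Γ.h + i) (by omega)
    have p5 := hp (2 * Γ.h) (by omega)
    have h3w : 3 < 2 ^ Γ.w := by omega
    have h2w : 2 < 2 ^ Γ.w := by omega
    have e3 : enc {2 * Γ.h + i, Γ.h, 3 * Γ.h} =
        2 ^ (2 * Γ.h + i) ||| (2 ^ Γ.h ||| 2 ^ (3 * Γ.h)) := by
      rw [Finset.insert_eq, Finset.insert_eq, ← enc_or, ← enc_or]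
      simp only [enc_singleton]
    have e4 : enc {3 * Γ.h + i, 0, 2 * Γ.h} =
        2 ^ (3 * Γ.h + i) ||| (1 ||| 2 ^ (2 * Γ.h)) := by
      rw [Finset.insert_eq, Finset.insert_eq, ← enc_or, ← enc_or]
      simp only [enc_singleton, pow_zero]
    have hfl := hf
    rw [List.length_append, length_dummies] at hfl
    refine .put_seq ?_ ?_ (by simp) (.set_seq ?_ (by simp) (.put_seq ?_ ?_ (by simp)
      (.set_seq ?_ (by simp) (.set ?_ (by simp) ?_))))
    · simp [e2, hfl]; omega
    · simp [e1, hj, hw0, h2w, h3w]; omega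
    · simp [hfl, hw0]; omega
    · simp [e2, hfl, hw0]; omega
    · simp [e1, hj, hw0, h2w, h3w]; omega
    · simp [hfl, hw0]; omega
    · simp [hj, hw0]; omega
    · rw [dummies_succ, ← List.append_assoc]
      refine ⟨by simp [hj], by simp [hfl, length_dummies, dummy]; omega, ?_, fun a ha => ?_⟩
      · have := (harr.concat {2 * Γ.h + i, Γ.h, 3 * Γ.h}).concat {3 * Γ.h + i, 0, 2 * Γ.h}
        rw [List.append_assoc] at this
        simpa [dummy, e1, e2, e3, e4, hj, hfl, length_dummies, Function.update_apply, add_assoc] using this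
      · simp [e1, e2, hj, hfl]
        rw [Function.update_of_ne (by omega), Function.update_of_ne (by omega), hlow a ha]
  · rintro t ⟨hj, hf, harr, hlow⟩ hk
    exact ⟨hf, harr, hlow⟩
  · simp
    omega


lemma entriesA_spec (Γ : Cfg) {G : List (Finset ℕ)} (t : Store Reg) (i M : ℕ) (hi : i < G.length)
    (hG : Kept Γ t G) (hj : t.reg .j = i) (hM : t.reg .M = M)
    (haddr : t.reg .addr + 2 * i + 1 < 2 ^ Γ.w) (h0 : t.mem (t.reg .addr + 2 * i) = 0)
    (h1 : t.mem (t.reg .addr + 2 * i + 1) = 0) :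
    entriesA.Ho Γ.w t 40 (fun u => u.mem =
        Function.update (Function.update t.mem (t.reg .addr + 2 * i) (entA G M (2 * i)).toNat)
          (t.reg .addr + 2 * i + 1) (entA G M (2 * i + 1)).toNat) := by
  have hw := Γ.word
  have hY := Γ.lits
  have hS := Γ.small
  have hw0 := Γ.w_ne_zero
  have h2w : 2 < 2 ^ Γ.w := by omega
  have hlen := hG.len
  have ha := hG.arr i hi
  have hdiv : (2 * i + 1) / 2 = i := by omega
  have hmod : (2 * i + 1) % 2 = 1 := by omega
  have e0 : entA G M (2 * i) = hit G M i := by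
    simp [entA, show 2 * i < 2 * G.length by omega]
  have e1 : entA G M (2 * i + 1) = !hit G M i := by
    simp [entA, show 2 * i + 1 < 2 * G.length by omega, hdiv, hmod]
  rw [e0, e1]
  unfold entriesA
  refine .ite ?_ (by simp) (fun hne => .put ?_ (by simp [hw0]) (by simp) ?_)
    (fun heq => .put ?_ (by simp [hw0]) (by simp) ?_)
  · simp [hG.bF, hj]; omega
  · simp [hj, h2w]; omega
  · have : hit G M i = true := by
      rw [hit_getElem hi]
      simpa [hG.bF, hj, ha, hM] using hne
    rw [this]
    simp [hj]
    exact h1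
  · simp [hj, h2w]; omega
  · have : hit G M i = false := by
      rw [hit_getElem hi]
      simpa [hG.bF, hj, ha, hM] using heq
    rw [this]
    simp only [Bool.toNat_false, Bool.not_false, Bool.toNat_true]
    rw [← h0, Function.update_eq_self]
    simp [hj]

lemma entriesB_spec (Γ : Cfg) {G : List (Finset ℕ)} (t : Store Reg) (i M : ℕ) (hi : i < G.length)
    (hG : Kept Γ t G) (hj : t.reg .j = i) (hM : t.reg .M = M) (hβ : 3 * Γ.S ≤ t.reg .addr)
    (haddr : t.reg .addr + 2 * i + 1 < 2 ^ Γ.w)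
    (h1 : t.mem (t.reg .addr + 2 * i + 1) = 0) :
    entriesB.Ho Γ.w t 40 (fun u => u.mem =
        Function.update (Function.update t.mem (t.reg .addr + 2 * i) (entB G M (2 * i)).toNat)
          (t.reg .addr + 2 * i + 1) (entB G M (2 * i + 1)).toNat) := by
  have hw := Γ.word
  have hY := Γ.lits
  have hS := Γ.small
  have hw0 := Γ.w_ne_zero
  have h2w : 2 < 2 ^ Γ.w := by omega
  have hlen := hG.len
  have ha := hG.arr i hi
  have hdiv : (2 * i + 1) / 2 = i := by omega
  have hmod : (2 * i + 1) % 2 = 1 := by omega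
  have e0 : entB G M (2 * i) = true := by
    simp [entB, show 2 * i < 2 * G.length by omega]
  have e1 : entB G M (2 * i + 1) = hit G M i := by
    simp [entB, show 2 * i + 1 < 2 * G.length by omega, hdiv, hmod]
  have ha' : Function.update t.mem (t.reg .addr + 2 * i) 1 (Γ.S + i) = enc G[i] := by
    rw [Function.update_of_ne (by omega), ha]
  rw [e0, e1]
  unfold entriesB
  refine .put_seq ?_ (by simp [hw0]) (by simp) (.ite ?_ (by simp)
    (fun hne => .put ?_ (by simp [hw0]) (by simp) ?_) (fun heq => .skip ?_))
  · simp [hj, h2w]; omega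
  · simp [hG.bF, hj]; omega
  · simp [hj, h2w]; omega
  · have : hit G M i = true := by
      rw [hit_getElem hi]
      simpa [hG.bF, hj, ha', hM] using hne
    rw [this]
    simp [hj]
  · have : hit G M i = false := by
      rw [hit_getElem hi]
      simpa [hG.bF, hj, ha', hM] using heq
    rw [this]
    simp [hj]
    exact h1

-- The register `ans` is only ever raised to one, so over all leaves it becomes the disjunction of
-- the answers. The block of length `S` from `β` on has room for the instance and for every address
-- that `p` can form.
open Classical in
lemma solve_spec (Γ : Cfg) {s : Store Reg} {F : List (Finset ℕ)} (hF : Kept Γ s F)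
    (hlen : F.length ≤ maxPot Γ.k Γ.q (4 * Γ.h)) (hh1 : 1 ≤ Γ.h) (hh : s.reg .h = Γ.h)
    {d β w₀ τ : ℕ} (hN : s.reg .N = 2 ^ Γ.h) (hd : s.reg .dim = d) (hb : s.reg .base = β)
    (hβ : 3 * Γ.S ≤ β) (hβw : β + Γ.S < 2 ^ Γ.w) (hzero : ∀ a, β ≤ a → s.mem a = 0)
    (hdim : 2 * (maxPot Γ.k Γ.q (4 * Γ.h) + 2 * Γ.h) ≤ d)
    (hNum : maxPot Γ.k Γ.q (4 * Γ.h) + 2 * Γ.h ≤ 2 ^ Γ.h) (hsize : 3 + 2 * (2 ^ Γ.h * d) ≤ Γ.S)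
    (hw₀ : 2 ^ w₀ ≤ Γ.S) {T : ℝ} {p : Program} (hTτ : T ≤ τ)
    (hp : ∀ I : TVPP (2 ^ Γ.h) d, Decides p I.encode T w₀ I.IsYes) :
    (solve p).Ho Γ.w s ((2 ^ Γ.h + 2) * (600 * Γ.Y) + 2 * τ + p.regs) (fun t =>
      ((∀ a < Γ.S, t.mem a = s.mem a) ∧ (∀ a, β + Γ.S ≤ a → t.mem a = 0) ∧
      t.reg .ans = if ∃ a < 2 ^ Γ.h, ∃ b < 2 ^ Γ.h, ∀ D ∈ F, Hits (trueLits Γ.h a b) D then 1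
        else s.reg .ans) ∧ (solve p).Keeps s t) := by
  have hw := Γ.word
  have hY := Γ.lits
  have hS := Γ.small
  have hw0 := Γ.w_ne_zero
  have h2w : 3 < 2 ^ Γ.w := by omega
  have hmask := Γ.mask
  have hNS : 2 ^ Γ.h ≤ Γ.S := (Nat.pow_le_pow_right (by norm_num) (by omega)).trans hmask
  have hd1 : 1 ≤ d := by omega
  have hT : (2 ^ Γ.h + 2) * (600 * Γ.Y) = (2 ^ Γ.h + 2) * (200 * Γ.Y) + (2 ^ Γ.h + 2) * (200 * Γ.Y) +
      2 ^ Γ.h * (200 * Γ.Y) + 400 * Γ.Y := by ring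
  set G := F ++ dummies Γ.h Γ.h with hG
  have hGl : G.length = F.length + 2 * Γ.h := by rw [hG, List.length_append, length_dummies]
  apply Cmd.Ho.keeps
  unfold solve
  refine .seq (addDummies_spec Γ hF hlen hh) (by omega) ?_
  rintro t₀ ⟨⟨hF₀, hlow₀⟩, hk₀⟩
  have a1 := hk₀.reg .h (by simp [addDummies, Cmd.Writes])
  have a2 := hk₀.reg .N (by simp [addDummies, Cmd.Writes])
  have a3 := hk₀.reg .dim (by simp [addDummies, Cmd.Writes])
  have a4 := hk₀.reg .base (by simp [addDummies, Cmd.Writes])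
  have a5 := hk₀.reg .ans (by simp [addDummies, Cmd.Writes])
  rw [hh] at a1
  rw [hN] at a2
  rw [hd] at a3
  rw [hb] at a4
  have a6 := hF₀.f
  refine .put_seq (by simp) (by simp) (by simp; omega) (.put_seq (by simp [a4, hw0]; omega)
    (by simp) (by simp; omega) (.put_seq (by simp [a4]; omega) (by simp) (by simp; omega)
    (.set_seq (by simp [a4]; omega) (by simp; omega) ?_)))
  set t₁ : Store Reg := ⟨_, _⟩ with ht₁
  have m₁ : t₁.mem = Function.update (Function.update (Function.update t₀.mem β (2 ^ Γ.h)) (β + 1) d)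
      (β + 2) G.length := by
    simp [ht₁, a2, a3, a4, a6, hG]
  have b0 : t₁.reg .addr = β + 3 := by simp [ht₁, a4]
  have b1 : t₁.reg .h = Γ.h := by simp [ht₁, a1]
  have b2 : t₁.reg .N = 2 ^ Γ.h := by simp [ht₁, a2]
  have b3 : t₁.reg .dim = d := by simp [ht₁, a3]
  have b4 : t₁.reg .base = β := by simp [ht₁, a4]
  have b5 : t₁.reg .ans = s.reg .ans := by simp [ht₁, a5]
  have low₁ : ∀ a < β, t₁.mem a = t₀.mem a := fun a ha => by
    rw [m₁, Function.update_of_ne (by omega), Function.update_of_ne (by omega),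
      Function.update_of_ne (by omega)]
  have hF₁ : Kept Γ t₁ G := by
    refine ⟨by simp [ht₁, hF₀.bF], by simp [ht₁, hF₀.f, hG], hF₀.arr.congr fun j hj => low₁ _ ?_,
      hF₀.sub, hF₀.len⟩
    have := hF₀.len
    omega
  have fill₁ : Filled t₁.mem β [2 ^ Γ.h, d, G.length] := by
    intro a
    rw [m₁]
    rcases a with _ | _ | _ | a
    · simp [Function.update_apply]
    · simp [Function.update_apply]
    · simp [Function.update_apply]
    · rw [Function.update_of_ne (by omega), Function.update_of_ne (by omega),
        Function.update_of_ne (by omega), hlow₀ _ (by omega), hzero _ (by omega)]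
      simp
  clear_value t₁
  have hmA : ∀ a < 2 ^ Γ.h, maskA Γ.h a < 2 ^ (3 * Γ.h) := fun a ha => maskA_lt ha
  have hp3 : 2 ^ (3 * Γ.h) ≤ Γ.S := (Nat.pow_le_pow_right (by norm_num) (by omega)).trans hmask
  have hrow : ∀ a < 2 ^ Γ.h, a * 2 ^ (2 * Γ.h) ≤ Γ.S := fun a ha => by
    refine le_trans ?_ hp3
    rw [show 3 * Γ.h = Γ.h + 2 * Γ.h by ring, pow_add]
    exact Nat.mul_le_mul_right _ ha.le
  have hvalA : ∀ t : Store Reg, t.reg .h = t₁.reg .h → t.reg .N = 2 ^ Γ.h → t.reg .row < 2 ^ Γ.h →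
      rowMask.Fits Γ.w t ∧ rowMask.val t = maskA Γ.h (t.reg .row) := by
    intro t h1 h2 h3
    rw [b1] at h1
    have := hrow _ h3
    refine ⟨?_, ?_⟩
    · simp [rowMask, h1, h2, hw0]
      omega
    · simp [rowMask, h1, h2, maskA]
  refine .seq (rows_spec Γ hF₁ (entA G) (maskA Γ.h) (N := 2 ^ Γ.h) (d := d) (β := β)
    (by simp [entriesA, Cmd.Writes]) (by simp [rowMask]) hNS b2 b3 fill₁ (by simp [b0]) hβ
    (by simp; omega) (by omega) (fun M c hc => by simp [entA, hc]) hvalA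
    (fun t i M h1 h2 h3 h4 _ h5 h6 h7 => entriesA_spec Γ t i M h1 h2 h3 h4 h5 h6 h7))
    (by simp; omega) ?_
  rintro t₂ ⟨⟨fill₂, addr₂, low₂⟩, hk₂⟩
  have c1 := hk₂.reg .h (by simp [rows, entriesA, Cmd.Writes])
  have c2 := hk₂.reg .N (by simp [rows, entriesA, Cmd.Writes])
  have c3 := hk₂.reg .dim (by simp [rows, entriesA, Cmd.Writes])
  have c4 := hk₂.reg .base (by simp [rows, entriesA, Cmd.Writes])
  have c5 := hk₂.reg .ans (by simp [rows, entriesA, Cmd.Writes])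
  have hF₂ : Kept Γ t₂ G := by
    refine ⟨?_, ?_, hF₁.arr.congr fun j hj => low₂ _ ?_, hF₁.sub, hF₁.len⟩
    · rw [hk₂.reg _ (by simp [rows, entriesA, Cmd.Writes]), hF₁.bF]
    · rw [hk₂.reg _ (by simp [rows, entriesA, Cmd.Writes]), hF₁.f]
    · have := hF₁.len
      omega
  have hl₂ : ([2 ^ Γ.h, d, G.length] ++ rowList d (fun i => entA G (maskA Γ.h i)) (2 ^ Γ.h)).length =
      3 + 2 ^ Γ.h * d := by
    rw [List.length_append, length_rowList]; rfl
  have hp4 : 2 ^ (3 * Γ.h) * 2 ^ Γ.h ≤ Γ.S := by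
    rw [← pow_add]; exact (Nat.pow_le_pow_right (by norm_num) (by omega)).trans hmask
  refine .seq (rows_spec Γ hF₂ (entB G) (maskB Γ.h) (N := 2 ^ Γ.h) (d := d) (β := β)
    (by simp [entriesB, Cmd.Writes]) (by simp [rowMask]) hNS (c2.trans b2) (c3.trans b3) fill₂ addr₂ hβ
    (by omega) (by omega) (fun M c hc => by simp [entB, hc]) ?_
    (fun t i M h1 h2 h3 h4 h8 h5 _ h7 => entriesB_spec Γ t i M h1 h2 h3 h4 h8 h5 h7))
    (by simp; omega) ?_
  · intro t h1 h2 h3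
    obtain ⟨v1, v2⟩ := hvalA t (h1.trans c1) h2 h3
    have := hmA _ h3
    have h4 : maskA Γ.h (t.reg .row) * 2 ^ Γ.h ≤ 2 ^ (3 * Γ.h) * 2 ^ Γ.h :=
      Nat.mul_le_mul_right _ this.le
    refine ⟨?_, ?_⟩
    · simp [v1, v2, h1, c1, b1]
      omega
    · simp [v2, h1, c1, b1, maskB]
  rintro t₃ ⟨⟨fill₃, -, low₃⟩, hk₃⟩
  have d4 := hk₃.reg .base (by simp [rows, entriesB, Cmd.Writes])
  have d5 := hk₃.reg .ans (by simp [rows, entriesB, Cmd.Writes])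
  have hbase : t₃.reg .base = β := by rw [d4, c4, b4]
  have hans : t₃.reg .ans = s.reg .ans := by rw [d5, c5, b5]
  have hN' : F.length + 2 * Γ.h ≤ 2 ^ Γ.h := by omega
  have hd' : 2 * (F.length + 2 * Γ.h) ≤ d := by omega
  let I := inst Γ.h d F hh1 hN' hd'
  have henc : ∀ a, t₃.mem (t₃.reg .base + a) = I.encode.getD a 0 := by
    intro a
    rw [hbase, fill₃ a, inst_encode, ← hG, hGl]
  have hyes : I.IsYes ↔ ∃ a < 2 ^ Γ.h, ∃ b < 2 ^ Γ.h, ∀ D ∈ F, Hits (trueLits Γ.h a b) D :=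
    inst_isYes hh1 hN' hd'
  have hout : ∃ out, Outputs p I.encode T w₀ out ∧ (if out ≠ 0 then 1 else s.reg .ans) =
      if ∃ a < 2 ^ Γ.h, ∃ b < 2 ^ Γ.h, ∀ D ∈ F, Hits (trueLits Γ.h a b) D then 1
        else s.reg .ans := by
    by_cases hI : I.IsYes
    · exact ⟨1, (hp I).1 hI, by rw [if_pos (by norm_num), if_pos (hyes.1 hI)]⟩
    · exact ⟨0, (hp I).2 hI, by rw [if_neg (by norm_num), if_neg (fun h => hI (hyes.2 h))]⟩
  obtain ⟨out, ho, hval⟩ := hout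
  refine .seq (T' := 2 * τ + p.regs + 2) (R := fun t => t.reg .res = out ∧ t.reg .ans = s.reg .ans ∧
    (∀ a < Γ.S, t.mem a = s.mem a) ∧ ∀ a, β + Γ.S ≤ a → t.mem a = 0)
    (.sim henc ho hTτ (by omega) le_rfl fun m' hm1 hm2 => ?_) (by simp; omega) ?_
  · rw [hbase] at hm1 hm2
    refine ⟨by simp, by simp [hans], fun a ha => ?_, fun a ha => ?_⟩
    · simp only
      rw [hm1 _ (by omega), low₃ _ (by omega), low₂ _ (by omega), low₁ _ (by omega),
        hlow₀ _ (.inl ha)]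
    · simp only
      obtain ⟨a, rfl⟩ : ∃ a', a = β + a' := ⟨a - β, by omega⟩
      rw [hm2 _ (by omega), fill₃, List.getD_eq_default]
      rw [List.length_append, hl₂, length_rowList]
      omega
  · rintro t ⟨h1, h2, h3, h4⟩
    rw [← hval]
    refine .ite (by simp) (by simp; omega) (fun hne => .set (by simp [hw0]) (by simp; omega) ?_)
      (fun h0 => .skip ?_)
    · simp only [Expr.val_var, h1] at hne
      exact ⟨h3, h4, by simp [hne]⟩
    · simp only [Expr.val_var, h1] at h0
      exact ⟨h3, h4, by simp [h0, h2]⟩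


/-! ### Verification: the whole program -/

/-- The registers after the initialization. -/
structure Ready (Γ : Cfg) (L : ℕ) (s : Store Reg) : Prop extends Fixed Γ s where
  N : s.reg .N = 2 ^ Γ.h
  lim : s.reg .lim = 2 ^ (L * Γ.h)

lemma setup_spec (Γ : Cfg) (hh : 1 ≤ Γ.h) {h₀ G L : ℕ} {s : Store Reg} (hSG : Γ.S = 2 ^ (G * Γ.h))
    (hn : s.mem 0 / 2 + h₀ = Γ.h) (hL : 2 ^ (L * Γ.h) < 2 ^ Γ.w) :
    (setup h₀ G L).Ho Γ.w s 200 (fun t => Ready Γ L t ∧ t.reg .m = s.mem 1 ∧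
      t.reg .base = 3 * Γ.S ∧ t.reg .x = 0 ∧ t.reg .ans = 0 ∧ t.mem = s.mem) := by
  have hw := Γ.word
  have hY := Γ.lits
  have hS := Γ.small
  have hw0 := Γ.w_ne_zero
  have hmask := Γ.mask
  have h4w : 4 < 2 ^ Γ.w := by omega
  have h3w : 3 < 2 ^ Γ.w := by omega
  have h2w : 2 < 2 ^ Γ.w := by omega
  have g1 : G * 1 ≤ G * Γ.h := Nat.mul_le_mul_left _ hh
  have g2 : G * Γ.h < 2 ^ (G * Γ.h) := Nat.lt_two_pow_self
  have l1 : L * 1 ≤ L * Γ.h := Nat.mul_le_mul_left _ hh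
  have l2 : L * Γ.h < 2 ^ (L * Γ.h) := Nat.lt_two_pow_self
  have hNS : 2 ^ Γ.h ≤ Γ.S := (Nat.pow_le_pow_right (by norm_num) (by omega)).trans hmask
  rw [← hSG] at g2
  refine .set_seq (by simp [hw0, h2w]; omega) (by simp) (.set_seq (by simp [hw0]) (by simp)
    (.set_seq ?_ (by simp) (.set_seq ?_ (by simp) (.set_seq ?_ (by simp) (.set_seq ?_ (by simp)
    (.set_seq ?_ (by simp) (.set_seq ?_ (by simp) (.set_seq ?_ (by simp) (.set_seq ?_ (by simp)
    (.set ?_ (by simp) ?_))))))))))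
  · simp [hn, hw0, ← hSG]; omega
  · simp
  · simp [hn, ← hSG, h2w]; omega
  · simp [hn, ← hSG, h3w]; omega
  · simp [hn, hw0, h4w]; omega
  · simp [hn, hw0]; omega
  · simp [hn, hw0]; omega
  · simp
  · simp
  · refine ⟨⟨⟨?_, ?_, ?_, ?_, ?_⟩, ?_, ?_⟩, ?_, ?_, ?_, ?_, rfl⟩ <;>
      simp [Function.update_apply, hn, ← hSG, enc_range]

lemma ite_or_one (A B : Prop) [Decidable A] [Decidable B] [Decidable (A ∨ B)] :
    (if B then 1 else if A then 1 else 0) = if A ∨ B then 1 else 0 := by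
  split_ifs <;> tauto

-- Before round `i` the register `x` holds the start `pos i` of the interval of leaf `i`, and `base`
-- is at most `(4 + pos i) * S`: a leaf takes one block and has an interval of length at least one.
-- This keeps all addresses within words of `O(n)` bits. At the end, `hits_leaves` is applied to
-- each pair of assignments separately.
open Classical in
lemma leaves_spec (Γ : Cfg) (hh : 1 ≤ Γ.h) {L : ℕ} {s : Store Reg} (hs : Ready Γ L s)
    {O : List (Finset ℕ)} (hm : s.reg .m = O.length) (hO : Orig Γ.k Γ.h s.mem 2 O)
    (hcl : ∀ D ∈ O, IsClause Γ.k (4 * Γ.h) D) (hOr : 2 + Γ.k * O.length ≤ Γ.S)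
    {J : ℕ} (hJ : fuel Γ.k Γ.q (4 * Γ.h) [] [] O ≤ J) (hJS : J + Γ.Y ≤ Γ.S)
    (hL : (2 ^ (L * Γ.h) + 6) * Γ.S ≤ 2 ^ Γ.w) (hpotL : maxPot Γ.k Γ.q (4 * Γ.h) ≤ L * Γ.h)
    (hx : s.reg .x = 0) (hans : s.reg .ans = 0) (hb : s.reg .base = 4 * Γ.S)
    (hzero : ∀ a, 4 * Γ.S ≤ a → s.mem a = 0)
    {d w₀ τ : ℕ} (hd : s.reg .dim = d)
    (hdim : 2 * (maxPot Γ.k Γ.q (4 * Γ.h) + 2 * Γ.h) ≤ d)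
    (hNum : maxPot Γ.k Γ.q (4 * Γ.h) + 2 * Γ.h ≤ 2 ^ Γ.h) (hsize : 3 + 2 * (2 ^ Γ.h * d) ≤ Γ.S)
    (hw₀ : 2 ^ w₀ ≤ Γ.S) {T : ℝ} {p : Program} (hTτ : T ≤ τ)
    (hp : ∀ I : TVPP (2 ^ Γ.h) d, Decides p I.encode T w₀ I.IsYes) {leaves : ℕ}
    (hleaves : (tree Γ.q Γ.σ (Finset.range (4 * Γ.h)) J [] [] O).leaves.length ≤ leaves) :
    (Cmd.loop (v .lim - v .x) (
      sparsify Γ.k Γ.q Γ.σ;; solve p;;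
      .set .base (v .base + v .S);; .set .x (v .x + v .y))).Ho Γ.w s
      ((leaves + 1) * ((J + 2) * (1100 * Γ.Y ^ 3) + (2 ^ Γ.h + 2) * (600 * Γ.Y) + 2 * τ + p.regs + 20))
      (fun t => t.reg .ans = if ∃ a < 2 ^ Γ.h, ∃ b < 2 ^ Γ.h, ∀ D ∈ O, Hits (trueLits Γ.h a b) D then 1
        else 0) := by
  have hw := Γ.word
  have hY := Γ.lits
  have hS := Γ.small
  have hw0 := Γ.w_ne_zero
  have hpl : 0 < 2 ^ (L * Γ.h) := by positivity
  set t := tree Γ.q Γ.σ (Finset.range (4 * Γ.h)) J [] [] O with ht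
  have hinv : Inv Γ.k Γ.q Γ.σ (4 * Γ.h) [] [] O := inv_init hcl
  have hdepth := depth_tree_le Γ.par Γ.k_pos J hinv
  rw [← ht] at hdepth
  obtain ⟨pos, hpos0, hposn, hpos⟩ := t.exists_enumeration (L := L * Γ.h) (by omega)
  have hvalid := leaves_valid Γ.par Γ.k_pos J hinv (by simp)
  rw [← ht] at hvalid
  have hle : ∀ i ≤ t.leaves.length, pos i ≤ 2 ^ (L * Γ.h) := by
    intro i hi
    rcases i with _ | i
    · omega
    · exact (hpos i (by omega)).2.1
  have hwL : 2 ^ (L * Γ.h) * Γ.S + 6 * Γ.S ≤ 2 ^ Γ.w := by rwa [add_mul] at hL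
  have hposw : ∀ i ≤ t.leaves.length, pos i ≤ pos i * Γ.S ∧ pos i * Γ.S ≤ 2 ^ (L * Γ.h) * Γ.S := by
    intro i hi
    exact ⟨Nat.le_mul_of_pos_right _ (by omega), Nat.mul_le_mul_right _ (hle i hi)⟩
  have hlimw : 2 ^ (L * Γ.h) ≤ 2 ^ (L * Γ.h) * Γ.S := Nat.le_mul_of_pos_right _ (by omega)
  have hkeep : ∀ r, r ∈ [Reg.h, .m, .bF, .bP, .S, .U, .N, .lim, .dim] →
      ¬ (sparsify Γ.k Γ.q Γ.σ;; solve p;; .set .base (v .base + v .S);;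
        .set .x (v .x + v .y)).Writes r := by
    intro r hr
    simp only [List.mem_cons, List.not_mem_nil, or_false] at hr
    rcases hr with rfl | rfl | rfl | rfl | rfl | rfl | rfl | rfl | rfl <;>
    simp [sparsify, popClause, readClause, process, checkReject, findFlower, countFlower, popc,
      branch, pushPetals, acceptClause, solve, addDummies, rows, entriesA, entriesB, Cmd.Writes]
  refine .count_keeps (fun i u => u.reg .x = pos i ∧ (∃ β, u.reg .base = β ∧ 4 * Γ.S ≤ β ∧
      β ≤ 4 * Γ.S + pos i * Γ.S ∧ ∀ a, β ≤ a → u.mem a = 0) ∧ (∀ a < Γ.S, u.mem a = s.mem a) ∧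
      u.reg .ans = if ∃ F ∈ t.leaves.take i, ∃ a < 2 ^ Γ.h, ∃ b < 2 ^ Γ.h,
        ∀ D ∈ F, Hits (trueLits Γ.h a b) D then 1 else 0) t.leaves.length
      ((J + 2) * (1100 * Γ.Y ^ 3) + (2 ^ Γ.h + 2) * (600 * Γ.Y) + 2 * τ + p.regs + 14) ?_ ?_ ?_ ?_ ?_
  · exact ⟨by rw [hx, hpos0], ⟨_, hb, le_rfl, by omega, hzero⟩, fun _ _ => rfl, by simp [hans]⟩
  · rintro i u hi ⟨hxu, -⟩ hk
    have e1 := hk.reg .lim (hkeep _ (by simp))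
    rw [hs.lim] at e1
    refine ⟨by simp, ?_⟩
    simp only [Expr.val_sub, Expr.val_var, e1, hxu]
    constructor
    · intro h
      by_contra hne
      have := hpos i (by omega)
      omega
    · rintro rfl
      omega
  · rintro i u hi ⟨hxu, ⟨β, hbu, hβ1, hβ2, hz⟩, hmem, hansu⟩ hk
    obtain ⟨hp1, hp2, hwalk⟩ := hpos i hi
    have hb1 := hposw i hi.le
    have hb2 := hposw (i + 1) hi
    have hstep : pos i * Γ.S + Γ.S ≤ pos (i + 1) * Γ.S := by
      calc pos i * Γ.S + Γ.S = (pos i + 1) * Γ.S := by ring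
        _ ≤ _ := Nat.mul_le_mul_right _ hp1
    have hfix : Fixed Γ u := ⟨(hk.reg _ (hkeep _ (by simp))).trans hs.h,
      (hk.reg _ (hkeep _ (by simp))).trans hs.S, (hk.reg _ (hkeep _ (by simp))).trans hs.bF,
      (hk.reg _ (hkeep _ (by simp))).trans hs.bP, (hk.reg _ (hkeep _ (by simp))).trans hs.U⟩
    have e2 := (hk.reg .m (hkeep _ (by simp))).trans hm
    have e3 := (hk.reg .lim (hkeep _ (by simp))).trans hs.lim
    have e4 := (hk.reg .N (hkeep _ (by simp))).trans hs.N
    have e5 := (hk.reg .dim (hkeep _ (by simp))).trans hd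
    refine .seq (sparsify_spec Γ hfix e2 (hO.congr hmem hOr) hcl hOr hJ hJS hxu e3 (by omega))
      (by omega) ?_
    rintro u₁ ⟨⟨F, y', hF, hy, hout, hw1⟩, hk₁⟩
    have hFy := hw1.symm.trans hwalk
    simp only [Prod.mk.injEq] at hFy
    obtain ⟨rfl, rfl⟩ := hFy
    have hreg₁ : ∀ r, r ∈ [Reg.h, .S, .N, .dim, .base, .x, .ans] → u₁.reg r = u.reg r := by
      intro r hr
      refine hk₁.reg r ?_
      simp only [List.mem_cons, List.not_mem_nil, or_false] at hr
      rcases hr with rfl | rfl | rfl | rfl | rfl | rfl | rfl <;>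
      simp [sparsify, popClause, readClause, process, checkReject, findFlower, countFlower, popc,
        branch, pushPetals, acceptClause, Cmd.Writes]
    refine .seq (solve_spec Γ hF (hvalid _ (List.getElem_mem hi)).1 hh
      ((hreg₁ _ (by simp)).trans hfix.h) ((hreg₁ _ (by simp)).trans e4)
      ((hreg₁ _ (by simp)).trans e5) ((hreg₁ _ (by simp)).trans hbu) (by omega) (by omega)
      (fun a ha => (hout a (by omega)).trans (hz a ha)) hdim hNum hsize hw₀ hTτ hp) (by omega) ?_
    rintro u₂ ⟨⟨hlow₂, hz₂, hans₂⟩, hk₂⟩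
    have hreg₂ : ∀ r, r ∈ [Reg.S, .base, .x, .y] → u₂.reg r = u₁.reg r := by
      intro r hr
      refine hk₂.reg r ?_
      simp only [List.mem_cons, List.not_mem_nil, or_false] at hr
      rcases hr with rfl | rfl | rfl | rfl <;>
      simp [solve, addDummies, rows, rowMask, entriesA, entriesB, Cmd.Writes]
    have r1 : u₂.reg .base = β := by rw [hreg₂ _ (by simp), hreg₁ _ (by simp), hbu]
    have r2 : u₂.reg .S = Γ.S := by rw [hreg₂ _ (by simp), hreg₁ _ (by simp), hfix.S]
    have r3 : u₂.reg .x = pos i := by rw [hreg₂ _ (by simp), hreg₁ _ (by simp), hxu]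
    have r4 : u₂.reg .y = pos (i + 1) - pos i := by rw [hreg₂ _ (by simp), hy]
    refine .set_seq (by simp [r1, r2]; omega) (by simp; omega) (.set (by simp [r3, r4]; omega)
      (by simp; omega) ?_)
    refine ⟨by simp [r3, r4]; omega, ⟨β + Γ.S, by simp [r1, r2], by omega, by omega, hz₂⟩,
      fun a ha => ?_, ?_⟩
    · exact (hlow₂ a ha).trans ((hout a (.inl ha)).trans (hmem a ha))
    · simp only [List.take_succ_eq_append_getElem hi, List.mem_append, List.mem_singleton,
        or_and_right, exists_or, exists_eq_left]
      simp only [ne_eq, reduceCtorEq, not_false_eq_true, Function.update_of_ne, hans₂]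
      rw [hreg₁ _ (by simp), hansu]
      exact ite_or_one _ _
  · rintro u ⟨-, -, -, hansu⟩ hk
    rw [hansu, List.take_length]
    refine if_congr ?_ rfl rfl
    have hhit : ∀ a < 2 ^ Γ.h, ∀ b < 2 ^ Γ.h, ((∃ F ∈ t.leaves, ∀ D ∈ F, Hits (trueLits Γ.h a b) D) ↔
        ∀ D ∈ O, Hits (trueLits Γ.h a b) D) := by
      intro a ha b hb'
      have hd0 : ({2 * Γ.h + 0, Γ.h, 3 * Γ.h} : Finset ℕ) ∈ dummies Γ.h Γ.h :=
        mem_dummies.2 ⟨0, by omega, .inl rfl⟩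
      have := hits_leaves Γ.par Γ.k_pos
        ((hits_dummies ha hb' hd0).mono (dummies_subset hd0)) J hinv (by simp) hJ
      rw [← ht] at this
      simpa using this
    constructor
    · rintro ⟨F, hF, a, ha, b, hb', hall⟩
      exact ⟨a, ha, b, hb', (hhit a ha b hb').1 ⟨F, hF, hall⟩⟩
    · rintro ⟨a, ha, b, hb', hall⟩
      obtain ⟨F, hF, hall'⟩ := (hhit a ha b hb').2 hall
      exact ⟨F, hF, a, ha, b, hb', hall'⟩
  · simp only [Expr.cost_sub, Expr.cost_var]
    exact Nat.mul_le_mul (by omega) (by omega)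

open Classical in
lemma main_spec (Γ : Cfg) (hh : 1 ≤ Γ.h) {h₀ G L : ℕ} {s : Store Reg} (hSG : Γ.S = 2 ^ (G * Γ.h))
    (hn : s.mem 0 / 2 + h₀ = Γ.h)
    {O : List (Finset ℕ)} (hm : s.mem 1 = O.length) (hO : Orig Γ.k Γ.h s.mem 2 O)
    (hcl : ∀ D ∈ O, IsClause Γ.k (4 * Γ.h) D) (hOr : 2 + Γ.k * O.length ≤ Γ.S)
    (hzero : ∀ a, Γ.S ≤ a → s.mem a = 0)
    {J : ℕ} (hJ : fuel Γ.k Γ.q (4 * Γ.h) [] [] O ≤ J) (hJS : J + Γ.Y ≤ Γ.S)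
    (hL : (2 ^ (L * Γ.h) + 6) * Γ.S ≤ 2 ^ Γ.w) (hpotL : maxPot Γ.k Γ.q (4 * Γ.h) ≤ L * Γ.h)
    {d w₀ τ τd : ℕ} {getDim : Cmd Reg}
    (hdim : 2 * (maxPot Γ.k Γ.q (4 * Γ.h) + 2 * Γ.h) ≤ d)
    (hNum : maxPot Γ.k Γ.q (4 * Γ.h) + 2 * Γ.h ≤ 2 ^ Γ.h) (hsize : 3 + 2 * (2 ^ Γ.h * d) ≤ Γ.S)
    (hw₀ : 2 ^ w₀ ≤ Γ.S) {T : ℝ} {p : Program} (hTτ : T ≤ τ)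
    (hp : ∀ I : TVPP (2 ^ Γ.h) d, Decides p I.encode T w₀ I.IsYes) {leaves : ℕ}
    (hleaves : (tree Γ.q Γ.σ (Finset.range (4 * Γ.h)) J [] [] O).leaves.length ≤ leaves)
    (hwrites : ∀ r, getDim.Writes r → r = .dim)
    (hgetDim : ∀ s : Store Reg, s.reg .h = Γ.h → s.reg .N = 2 ^ Γ.h → s.reg .base = 3 * Γ.S →
      (∀ a, 3 * Γ.S ≤ a → s.mem a = 0) → getDim.Ho Γ.w s τd (fun t => t.reg .dim = d ∧
        (∀ a < 3 * Γ.S, t.mem a = s.mem a) ∧ ∀ a, 4 * Γ.S ≤ a → t.mem a = 0)) :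
    (main Γ.k Γ.q Γ.σ h₀ G L getDim p).Ho Γ.w s (204 + τd + (leaves + 1) * ((J + 2) * (1100 * Γ.Y ^ 3) +
        (2 ^ Γ.h + 2) * (600 * Γ.Y) + 2 * τ + p.regs + 20))
      (fun t => t.reg .ans = if ∃ a < 2 ^ Γ.h, ∃ b < 2 ^ Γ.h, ∀ D ∈ O, Hits (trueLits Γ.h a b) D then 1
        else 0) := by
  have hw := Γ.word
  have hS := Γ.small
  have hY := Γ.lits
  have hL' : 2 ^ (L * Γ.h) + 6 ≤ (2 ^ (L * Γ.h) + 6) * Γ.S := Nat.le_mul_of_pos_right _ (by omega)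
  unfold main
  refine .seq (setup_spec Γ hh hSG hn (by omega)) (by omega) ?_
  rintro t ⟨ht, hmt, hbt, hxt, hanst, hmemt⟩
  refine .seq (hgetDim t ht.h ht.N hbt fun a ha => by rw [hmemt, hzero a (by omega)]).keeps
    (by omega) ?_
  rintro u ⟨⟨hdu, hlow, hz⟩, hk⟩
  have hk' : ∀ r, r ≠ .dim → u.reg r = t.reg r := fun r hr => hk.reg r fun h => hr (hwrites r h)
  refine .set_seq (by simp [hk', hbt, ht.S]; omega) (by simp; omega) ?_
  refine (leaves_spec Γ hh (L := L) (O := O) (J := J) (d := d)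
    ⟨⟨?_, ?_, ?_, ?_, ?_⟩, ?_, ?_⟩ ?_ ?_ hcl hOr hJ hJS hL hpotL ?_ ?_ ?_ ?_ ?_ hdim hNum
    hsize hw₀ hTτ hp hleaves).conseq ?_ fun _ h => h
  · simp [hk', ht.h]
  · simp [hk', ht.S]
  · simp [hk', ht.bF]
  · simp [hk', ht.bP]
  · simp [hk', ht.U]
  · simp [hk', ht.N]
  · simp [hk', ht.lim]
  · simp [hk', hmt, hm]
  · exact hO.congr (fun a ha => by rw [hlow a (by omega), hmemt]) hOr
  · simp [hk', hxt]
  · simp [hk', hanst]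
  · simp [hk', hbt, ht.S]; omega
  · exact hz
  · simp [hk', hdu]
  · simp only [Expr.cost_add, Expr.cost_var]
    omega


/-! ### Formulas -/

/-- A clause as a set of literals. -/
def litSet {k n : ℕ} (h : ℕ) (c : KClause k n) : Finset ℕ :=
  Finset.univ.image fun i => ((c i).1 : ℕ) + (c i).2.toNat * (2 * h)

/-- The input words of a clause. -/
def clauseWords {k n : ℕ} (c : KClause k n) : List ℕ :=
  List.ofFn fun i => 2 * ((c i).1 : ℕ) + (c i).2.toNat

lemma litOf_word (h x : ℕ) (b : Bool) : litOf h (2 * x + b.toNat) = x + b.toNat * (2 * h) := by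
  cases b
  · simp [litOf]
  · simp only [litOf, Bool.toNat_true]
    rw [show (2 * x + 1) / 2 = x by omega, show (2 * x + 1) % 2 = 1 by omega]

lemma orig_of_words {k n h : ℕ} {m : ℕ → ℕ} : ∀ (cs : List (KClause k n)) (a : ℕ),
    (∀ i, m (a + i) = (cs.flatMap clauseWords).getD i 0) → Orig k h m a (cs.map (litSet h))
  | [], _, _ => trivial
  | c :: cs, a, hm => by
    have hl : (clauseWords c).length = k := by simp [clauseWords]
    simp only [List.flatMap_cons] at hm
    refine ⟨?_, orig_of_words cs (a + k) fun i => ?_⟩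
    · ext x
      simp only [litSet, Finset.mem_image, Finset.mem_univ, true_and, Finset.mem_range]
      have key : ∀ i : Fin k, litOf h (m (a + i)) = ((c i).1 : ℕ) + (c i).2.toNat * (2 * h) := by
        intro i
        rw [hm, List.getD_append _ _ _ _ (by rw [hl]; exact i.2),
          List.getD_eq_getElem _ _ (by rw [hl]; exact i.2)]
        simp only [clauseWords, List.getElem_ofFn]
        exact litOf_word _ _ _
      constructor
      · rintro ⟨i, rfl⟩
        exact ⟨i, i.2, key i⟩
      · rintro ⟨j, hj, rfl⟩
        exact ⟨⟨j, hj⟩, (key ⟨j, hj⟩).symm⟩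
    · rw [add_assoc, hm, List.getD_append_right _ _ _ _ (by omega), hl, Nat.add_sub_cancel_left]

lemma isClause_litSet {k n h : ℕ} (hk : 1 ≤ k) (hn : n ≤ 2 * h) (c : KClause k n) :
    IsClause k (4 * h) (litSet h c) := by
  refine ⟨?_, ?_, ?_⟩
  · exact (Finset.univ_nonempty_iff.2 ⟨⟨0, hk⟩⟩).image _
  · intro x hx
    simp only [litSet, Finset.mem_image, Finset.mem_univ, true_and] at hx
    obtain ⟨i, rfl⟩ := hx
    have := (c i).1.2
    rw [Finset.mem_range]
    cases (c i).2 <;> simp <;> omega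
  · exact Finset.card_image_le.trans (by simp)

lemma mem_trueLits {h a b x : ℕ} (ha : a < 2 ^ h) (hb : b < 2 ^ h) (hx : x < 2 * h) (β : Bool) :
    x + β.toNat * (2 * h) ∈ trueLits h a b ↔
      (if x < h then a.testBit x else b.testBit (x - h)) = β := by
  simp only [trueLits, Set.mem_ofPred_eq, testBit_maskA ha, testBit_maskB hb]
  cases β
  · by_cases h1 : x < h
    · simp [h1, show ¬ h ≤ x by omega]
    · simp [h1, show h ≤ x by omega, hx, show ¬ 2 * h ≤ x by omega]
  · have hn : ¬ x + 2 * h < h := by omega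
    have hn2 : ¬ x + 2 * h < 2 * h := by omega
    by_cases h1 : x < h
    · simp [h1, hn, show h ≤ x + 2 * h by omega, show ¬ 3 * h ≤ x + 2 * h by omega]
    · have : a.testBit x = false := Nat.testBit_lt_two_pow (ha.trans_le
        (Nat.pow_le_pow_right (by norm_num) (not_lt.1 h1)))
      simp [h1, hn, show h ≤ x + 2 * h by omega, show 3 * h ≤ x + 2 * h by omega, this,
        show x + 2 * h - 3 * h = x - h by omega]

lemma hits_litSet {k n h a b : ℕ} (hn : n ≤ 2 * h) (ha : a < 2 ^ h) (hb : b < 2 ^ h)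
    (c : KClause k n) : Hits (trueLits h a b) (litSet h c) ↔
      ∃ i, (if ((c i).1 : ℕ) < h then a.testBit (c i).1 else b.testBit ((c i).1 - h)) = (c i).2 := by
  simp only [Hits, litSet, Finset.mem_image, Finset.mem_univ, true_and, exists_exists_eq_and]
  refine exists_congr fun i => ?_
  rw [mem_trueLits ha hb ((c i).1.2.trans_le hn)]

lemma exists_testBit (h : ℕ) (f : ℕ → Bool) : ∃ a < 2 ^ h, ∀ i < h, a.testBit i = f i := by
  refine ⟨enc ((Finset.range h).filter fun i => f i = true), enc_lt (Finset.filter_subset _ _),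
    fun i hi => ?_⟩
  rw [testBit_enc]
  simp [hi]

/-- An assignment is cut at the variable `h`. The padding variables from `n` to `2h` occur in no
clause and may be given any value. -/
lemma satisfiable_iff {k n h : ℕ} (hn : n ≤ 2 * h) (φ : KCNF k n) : φ.Satisfiable ↔
    ∃ a < 2 ^ h, ∃ b < 2 ^ h, ∀ D ∈ φ.clauses.map (litSet h), Hits (trueLits h a b) D := by
  simp only [List.forall_mem_map]
  constructor
  · rintro ⟨τ, hτ⟩
    let f : ℕ → Bool := fun x => if hx : x < n then τ ⟨x, hx⟩ else false
    obtain ⟨a, ha, hfa⟩ := exists_testBit h f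
    obtain ⟨b, hb, hfb⟩ := exists_testBit h fun i => f (h + i)
    refine ⟨a, ha, b, hb, fun c hc => (hits_litSet hn ha hb c).2 ?_⟩
    obtain ⟨i, hi⟩ := hτ c hc
    refine ⟨i, ?_⟩
    have hx := (c i).1.2
    have hf : f (c i).1 = (c i).2 := by simp [f, hi]
    split_ifs with h1
    · rw [hfa _ h1, hf]
    · rw [hfb _ (by omega), Nat.add_sub_cancel' (not_lt.1 h1), hf]
  · rintro ⟨a, ha, b, hb, hab⟩
    exact ⟨fun x => if (x : ℕ) < h then a.testBit x else b.testBit (x - h),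
      fun c hc => (hits_litSet hn ha hb c).1 (hab c hc)⟩

/-- This is where pairwise difference of the clauses matters: it makes the input, and thereby the
fuel, polynomial in `n`. -/
lemma length_clauses_le {k n : ℕ} (φ : KCNF k n) : φ.clauses.length ≤ (2 * n) ^ k := by
  classical
  rw [← List.toFinset_card_of_nodup φ.nodup]
  refine (Finset.card_le_univ _).trans (le_of_eq ?_)
  simp [mul_comm]

lemma encode_eq {k n : ℕ} (φ : KCNF k n) :
    φ.encode = [n, φ.clauses.length] ++ φ.clauses.flatMap clauseWords := rfl

lemma length_encode {k n : ℕ} (φ : KCNF k n) : φ.encode.length = 2 + k * φ.clauses.length := by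
  rw [encode_eq, List.length_append, List.length_flatMap]
  simp [clauseWords, mul_comm]

lemma mem_encode_le {k n : ℕ} (φ : KCNF k n) {x : ℕ} (hx : x ∈ φ.encode) :
    x ≤ 2 * n + 1 + φ.clauses.length := by
  rw [encode_eq] at hx
  simp only [List.cons_append, List.nil_append, List.mem_cons, List.mem_flatMap, clauseWords,
    List.mem_ofFn] at hx
  rcases hx with rfl | rfl | ⟨c, -, i, rfl⟩
  · omega
  · omega
  · have := (c i).1.2
    have := Bool.toNat_le (c i).2
    omega

/-- The numbers of the registers. -/
lemma ctorIdx_injective : Function.Injective Reg.ctorIdx := by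
  intro a b h
  cases a <;> cases b <;> first | rfl | exact absurd h (by decide)

lemma ctorIdx_lt (r : Reg) : r.ctorIdx < 40 := by cases r <;> decide

/-- The reduction: a program for the TVPP instances with `2 ^ h` vectors of dimension `d` gives a
program for `k`-SAT. -/
lemma exists_decides (k q σ h₀ G L : ℕ) (getDim : Cmd Reg)
    (hwrites : ∀ r, getDim.Writes r → r = .dim) (p : Program) : ∃ P : Program,
    ∀ (n : ℕ) (φ : KCNF k n) (h w Y J d w₀ τ τd leaves : ℕ) (T T' : ℝ), h = n / 2 + h₀ → 1 ≤ h →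
      n ≤ 2 * h → Par k q σ (4 * h) → 1 ≤ k → 2 ^ (4 * h) ≤ 2 ^ (G * h) → 2 ^ (q * k) ≤ 2 ^ (G * h) →
      64 * 2 ^ (G * h) ≤ 2 ^ w → 4 * h + 2 ≤ Y → maxPot k q (4 * h) + 2 * h + 2 ≤ Y → 2 ^ k ≤ Y →
      Y ≤ 2 ^ (G * h) → 2 + k * (2 * n) ^ k ≤ 2 ^ (G * h) →
      (2 * n) ^ k + maxPot k q (4 * h) * (maxPot k q (4 * h) + 2) ≤ J → J + Y ≤ 2 ^ (G * h) →
      (2 ^ (L * h) + 6) * 2 ^ (G * h) ≤ 2 ^ w → maxPot k q (4 * h) ≤ L * h →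
      2 * (maxPot k q (4 * h) + 2 * h) ≤ d → maxPot k q (4 * h) + 2 * h ≤ 2 ^ h →
      3 + 2 * (2 ^ h * d) ≤ 2 ^ (G * h) → 2 ^ w₀ ≤ 2 ^ (G * h) → T ≤ τ →
      (∀ I : TVPP (2 ^ h) d, Decides p I.encode T w₀ I.IsYes) →
      (∀ n O, (∀ D ∈ O, IsClause k (4 * h) D) →
        (tree q σ (Finset.range (4 * h)) n [] [] O).leaves.length ≤ leaves) →
      (∀ s : Store Reg, s.reg .h = h → s.reg .N = 2 ^ h → s.reg .base = 3 * 2 ^ (G * h) →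
        (∀ a, 3 * 2 ^ (G * h) ≤ a → s.mem a = 0) → getDim.Ho w s τd (fun t => t.reg .dim = d ∧
          (∀ a < 3 * 2 ^ (G * h), t.mem a = s.mem a) ∧ ∀ a, 4 * 2 ^ (G * h) ≤ a → t.mem a = 0)) →
      ((204 + τd + (leaves + 1) * ((J + 2) * (1100 * Y ^ 3) +
        (2 ^ h + 2) * (600 * Y) + 2 * τ + p.regs + 20) : ℕ) : ℝ) ≤ T' →
      Decides P φ.encode T' w φ.Satisfiable := by
  -- `ans` is the first constructor, so it is kept in register `0`, the output register.
  obtain ⟨P, hP⟩ := Cmd.exists_outputs (r₀ := Reg.ans) ctorIdx_injective ctorIdx_lt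
    (main k q σ h₀ G L getDim p) rfl
  refine ⟨P, fun n φ h w Y J d w₀ τ τd leaves T T' hh h1 hn hpar hk hmask hthr hword hlits hpot hsubs
    hsmall hsize₀ hJ hJS hL hpotL hdim hNum hsize hw₀ hT hp hleaves hget hT' => ?_⟩
  let Γ : Cfg := ⟨k, q, σ, h, 2 ^ (G * h), w, Y, hpar, hk, hmask, hthr, hword, hlits, hpot, hsubs, hsmall⟩
  set O := φ.clauses.map (litSet h) with hO
  have hOl : O.length = φ.clauses.length := by simp [hO]
  have hcl : ∀ D ∈ O, IsClause k (4 * h) D := by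
    intro D hD
    obtain ⟨c, -, rfl⟩ := List.mem_map.1 hD
    exact isClause_litSet hk hn c
  have hlen := length_clauses_le φ
  have hlen' : k * φ.clauses.length ≤ k * (2 * n) ^ k := Nat.mul_le_mul_left _ hlen
  let s : Store Reg := ⟨fun _ => 0, fun a => φ.encode.getD a 0⟩
  have hmain := main_spec Γ h1 (h₀ := h₀) (G := G) (L := L) (s := s) rfl
    (show n / 2 + h₀ = h from hh.symm) (O := O) (by rw [hOl]; rfl)
    (orig_of_words φ.clauses 2 fun i => by
      show φ.encode.getD (2 + i) 0 = _
      rw [encode_eq, List.getD_append_right _ _ _ _ (by simp)]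
      simp) hcl
    (show 2 + k * O.length ≤ _ by rw [hOl]; show _ ≤ 2 ^ (G * h); omega)
    (fun a ha => List.getD_eq_default _ _ (by
      rw [length_encode]; change 2 ^ (G * h) ≤ a at ha; omega))
    (J := J) (by
      show fuel k q (4 * h) [] [] O ≤ J
      refine le_trans ?_ hJ
      unfold fuel
      rw [List.length_nil, zero_add, hOl]
      exact add_le_add hlen (Nat.mul_le_mul_right _ (Nat.sub_le _ _)))
    hJS hL hpotL hdim hNum hsize hw₀ hT hp (hleaves J O hcl) hwrites hget
  obtain ⟨t, ht, s', hexec, hans⟩ := hmain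
  have hx : ∀ x ∈ φ.encode, x < 2 ^ w := by
    intro x hx
    have h2 := mem_encode_le φ hx
    have h3 : φ.clauses.length ≤ J := hlen.trans ((Nat.le_add_right _ _).trans hJ)
    omega
  have hout := hP φ.encode w t T' s' hx hexec (le_trans (by exact_mod_cast ht) hT')
  rw [hans] at hout
  have hsat := satisfiable_iff hn φ
  refine ⟨fun h => ?_, fun h => ?_⟩
  · rw [if_pos (hsat.1 h)] at hout
    exact hout
  · rw [if_neg (fun h' => h (hsat.2 h'))] at hout
    exact hout


/-! ### Choice of the parameters -/

/-- Put `u = 2^q` and `ρ = 1 + x` with `x = κ / u^(k-1)`; then `ρ^(24 u^(k-1)) ≤ e^(24 κ) = 2^η`.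
The recursion for the leaves asks for `x * ρ^b ≥ 1`, where `b + 1 = u^k / 2^(σ+1)`. Bernoulli's
inequality on each of `k` blocks of length `b / k` yields `ρ^b ≥ (c u)^k`, so that `x * ρ^b ≥ κ c^k
u`, which is at least `1` for large `q`. The `k`-th power is needed against the factor `u^(k-1)` in
`1 / x`. As `σ` depends on `k` only, it is fixed before `q`. -/
lemma exists_params {k : ℕ} (hk : 1 ≤ k) {η : ℝ} (hη : 0 < η) : ∃ (q σ b : ℕ) (ρ : ℝ),
    σ + 1 ≤ q ∧ 8 * k ≤ 2 ^ σ ∧ 1 ≤ ρ ∧ b + 1 = 2 ^ (q * k - σ - 1) ∧ ρ ^ b + 1 ≤ ρ ^ (b + 1) ∧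
      ρ ^ (24 * 2 ^ (q * (k - 1))) ≤ (2 : ℝ) ^ η := by
  obtain ⟨σ, hσ⟩ : ∃ σ, 8 * k ≤ 2 ^ σ :=
    ⟨8 * k, Nat.lt_two_pow_self.le⟩
  set κ : ℝ := η * Real.log 2 / 24 with hκ
  have hκ0 : 0 < κ := by
    have := Real.log_pos (show (1 : ℝ) < 2 by norm_num)
    positivity
  have hk0 : (0 : ℝ) < k := by exact_mod_cast hk
  set M : ℝ := 2 ^ (σ + 1) with hM
  have hM0 : 0 < M := by positivity
  set c : ℝ := κ / (4 * M * k) with hc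
  have hc0 : 0 < c := by positivity
  -- The first bound gives `z ≥ 1`, which compensates for rounding in `b / k`; the second is the
  -- final inequality.
  obtain ⟨q₀, hq₀⟩ := pow_unbounded_of_one_lt (max (4 * M * k) (1 / (κ * c ^ k)))
    (show (1 : ℝ) < 2 by norm_num)
  set q := q₀ + (σ + 1) with hq
  have hqu : (2 : ℝ) ^ q₀ ≤ 2 ^ q := pow_le_pow_right₀ (by norm_num) (by omega)
  set u : ℝ := 2 ^ q with hu
  have hu1 : 4 * M * k ≤ u := ((le_max_left _ _).trans hq₀.le).trans hqu
  have hu2 : 1 ≤ κ * c ^ k * u := by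
    have := ((le_max_right _ _).trans hq₀.le).trans hqu
    rw [div_le_iff₀ (by positivity)] at this
    linarith
  have hu0 : 1 ≤ u := one_le_pow₀ (by norm_num)
  have hqk : q * 1 ≤ q * k := Nat.mul_le_mul_left _ hk
  obtain ⟨b, hb⟩ : ∃ b, b + 1 = 2 ^ (q * k - σ - 1) :=
    ⟨2 ^ (q * k - σ - 1) - 1, Nat.sub_add_cancel Nat.one_le_two_pow⟩
  set x : ℝ := κ / u ^ (k - 1) with hx
  have hx0 : 0 < x := by positivity
  have hbM : ((b : ℝ) + 1) * M = u ^ k := by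
    have h1 : ((b : ℝ) + 1) = 2 ^ (q * k - σ - 1) := by exact_mod_cast hb
    rw [h1, hM, hu, ← pow_add, ← pow_mul]
    congr 1
    omega
  have huk : u ^ k = u ^ (k - 1) * u := by
    rw [← pow_succ]; congr 1; omega
  have huu : u ≤ u ^ k := le_self_pow₀ hu0 (by omega)
  set z : ℝ := u ^ k / (4 * M * k) with hz
  have hz1 : 1 ≤ z := by
    rw [hz, le_div_iff₀ (by positivity), one_mul]
    exact hu1.trans huu
  have hbz : z ≤ ((b / k : ℕ) : ℝ) := by
    have h1 : b + 1 ≤ k * (b / k + 1) := by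
      have := Nat.lt_mul_div_succ b (show 0 < k by omega)
      omega
    have h2 : (b : ℝ) + 1 ≤ k * (((b / k : ℕ) : ℝ) + 1) := by exact_mod_cast h1
    have h3 : 4 * z * k * M = u ^ k := by
      rw [hz]; field_simp
    have h4 : 4 * z * k * M ≤ k * (((b / k : ℕ) : ℝ) + 1) * M := by
      rw [h3, ← hbM]
      exact mul_le_mul_of_nonneg_right h2 hM0.le
    have h5 : 4 * z * k ≤ k * (((b / k : ℕ) : ℝ) + 1) := le_of_mul_le_mul_right h4 hM0
    have h6 : k * (4 * z) ≤ k * (((b / k : ℕ) : ℝ) + 1) := by linarith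
    have h7 := le_of_mul_le_mul_left h6 hk0
    linarith
  have hzx : z * x = c * u := by
    rw [hz, hx, hc, huk]
    field_simp
  have hpow : 1 ≤ (1 + x) ^ b * x := by
    have h1 : (c * u) ^ k ≤ (1 + x) ^ b := by
      calc (c * u) ^ k = (z * x) ^ k := by rw [hzx]
        _ ≤ ((1 + x) ^ (b / k)) ^ k := by
            gcongr
            have h2 := one_add_mul_le_pow (show (-2 : ℝ) ≤ x by linarith) (b / k)
            have h3 : z * x ≤ ((b / k : ℕ) : ℝ) * x := mul_le_mul_of_nonneg_right hbz hx0.le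
            linarith
        _ = (1 + x) ^ (b / k * k) := by rw [pow_mul]
        _ ≤ (1 + x) ^ b := pow_le_pow_right₀ (by linarith) (Nat.div_mul_le_self b k)
    calc 1 ≤ κ * c ^ k * u := hu2
      _ = (c * u) ^ k * x := by
          rw [hx, mul_pow, huk]
          field_simp
      _ ≤ _ := mul_le_mul_of_nonneg_right h1 hx0.le
  refine ⟨q, σ, b, 1 + x, by omega, hσ, by linarith, hb, ?_, ?_⟩
  · rw [pow_succ]
    linarith
  · have h1 : (1 + x) ^ (24 * 2 ^ (q * (k - 1))) ≤ Real.exp x ^ (24 * 2 ^ (q * (k - 1))) := by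
      gcongr
      rw [add_comm]
      exact Real.add_one_le_exp x
    refine h1.trans (le_of_eq ?_)
    rw [← Real.exp_nat_mul, Real.rpow_def_of_pos (by norm_num)]
    congr 1
    push_cast
    rw [pow_mul, ← hu, hx, hκ]
    field_simp

lemma exists_pow_le (m : ℕ) {η : ℝ} (hη : 0 < η) :
    ∃ D : ℝ, 0 < D ∧ ∀ h : ℕ, (h : ℝ) ^ m ≤ D * (2 : ℝ) ^ (η * h) := by
  have h1 : (1 : ℝ) < 2 ^ η := Real.one_lt_rpow (by norm_num) hη
  obtain ⟨D, hD, hb⟩ := Asymptotics.bound_of_isBigO_nat_atTop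
    (isLittleO_pow_const_const_pow_of_one_lt (R := ℝ) m h1).isBigO
  refine ⟨D, hD, fun h => ?_⟩
  have h2 : (0 : ℝ) < (2 ^ η) ^ h := by positivity
  have := hb h2.ne'
  rw [Real.norm_of_nonneg (by positivity), Real.norm_of_nonneg h2.le] at this
  rwa [Real.rpow_mul (by norm_num), Real.rpow_natCast]

lemma mul_pow_le_two_pow (c m h : ℕ) (hh : 1 ≤ h) : c * h ^ m ≤ 2 ^ ((c + m) * h) := by
  calc c * h ^ m ≤ 2 ^ c * (2 ^ h) ^ m :=
        Nat.mul_le_mul Nat.lt_two_pow_self.le (Nat.pow_le_pow_left Nat.lt_two_pow_self.le _)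
    _ = 2 ^ (c + h * m) := by rw [← pow_mul, ← pow_add]
    _ ≤ _ := Nat.pow_le_pow_right (by norm_num) (by
        have : c * 1 ≤ c * h := Nat.mul_le_mul_left _ hh
        rw [add_mul, mul_comm h m]; omega)

lemma length_leaves_floor {k q σ b h : ℕ} (hk : 1 ≤ k) (hp : Par k q σ (4 * h)) {ρ η : ℝ} (h1 : 1 ≤ ρ)
    (hb : b + 1 = 2 ^ (q * k - σ - 1)) (hρ : ρ ^ b + 1 ≤ ρ ^ (b + 1))
    (hη : ρ ^ (24 * 2 ^ (q * (k - 1))) ≤ (2 : ℝ) ^ η) (n : ℕ) (O : List (Finset ℕ))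
    (hO : ∀ D ∈ O, IsClause k (4 * h) D) :
    (tree q σ (Finset.range (4 * h)) n [] [] O).leaves.length ≤ ⌊(2 : ℝ) ^ (η * h)⌋₊ := by
  refine Nat.le_floor ((length_leaves_le hp hk h1 hb hρ n (inv_init hO)).trans ?_)
  calc _ ≤ ρ ^ maxPot k q (4 * h) := pow_le_pow_right₀ h1 (Nat.sub_le _ _)
    _ = (ρ ^ (24 * 2 ^ (q * (k - 1)))) ^ h := by
        rw [← pow_mul, maxPot]; congr 1; ring
    _ ≤ ((2 : ℝ) ^ η) ^ h := by gcongr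
    _ = _ := by rw [Real.rpow_mul (by norm_num), Real.rpow_natCast]


/-- The running time for the parameter `h` in terms of the number of vectors. -/
lemma time_le {h m leaves J Y τ τd r : ℕ} {X Z H c₁ B C Cd : ℝ} (hh : 1 ≤ h) (hm : 4 ≤ m)
    (hX : ((2 ^ h : ℕ) : ℝ) ≤ X) (hZ : 1 ≤ Z) (hH : (h : ℝ) ^ m ≤ H * Z) (hl : (leaves : ℝ) ≤ Z)
    (hY : (Y : ℝ) = B * h) (hJ : (J : ℝ) = c₁ * h ^ (m - 3)) (hB : 0 ≤ B) (hc : 0 ≤ c₁)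
    (hτ : (τ : ℝ) ≤ C * X) (hC : 0 ≤ C) (hτd : (τd : ℝ) ≤ Cd * X) (hCd : 0 ≤ Cd) :
    ((204 + τd + (leaves + 1) * ((J + 2) * (1100 * Y ^ 3) +
        (2 ^ h + 2) * (600 * Y) + 2 * τ + r + 20) : ℕ) : ℝ) ≤
      (204 + Cd + 2 * (((c₁ + 2) * (1100 * B ^ 3) + 1800 * B + 2 * C + r + 20) * H)) * (X * Z ^ 2) := by
  have hh' : (1 : ℝ) ≤ h := by exact_mod_cast hh
  have hX1 : 1 ≤ X := le_trans (by exact_mod_cast Nat.one_le_two_pow) hX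
  have hm1 : (1 : ℝ) ≤ (h : ℝ) ^ m := one_le_pow₀ hh'
  have hmh : (h : ℝ) ≤ (h : ℝ) ^ m := le_self_pow₀ hh' (by omega)
  have hm3 : (1 : ℝ) ≤ (h : ℝ) ^ (m - 3) := one_le_pow₀ hh'
  have e1 : ((J : ℝ) + 2) * (1100 * (Y : ℝ) ^ 3) ≤ (c₁ + 2) * (1100 * B ^ 3) * (X * h ^ m) := by
    rw [hJ, hY]
    have h1 : c₁ * (h : ℝ) ^ (m - 3) + 2 ≤ (c₁ + 2) * (h : ℝ) ^ (m - 3) := by nlinarith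
    have h2 : (h : ℝ) ^ m = h ^ (m - 3) * h ^ 3 := by rw [← pow_add]; congr 1; omega
    calc _ ≤ (c₁ + 2) * (h : ℝ) ^ (m - 3) * (1100 * (B * h) ^ 3) :=
          mul_le_mul_of_nonneg_right h1 (by positivity)
      _ = (c₁ + 2) * (1100 * B ^ 3) * (1 * h ^ m) := by rw [h2]; ring
      _ ≤ _ := by gcongr
  have e2 : ((2 : ℝ) ^ h + 2) * (600 * (Y : ℝ)) ≤ 1800 * B * (X * h ^ m) := by
    push_cast at hX
    rw [hY]
    calc ((2 : ℝ) ^ h + 2) * (600 * (B * h)) ≤ (X + 2 * X) * (600 * (B * h ^ m)) := by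
          gcongr; linarith
      _ = _ := by ring
  have hXm : X ≤ X * h ^ m := le_mul_of_one_le_right (by linarith) hm1
  have e3 : (τ : ℝ) ≤ C * (X * h ^ m) := hτ.trans (by gcongr)
  have e4 : (r : ℝ) + 20 ≤ (r + 20) * (X * h ^ m) :=
    le_mul_of_one_le_right (by positivity) (hX1.trans hXm)
  have hZ2 : 1 ≤ Z ^ 2 := one_le_pow₀ hZ
  have hXZ : X ≤ X * Z ^ 2 := le_mul_of_one_le_right (by linarith) hZ2
  set D := (c₁ + 2) * (1100 * B ^ 3) + 1800 * B + 2 * C + r + 20 with hD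
  have hD0 : 0 ≤ D := by positivity
  have e5 : ((J : ℝ) + 2) * (1100 * (Y : ℝ) ^ 3) + ((2 : ℝ) ^ h + 2) * (600 * Y) + 2 * τ + r + 20 ≤
      D * (X * (H * Z)) := by
    calc _ ≤ D * (X * h ^ m) := by rw [hD]; linarith
      _ ≤ _ := by gcongr
  have e6 : ((leaves : ℝ) + 1) * (((J : ℝ) + 2) * (1100 * (Y : ℝ) ^ 3) + ((2 : ℝ) ^ h + 2) * (600 * Y) +
      2 * τ + r + 20) ≤ (2 * Z) * (D * (X * (H * Z))) :=
    mul_le_mul (by linarith) e5 (by positivity) (by linarith)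
  push_cast
  have e7 : (τd : ℝ) ≤ Cd * (X * Z ^ 2) := hτd.trans (by gcongr)
  have e8 : (2 * Z) * (D * (X * (H * Z))) = 2 * (D * H) * (X * Z ^ 2) := by ring
  linarith

lemma exists_ge (a b c d e : ℕ) : ∃ G, a ≤ G ∧ b ≤ G ∧ c ≤ G ∧ d ≤ G ∧ e ≤ G :=
  ⟨a + b + c + d + e, by omega, by omega, by omega, by omega, by omega⟩

set_option maxHeartbeats 1000000 in
/-- A fast program for TVPP with `2 ^ h` vectors gives a fast program for `k`-SAT. -/
theorem ksatInTime_of_solver {k : ℕ} (hk : 1 ≤ k) {ε : ℝ} (hε : 0 < ε) (hε1 : ε ≤ 1) :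
    ∃ K : ℕ, ∀ (p : Program) (c : ℕ) (C : ℝ) (d : ℕ → ℕ) (E : ℕ) (getDim : Cmd Reg) (Cd : ℝ)
      (τd : ℕ → ℕ), (∀ᶠ h in atTop, K * h ≤ d h ∧ d h ≤ 2 ^ (E * h)) →
      (∀ᶠ h in atTop, ∀ I : TVPP (2 ^ h) (d h), Decides p I.encode (C * ((2 ^ h : ℕ) : ℝ) ^ (2 - ε))
        (c * (Nat.log 2 (2 ^ h * d h) + 1)) I.IsYes) →
      (∀ r, getDim.Writes r → r = .dim) →
      (∀ᶠ h in atTop, ∀ S w, 2 ^ (E * h) ≤ S → 64 * S ≤ 2 ^ w → d h < 2 ^ w →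
        ∀ s : Store Reg, s.reg .h = h → s.reg .N = 2 ^ h → s.reg .base = 3 * S →
          (∀ a, 3 * S ≤ a → s.mem a = 0) → getDim.Ho w s (τd h) (fun t => t.reg .dim = d h ∧
            (∀ a < 3 * S, t.mem a = s.mem a) ∧ ∀ a, 4 * S ≤ a → t.mem a = 0)) →
      (∀ᶠ h in atTop, (τd h : ℝ) ≤ Cd * ((2 ^ h : ℕ) : ℝ) ^ (2 - ε)) →
      KSATInTime k (fun n => (2 : ℝ) ^ ((1 - ε / 4) * (n : ℝ))) := by
  have hη : 0 < ε / 4 := by positivity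
  obtain ⟨q, σ, b, ρ, hσq, hσ, hρ1, hb, hρ, hρη⟩ := exists_params hk hη
  -- The factor is `6 * 4`, as there are `4 * h` literals.
  set A := 24 * 2 ^ (q * (k - 1)) with hA
  have hpotA : ∀ h, maxPot k q (4 * h) = A * h := fun h => by rw [maxPot, hA]; ring
  -- A leaf has at most `A * h` clauses and gets `2 * h` dummies, with two columns for each. The
  -- constant depends on `k` and `ε` only, so the dimension may be chosen after it.
  refine ⟨2 * (A + 2), fun p c C d E getDim Cd τd hd hp hwrites hget hτd => ?_⟩
  set B := A + 6 + 2 ^ k with hB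
  set cJ := 4 ^ k + A * (A + 2) with hcJ
  -- The block length `2 ^ (G * h)` has to dominate the clause masks, the thresholds, the words of
  -- the solver, the size of the instance, and the polynomial bounds.
  obtain ⟨G, hG1, hG2, hG3, hG4, hG5⟩ := exists_ge 4 (q * k) (c * (E + 2)) (E + 4)
    (2 + k * 4 ^ k + cJ + B + (k + 2))
  -- What holds eventually holds from `h₀` on. Taking `h = n / 2 + h₀` pads the formula with unused
  -- variables, at the cost of a constant factor in the time.
  obtain ⟨h₀, hh₀⟩ := eventually_atTop.1 ((((((hd.and hp).and hget).and hτd).and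
    (eventually_gt_atTop k)).and (eventually_ge_atTop 1)).and
    (show ∀ᶠ h in atTop, (A + 2) * h ≤ 2 ^ h from by
      have := (tendsto_pow_const_div_const_pow_of_one_lt 1 (show (1 : ℝ) < 2 by norm_num)).eventually_le_const
        (show (0 : ℝ) < 1 / (A + 2) by positivity)
      filter_upwards [this] with h hh
      rw [pow_one, div_le_div_iff₀ (by positivity) (by positivity)] at hh
      have h2 : ((A : ℝ) + 2) * h ≤ 2 ^ h := by linarith
      exact_mod_cast h2))
  -- The intervals live in `[0, 2 ^ (A * h))`, because the depth of the tree is at most `A * h`.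
  obtain ⟨P, hP⟩ := exists_decides k q σ h₀ G A getDim hwrites p
  obtain ⟨H, hH0, hH⟩ := exists_pow_le (k + 5) hη
  set CT : ℝ := 204 + |Cd| + 2 * ((((cJ : ℝ) + 2) * (1100 * (B : ℝ) ^ 3) + 1800 * B + 2 * (|C| + 1) +
    p.regs + 20) * H) with hCT
  have hCT0 : 0 ≤ CT := by positivity
  refine ⟨P, (A + G) * (h₀ + 1) + 6, CT * (2 : ℝ) ^ ((2 - ε / 2) * h₀), fun n φ => ?_⟩
  set h := n / 2 + h₀ with hh
  obtain ⟨⟨⟨⟨⟨⟨⟨hKd, hdE⟩, hp⟩, hget⟩, hτd⟩, hkh⟩, hh1⟩, hA2⟩ := hh₀ h (by omega)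
  have hh₀1 := (hh₀ h₀ le_rfl).1.2
  have hn2 : n ≤ 2 * h := by omega
  set w := ((A + G) * (h₀ + 1) + 6) * (n + 1) with hw
  have hwh : (A + G) * h + 6 ≤ w := by
    have h1 : h ≤ (h₀ + 1) * (n + 1) := by
      rw [add_mul, mul_add]
      omega
    have h2 := Nat.mul_le_mul_left (A + G) h1
    calc (A + G) * h + 6 ≤ (A + G) * ((h₀ + 1) * (n + 1)) + 6 * (n + 1) := by omega
      _ = w := by rw [hw]; ring
  have hpow : ∀ e, e ≤ G * h → 2 ^ e ≤ 2 ^ (G * h) := fun e he =>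
    Nat.pow_le_pow_right (by norm_num) he
  have hGE : ∀ e, e ≤ G → 2 ^ (e * h) ≤ 2 ^ (G * h) := fun e he => hpow _ (Nat.mul_le_mul_right _ he)
  have hle : ∀ e, e ≤ e * h := fun e => Nat.le_mul_of_pos_right _ hh1
  have hbig := (mul_pow_le_two_pow (2 + k * 4 ^ k + cJ + B) (k + 2) h hh1).trans
    (hGE _ hG5)
  have hp1 : 1 ≤ h ^ (k + 2) := Nat.one_le_pow _ _ hh1
  have hph : h ≤ h ^ (k + 2) := Nat.le_self_pow (by omega) _
  have hph2 : h ^ 2 ≤ h ^ (k + 2) := Nat.pow_le_pow_right hh1 (by omega)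
  have hphk : h ^ k ≤ h ^ (k + 2) := Nat.pow_le_pow_right hh1 (by omega)
  have h4k : (2 * n) ^ k ≤ 4 ^ k * h ^ k := by
    rw [← mul_pow]
    exact Nat.pow_le_pow_left (by omega) _
  have h4k' : (2 * n) ^ k ≤ 4 ^ k * h ^ (k + 2) := h4k.trans (Nat.mul_le_mul_left _ hphk)
  have hkk : k * (2 * n) ^ k ≤ k * 4 ^ k * h ^ (k + 2) := by
    rw [mul_assoc]; exact Nat.mul_le_mul_left _ h4k'
  have hexp : (2 + k * 4 ^ k + cJ + B) * h ^ (k + 2) = 2 * h ^ (k + 2) + k * 4 ^ k * h ^ (k + 2) +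
      cJ * h ^ (k + 2) + B * h ^ (k + 2) := by ring
  have hBh : B * h ≤ B * h ^ (k + 2) := Nat.mul_le_mul_left _ hph
  have hBexp : B * h = A * h + 6 * h + 2 ^ k * h := by rw [hB]; ring
  have h2k : 2 ^ k ≤ 2 ^ k * h := hle _
  have hJ : (2 * n) ^ k + A * h * (A * h + 2) ≤ cJ * h ^ (k + 2) := by
    have h1 : A * h * (A * h + 2) ≤ A * (A + 2) * h ^ 2 := by
      calc A * h * (A * h + 2) ≤ A * h * (A * h + 2 * h) := Nat.mul_le_mul_left _ (by omega)
        _ = _ := by ring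
    have h2 : A * (A + 2) * h ^ 2 ≤ A * (A + 2) * h ^ (k + 2) := Nat.mul_le_mul_left _ hph2
    rw [hcJ, add_mul]
    omega
  have hS64 : 64 * 2 ^ (G * h) ≤ 2 ^ w := by
    rw [show 64 = 2 ^ 6 by norm_num, ← pow_add]
    refine Nat.pow_le_pow_right (by norm_num) ?_
    rw [add_mul] at hwh
    omega
  have hNd : 2 ^ h * d h ≤ 2 ^ ((E + 1) * h) := by
    calc 2 ^ h * d h ≤ 2 ^ h * 2 ^ (E * h) := Nat.mul_le_mul_left _ hdE
      _ = _ := by rw [← pow_add]; congr 1; ring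
  have hsize : 3 + 2 * (2 ^ h * d h) ≤ 2 ^ (G * h) := by
    refine le_trans ?_ (hGE (E + 4) hG4)
    have h1 : 2 ^ ((E + 4) * h) = 2 ^ ((E + 1) * h) * 2 ^ (3 * h) := by rw [← pow_add]; congr 1; ring
    have h2 : 2 ^ 3 ≤ 2 ^ (3 * h) := Nat.pow_le_pow_right (by norm_num) (by omega)
    have h3 : 2 ^ ((E + 1) * h) * 2 ^ 3 ≤ 2 ^ ((E + 1) * h) * 2 ^ (3 * h) := Nat.mul_le_mul_left _ h2
    have h4 : 1 ≤ 2 ^ ((E + 1) * h) := Nat.one_le_two_pow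
    omega
  have hw₀ : 2 ^ (c * (Nat.log 2 (2 ^ h * d h) + 1)) ≤ 2 ^ (G * h) := by
    refine hpow _ ?_
    have h1 : Nat.log 2 (2 ^ h * d h) ≤ (E + 1) * h := by
      calc _ ≤ Nat.log 2 (2 ^ ((E + 1) * h)) := Nat.log_mono_right hNd
        _ = _ := Nat.log_pow (by norm_num) _
    calc c * (Nat.log 2 (2 ^ h * d h) + 1) ≤ c * ((E + 1) * h + h) := Nat.mul_le_mul_left _ (by omega)
      _ = c * (E + 2) * h := by ring
      _ ≤ G * h := Nat.mul_le_mul_right _ hG3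
  have hL : (2 ^ (A * h) + 6) * 2 ^ (G * h) ≤ 2 ^ w := by
    calc (2 ^ (A * h) + 6) * 2 ^ (G * h) ≤ (2 ^ (A * h) * 2 ^ 6) * 2 ^ (G * h) := by
          refine Nat.mul_le_mul_right _ ?_
          have : 1 ≤ 2 ^ (A * h) := Nat.one_le_two_pow
          omega
      _ = 2 ^ ((A + G) * h + 6) := by rw [← pow_add, ← pow_add]; congr 1; ring
      _ ≤ _ := Nat.pow_le_pow_right (by norm_num) hwh
  have hqk : q * 1 ≤ q * k := Nat.mul_le_mul_left _ hk
  have hpar : Par k q σ (4 * h) := ⟨by omega, hσ, by omega, by omega, by omega⟩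
  have hqkG : q * k ≤ G * h := ((hle _).trans (Nat.mul_le_mul_right _ hG2))
  set X : ℝ := ((2 ^ h : ℕ) : ℝ) ^ (2 - ε) with hX
  have h2h : (1 : ℝ) ≤ ((2 ^ h : ℕ) : ℝ) := by exact_mod_cast Nat.one_le_two_pow
  have hX2 : ((2 ^ h : ℕ) : ℝ) ≤ X := by
    conv_lhs => rw [← Real.rpow_one ((2 ^ h : ℕ) : ℝ)]
    exact Real.rpow_le_rpow_of_exponent_le h2h (by linarith)
  have hX1 : 1 ≤ X := h2h.trans hX2
  set Z : ℝ := (2 : ℝ) ^ (ε / 4 * h) with hZ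
  have hZ1 : 1 ≤ Z := Real.one_le_rpow (by norm_num) (by positivity)
  have hτ : ((⌈C * X⌉₊ : ℕ) : ℝ) ≤ (|C| + 1) * X := by
    rcases le_or_gt (C * X) 0 with h1 | h1
    · rw [Nat.ceil_eq_zero.2 h1]
      simp only [Nat.cast_zero]
      positivity
    · have h2 := (Nat.ceil_lt_add_one h1.le).le
      have h3 : C * X ≤ |C| * X := mul_le_mul_of_nonneg_right (le_abs_self C) (by linarith)
      linarith
  have htime := time_le (h := h) (m := k + 5) (leaves := ⌊Z⌋₊) (J := cJ * h ^ (k + 2)) (Y := B * h)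
    (τ := ⌈C * X⌉₊) (τd := τd h) (r := p.regs) hh1 (by omega) hX2 hZ1 (hH h)
    (Nat.floor_le (by linarith)) (B := B) (by push_cast; ring) (c₁ := cJ)
    (by push_cast; rfl) (by positivity) (by positivity) hτ (by positivity)
    (hτd.trans (mul_le_mul_of_nonneg_right (le_abs_self Cd) (by linarith))) (by positivity)
  refine hP n φ h w (B * h) (cJ * h ^ (k + 2)) (d h) _ ⌈C * X⌉₊ (τd h) ⌊Z⌋₊ (C * X) _ hh hh1 hn2 hpar hk
    (hGE 4 hG1) (hpow _ hqkG) hS64 (by omega) (by rw [hpotA]; omega) (by omega)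
    (by omega) (by omega) (by rw [hpotA]; exact hJ) (by omega) hL (by rw [hpotA])
    (by rw [hpotA]; linarith) (by rw [hpotA]; linarith) hsize hw₀ (Nat.le_ceil _) hp
    (fun n' O hO => length_leaves_floor hk hpar hρ1 hb hρ hρη n' O hO)
    (hget _ w (hGE E (by omega)) hS64 ?_) (htime.trans ?_)
  · have h1 : d h ≤ 2 ^ h * d h := Nat.le_mul_of_pos_left _ (by positivity)
    omega
  · rw [mul_assoc]
    refine mul_le_mul_of_nonneg_left ?_ hCT0
    rw [hX, hZ]
    push_cast
    rw [← Real.rpow_natCast 2 h, ← Real.rpow_natCast _ 2, ← Real.rpow_mul (by norm_num),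
      ← Real.rpow_mul (by norm_num), ← Real.rpow_add (by norm_num), ← Real.rpow_add (by norm_num)]
    refine Real.rpow_le_rpow_of_exponent_le (by norm_num) ?_
    -- The exponent is `(2 - ε) * h` plus twice `(ε / 4) * h`, once for the leaves and once for the
    -- polynomial factors; halving `n` turns `2 - ε / 2` into `1 - ε / 4`.
    have h1 : (h : ℝ) ≤ n / 2 + h₀ := by
      have h2 : 2 * h ≤ n + 2 * h₀ := by omega
      have h3 : (2 : ℝ) * h ≤ n + 2 * h₀ := by exact_mod_cast h2
      linarith
    have h4 : (2 - ε / 2) * (h : ℝ) ≤ (2 - ε / 2) * (n / 2 + h₀) :=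
      mul_le_mul_of_nonneg_left h1 (by linarith)
    push_cast
    linarith


/-! ### The remaining cases -/

/-- A clause without literals is false, so it suffices to look at the number of clauses. This case
is separate because the choice of parameters needs `k ≥ 1`. -/
lemma ksatInTime_zero {T : ℕ → ℝ} (hT : ∀ n, 1 ≤ T n) : KSATInTime 0 T := by
  obtain ⟨P, hP⟩ := Cmd.exists_outputs (r₀ := Reg.ans) ctorIdx_injective ctorIdx_lt
    (.ite (.get (n 1)) (.set .ans (n 0)) (.set .ans (n 1))) rfl
  refine ⟨P, 1, 20, fun nv φ => ?_⟩
  have h1 : nv + 1 < 2 ^ (nv + 1) := Nat.lt_two_pow_self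
  have hlen : φ.clauses.length ≤ 1 := by simpa using length_clauses_le φ
  have hx : ∀ x ∈ φ.encode, x < 2 ^ (1 * (nv + 1)) := by
    rw [one_mul, encode_eq]
    intro x hx
    simp only [List.cons_append, List.nil_append, List.mem_cons, List.mem_flatMap, clauseWords,
      List.ofFn_zero, List.not_mem_nil, and_false, exists_const, or_false] at hx
    rcases hx with rfl | rfl <;> omega
  have hmem : φ.encode.getD 1 0 = φ.clauses.length := rfl
  have key : (Cmd.ite (.get (n 1)) (.set .ans (n 0)) (.set .ans (n 1))).Ho (1 * (nv + 1))
      (⟨fun _ => 0, fun a => φ.encode.getD a 0⟩ : Store Reg) 20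
      (fun t => t.reg .ans = if φ.clauses.length = 0 then 1 else 0) := by
    refine .ite (by simp) (by simp) (fun hne => .set (by simp) (by simp) ?_)
      (fun h0 => .set (by simp) (by simp) ?_)
    · simp only [Expr.val_get, Expr.val_num, hmem] at hne
      rw [if_neg hne]
      simp
    · simp only [Expr.val_get, Expr.val_num, hmem] at h0
      rw [if_pos h0]
      simp
  obtain ⟨t, ht, s', hexec, hans⟩ := key
  have hout := hP φ.encode _ t (20 * T nv) s' hx hexec (by
    have h2 : (t : ℝ) ≤ 20 := by exact_mod_cast ht
    have := hT nv
    linarith)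
  rw [hans] at hout
  have hsat : φ.Satisfiable ↔ φ.clauses.length = 0 := by
    rw [List.length_eq_zero_iff]
    constructor
    · rintro ⟨τ, hτ⟩
      refine List.eq_nil_iff_forall_not_mem.2 fun c hc => ?_
      obtain ⟨i, -⟩ := hτ c hc
      exact i.elim0
    · intro h
      exact ⟨fun _ => false, by simp [h]⟩
  refine ⟨fun h => ?_, fun h => ?_⟩
  · rwa [if_pos (hsat.1 h)] at hout
  · rwa [if_neg fun h' => h (hsat.2 h')] at hout

lemma outputs_mono {p : Program} {x : List ℕ} {T T' : ℝ} {w out : ℕ} (h : Outputs p x T w out)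
    (hT : T ≤ T') : Outputs p x T' w out := by
  obtain ⟨t, ht, h⟩ := h
  exact ⟨t, ht.trans hT, h⟩

lemma decides_mono {p : Program} {x : List ℕ} {T T' : ℝ} {w : ℕ} {Q : Prop} (h : Decides p x T w Q)
    (hT : T ≤ T') : Decides p x T' w Q :=
  ⟨fun hQ => outputs_mono (h.1 hQ) hT, fun hQ => outputs_mono (h.2 hQ) hT⟩

lemma mul_rpow_le {C x a b : ℝ} (hx : 1 ≤ x) (hab : a ≤ b) : C * x ^ a ≤ |C| * x ^ b :=
  mul_le_mul (le_abs_self C) (Real.rpow_le_rpow_of_exponent_le hx hab)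
    (Real.rpow_nonneg (by linarith) _) (abs_nonneg C)

/-- For `2 ^ h` vectors the logarithm is `h * log 2`. This is the only use of the growth of `d`. -/
lemma eventually_mul_le {d : ℕ → ℕ}
    (hd : (fun n : ℕ => Real.log (n : ℝ)) =o[atTop] (fun n : ℕ => (d n : ℝ))) (K : ℕ) :
    ∀ᶠ h in atTop, K * h ≤ d (2 ^ h) := by
  have hlog := Real.log_pos (show (1 : ℝ) < 2 by norm_num)
  have h1 := hd.def (show 0 < Real.log 2 / (K + 1) by positivity)
  have h2 : Tendsto (fun h : ℕ => 2 ^ h) atTop atTop :=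
    tendsto_pow_atTop_atTop_of_one_lt (by norm_num)
  filter_upwards [h2.eventually h1] with h hh
  have hnn : 0 ≤ Real.log ((2 ^ h : ℕ) : ℝ) := Real.log_natCast_nonneg _
  rw [Real.norm_of_nonneg hnn, Real.norm_of_nonneg (by positivity)] at hh
  push_cast at hh
  rw [Real.log_pow, div_mul_eq_mul_div, le_div_iff₀ (by positivity)] at hh
  have h3 : Real.log 2 * (h * ((K : ℝ) + 1)) ≤ Real.log 2 * d (2 ^ h) := by linarith
  have h4 := le_of_mul_le_mul_left h3 hlog
  have h5 : h * (K + 1) ≤ d (2 ^ h) := by exact_mod_cast h4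
  nlinarith

lemma sim_getDim_spec {pd : Program} {h w₀ out τ S w : ℕ} {T : ℝ}
    (ho : Outputs pd [2 ^ h] T w₀ out) (hT : T ≤ τ) (hw₀ : 2 ^ w₀ ≤ S) (hS : 64 * S ≤ 2 ^ w)
    {s : Store Reg} (hN : s.reg .N = 2 ^ h) (hb : s.reg .base = 3 * S)
    (hz : ∀ a, 3 * S ≤ a → s.mem a = 0) :
    (Cmd.put (v .base) (v .N);; .sim pd .base .dim).Ho w s (2 * τ + pd.regs + 5) (fun t =>
      t.reg .dim = out ∧ (∀ a < 3 * S, t.mem a = s.mem a) ∧ ∀ a, 4 * S ≤ a → t.mem a = 0) := by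
  have hpos : 0 < 2 ^ w₀ := by positivity
  refine .put_seq (by simp) (by simp) (by simp) (.sim (fun a => ?_) ho hT ?_ (by simp)
    fun m' h1 h2 => ⟨by simp, fun a ha => ?_, fun a ha => ?_⟩)
  · rcases a with _ | a
    · simp [hb, hN]
    · simp [hb]
      exact hz _ (by omega)
  · simp only [hb]
    omega
  · simp only [hb, Expr.val_var] at h1
    simp only
    rw [h1 a ha, Function.update_of_ne (by omega)]
  · simp only [hb, Expr.val_var] at h2
    simp only
    rw [h2 a (by omega), Function.update_of_ne (by omega), hz a (by omega)]

/-- Since smaller dimensions are allowed, `K * h` itself is used; one multiplication computes it,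
however hard `d` may be. Replacing `ε` by `min ε 1` makes `N^(2-ε)` at least `N`, the cost of
listing the vectors up to factors polynomial in `h`. -/
lemma not_tvppInTime_le (hSETH : SETH) {d : ℕ → ℕ}
    (hd : (fun n : ℕ => Real.log (n : ℝ)) =o[atTop] (fun n : ℕ => (d n : ℝ)))
    {ε : ℝ} (hε : 0 < ε) : ¬ TVPPInTime (fun n d' => d' ≤ d n) (fun n => (n : ℝ) ^ (2 - ε)) := by
  rintro ⟨p, c, C, hp⟩
  have hε' : 0 < min ε 1 := lt_min hε one_pos
  obtain ⟨k, hk⟩ := hSETH (min ε 1 / 4) (by positivity)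
  apply hk
  rcases Nat.eq_zero_or_pos k with rfl | hk0
  · refine ksatInTime_zero fun n => Real.one_le_rpow (by norm_num) ?_
    have := min_le_right ε 1
    exact mul_nonneg (by linarith) (Nat.cast_nonneg _)
  obtain ⟨K, hK⟩ := ksatInTime_of_solver hk0 hε' (min_le_right _ _)
  have hX : ∀ h : ℕ, (1 : ℝ) ≤ ((2 ^ h : ℕ) : ℝ) := fun h => by exact_mod_cast Nat.one_le_two_pow
  refine hK p c |C| (fun h => K * h) (K + 1) (.set .dim (n K * v .h)) 10 (fun _ => 10) ?_ ?_ ?_ ?_ ?_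
  · filter_upwards [eventually_ge_atTop 1] with h hh
    refine ⟨le_rfl, ?_⟩
    simpa using mul_pow_le_two_pow K 1 h hh
  · filter_upwards [eventually_mul_le hd K] with h hh I
    exact decides_mono (hp _ _ hh I) (mul_rpow_le (hX h) (by linarith [min_le_left ε 1]))
  · simp [Cmd.Writes]
  · filter_upwards [eventually_ge_atTop 1] with h hh S w hS hw hdw s hs _ _ hz
    refine .set ?_ (by simp) ?_
    · simp only [Expr.fits_mul, Expr.fits_num, Expr.fits_var, Expr.val_num, Expr.val_var, hs]
      exact ⟨(Nat.le_mul_of_pos_right K hh).trans_lt hdw, trivial, hdw⟩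
    · exact ⟨by simp [hs], fun a _ => rfl, fun a ha => hz a (by omega)⟩
  · refine Eventually.of_forall fun h => ?_
    have := Real.one_le_rpow (hX h) (show 0 ≤ 2 - min ε 1 by linarith [min_le_right ε 1])
    push_cast at this ⊢
    linarith

/-- The dimension is computed once, by simulation, and the unused columns stay zero. The exponent is
lowered to the minimum of `ε`, `δ` and `1`, so that this computation fits into the time as well.
Being an output word, `d (2 ^ h)` is at most exponential in `h`, hence so is the instance, and it
fits into a block. -/
lemma not_tvppInTime_eq (hSETH : SETH) {d : ℕ → ℕ}
    (hd : (fun n : ℕ => Real.log (n : ℝ)) =o[atTop] (fun n : ℕ => (d n : ℝ)))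
    {ε : ℝ} (hε : 0 < ε) (hcomp : SubquadraticTimeComputable d) :
    ¬ TVPPInTime (fun n d' => d' = d n) (fun n => (n : ℝ) ^ (2 - ε)) := by
  rintro ⟨p, c, C, hp⟩
  obtain ⟨pd, cd, Cd, δ, hδ, hpd⟩ := hcomp
  set ε' := min (min ε δ) 1 with hε'
  have hε0 : 0 < ε' := lt_min (lt_min hε hδ) one_pos
  have hε1 : ε' ≤ 1 := min_le_right _ _
  have hεε : ε' ≤ ε := (min_le_left _ _).trans (min_le_left _ _)
  have hεδ : ε' ≤ δ := (min_le_left _ _).trans (min_le_right _ _)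
  obtain ⟨k, hk⟩ := hSETH (ε' / 4) (by positivity)
  apply hk
  rcases Nat.eq_zero_or_pos k with rfl | hk0
  · refine ksatInTime_zero fun n => Real.one_le_rpow (by norm_num) ?_
    exact mul_nonneg (by linarith) (Nat.cast_nonneg _)
  obtain ⟨K, hK⟩ := ksatInTime_of_solver hk0 hε0 hε1
  have hX : ∀ h : ℕ, (1 : ℝ) ≤ ((2 ^ h : ℕ) : ℝ) := fun h => by exact_mod_cast Nat.one_le_two_pow
  have hX' : ∀ h : ℕ, (1 : ℝ) ≤ ((2 ^ h : ℕ) : ℝ) ^ (2 - ε') := fun h =>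
    Real.one_le_rpow (hX h) (by linarith)
  have hw : ∀ h, 1 ≤ h → 2 ^ (cd * (Nat.log 2 (2 ^ h) + 1)) ≤ 2 ^ ((2 * cd) * h) := by
    intro h hh
    rw [Nat.log_pow (by norm_num)]
    refine Nat.pow_le_pow_right (by norm_num) ?_
    calc cd * (h + 1) ≤ cd * (2 * h) := Nat.mul_le_mul_left _ (by omega)
      _ = _ := by ring
  refine hK p c |C| (fun h => d (2 ^ h)) (2 * cd) (.put (v .base) (v .N);; .sim pd .base .dim)
    (2 * (|Cd| + 1) + pd.regs + 5)
    (fun h => 2 * ⌈Cd * ((2 ^ h : ℕ) : ℝ) ^ (2 - δ)⌉₊ + pd.regs + 5) ?_ ?_ ?_ ?_ ?_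
  · filter_upwards [eventually_mul_le hd K, eventually_ge_atTop 1] with h hh hh1
    refine ⟨hh, le_trans ?_ (hw h hh1)⟩
    obtain ⟨t, -, -, hout, hb⟩ := hpd (2 ^ h) Nat.one_le_two_pow
    rw [← hout]
    exact (hb t le_rfl 0).1.le
  · exact Eventually.of_forall fun h I =>
      decides_mono (hp _ _ rfl I) (mul_rpow_le (hX h) (by linarith))
  · simp [Cmd.Writes]
  · filter_upwards [eventually_ge_atTop 1] with h hh S w hS hw' _ s _ hN hb hz
    exact sim_getDim_spec (hpd (2 ^ h) Nat.one_le_two_pow) (Nat.le_ceil _) ((hw h hh).trans hS) hw' hN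
      hb hz
  · refine Eventually.of_forall fun h => ?_
    set X := ((2 ^ h : ℕ) : ℝ) ^ (2 - ε') with hXdef
    have h1 : Cd * ((2 ^ h : ℕ) : ℝ) ^ (2 - δ) ≤ |Cd| * X := mul_rpow_le (hX h) (by linarith)
    have h2 : (⌈Cd * ((2 ^ h : ℕ) : ℝ) ^ (2 - δ)⌉₊ : ℝ) ≤ |Cd| * X + 1 := by
      refine (Nat.cast_le.2 (Nat.ceil_mono h1)).trans (Nat.ceil_lt_add_one ?_).le
      have := hX' h
      positivity
    have h3 : (pd.regs : ℝ) + 5 ≤ (pd.regs + 5) * X :=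
      le_mul_of_one_le_right (by positivity) (hX' h)
    have h4 := hX' h
    push_cast at h2 ⊢
    linarith

end Reduction

theorem mainTheorem5 (hSETH : SETH) (d : ℕ → ℕ)
    (hd : (fun n : ℕ => Real.log (n : ℝ)) =o[Filter.atTop] (fun n : ℕ => (d n : ℝ)))
    (ε : ℝ) (hε : 0 < ε) :
    ¬ TVPPInTime (fun n d' => d' ≤ d n) (fun n => (n : ℝ) ^ (2 - ε)) ∧
    (SubquadraticTimeComputable d →
      ¬ TVPPInTime (fun n d' => d' = d n) (fun n => (n : ℝ) ^ (2 - ε))) :=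
  ⟨Reduction.not_tvppInTime_le hSETH hd hε, Reduction.not_tvppInTime_eq hSETH hd hε⟩
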